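/- For $\nu\in\mathbb C$ and $-1<x<1$ let $P_\nu(x)={}_2F_1\!\left(-\nu,\nu+1;1;\tfrac{1-x}2\right)$ be the Legendre function of the first kind, and for $\mu,\nu\in\mathbb C$ put $$T_{\mu,\nu}=\int_{-1}^1P_\mu(x)P_\nu(x)P_\nu(-x)\,dx,\qquad U_{\mu,\nu}=\int_{-1}^1\frac{P_\mu(x)+P_\mu(-x)}2\,[P_\nu(x)]^2\,dx .$$ For complex $\varepsilon$ near $0$ let $$c_{\mu,\nu}(\varepsilon)=\frac{\Gamma(\frac12+\varepsilon)\,\Gamma(-\nu+\varepsilon)\,\Gamma(\nu+1+\varepsilon)}{\Gamma(1+\varepsilon)\,\Gamma(\frac{2-\mu}2+\varepsilon)\,\Gamma(\frac{\mu+3}2+\varepsilon)},\qquad F_{\mu,\nu}(\varepsilon)=\frac{c_{\mu,\nu}(\varepsilon)}{c_{\mu,\nu}(0)}\;{}_4F_3\!\left(\left.\begin{matrix}1,\ \frac12+\varepsilon,\ -\nu+\varepsilon,\ \nu+1+\varepsilon\\ 1+\varepsilon,\ \frac{2-\mu}2+\varepsilon,\ \frac{\mu+3}2+\varepsilon\end{matrix}\right|1\right),$$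 where ${}_pF_q(a_1,\dots,a_p;b_1,\dots,b_q\,|\,t)=\sum_{k\ge0}\frac{(a_1)_k\cdots(a_p)_k}{(b_1)_k\cdots(b_q)_k}\frac{t^k}{k!}$ and $(a)_k=a(a+1)\cdots(a+k-1)$. **Theorem.** Let $\mu,\nu\in\mathbb C\smallsetminus\mathbb Z$. Then both integrals converge absolutely, the ${}_4F_3$ series converges absolutely for all $\varepsilon$ in a neighbourhood of $0$, $F_{\mu,\nu}$ is analytic at $\varepsilon=0$, and $$T_{\mu,\nu}=\frac{2\sin(\mu\pi)\sin(\nu\pi)}{\mu(\mu+1)\pi^2}\,F_{\mu,\nu}'(0),\qquad U_{\mu,\nu}=\frac{\sin(\mu\pi)\sin^2(\nu\pi)}{\mu(\mu+1)\pi^3}\,F_{\mu,\nu}''(0).$$ -/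

import Mathlib

open Filter Topology

/-- The Legendre function of the first kind of complex degree `ν` on the cut `-1 < x < 1`,
`P_ν(x) = ₂F₁(-ν, ν + 1; 1; (1 - x) / 2)`. -/
noncomputable def legendreFn (ν : ℂ) (x : ℝ) : ℂ :=
  ₂F₁ (-ν) (ν + 1) (1 : ℂ) (((1 - x) / 2 : ℝ) : ℂ)

/-- The integrand `P_μ(x) P_ν(x) P_ν(-x)`. -/
noncomputable def cgIntegrandT (μ ν : ℂ) (x : ℝ) : ℂ :=
  legendreFn μ x * legendreFn ν x * legendreFn ν (-x)

/-- The integrand `(P_μ(x) + P_μ(-x)) / 2 * P_ν(x) ^ 2`. -/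
noncomputable def cgIntegrandU (μ ν : ℂ) (x : ℝ) : ℂ :=
  (legendreFn μ x + legendreFn μ (-x)) / 2 * legendreFn ν x ^ 2

/-- `T_{μ,ν}`. -/
noncomputable def cgT (μ ν : ℂ) : ℂ := ∫ x in (-1 : ℝ)..1, cgIntegrandT μ ν x

/-- `U_{μ,ν}`. -/
noncomputable def cgU (μ ν : ℂ) : ℂ := ∫ x in (-1 : ℝ)..1, cgIntegrandU μ ν x

/-- The `k`-th term of the generalized hypergeometric series with upper parameters `as` and
lower parameters `bs` at the point `t`; `(ascPochhammer ℂ k).eval a` is the rising factorial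
`(a)_k = a (a + 1) ⋯ (a + k - 1)`. -/
noncomputable def hypergeometricTerm (as bs : List ℂ) (t : ℂ) (k : ℕ) : ℂ :=
  (as.map fun a => (ascPochhammer ℂ k).eval a).prod /
    (bs.map fun b => (ascPochhammer ℂ k).eval b).prod * (t ^ k / (k.factorial : ℂ))

/-- The generalized hypergeometric series `_pF_q(as; bs | t)`. -/
noncomputable def hypergeometricPFQ (as bs : List ℂ) (t : ℂ) : ℂ :=
  ∑' k : ℕ, hypergeometricTerm as bs t k

/-- The upper parameters `1, 1/2 + ε, -ν + ε, ν + 1 + ε`. -/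
noncomputable def upperParams (ν ε : ℂ) : List ℂ :=
  [1, 1 / 2 + ε, -ν + ε, ν + 1 + ε]

/-- The lower parameters `1 + ε, (2 - μ)/2 + ε, (μ + 3)/2 + ε`. -/
noncomputable def lowerParams (μ ε : ℂ) : List ℂ :=
  [1 + ε, (2 - μ) / 2 + ε, (μ + 3) / 2 + ε]

/-- `c_{μ,ν}(ε)`. -/
noncomputable def cCoeff (μ ν ε : ℂ) : ℂ :=
  Complex.Gamma (1 / 2 + ε) * Complex.Gamma (-ν + ε) * Complex.Gamma (ν + 1 + ε) /
    (Complex.Gamma (1 + ε) * Complex.Gamma ((2 - μ) / 2 + ε) * Complex.Gamma ((μ + 3) / 2 + ε))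

/-- The normalized family `c_{μ,ν}(ε) / c_{μ,ν}(0) * ₄F₃(⋯ | 1)`. -/
noncomputable def normalizedFamily (μ ν ε : ℂ) : ℂ :=
  cCoeff μ ν ε / cCoeff μ ν 0 * hypergeometricPFQ (upperParams ν ε) (lowerParams μ ε) 1

/-! Put z = 1 - x², S_ν = sin(νπ)/π and a(s) = Γ(s+1/2)Γ(s-ν)Γ(s+ν+1)/Γ(s+1)³ (`symSqQuot`). The
Frobenius series Φ_ε = ∑ a(k+ε) z^(k+ε) satisfies the third-order equation for products of two
Legendre functions (the symmetric square) up to a multiple of ε³ z^ε. Its first two ε-derivatives at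
0 are therefore solutions, with a logarithm and a squared logarithm.

Every solution on (0,1) is a quadratic form in P_ν(x), P_ν(-x), since these have Wronskian -2S_ν ≠ 0
for non-integral ν. The two logarithmic solutions have vanishing derivative at x = 0, which leaves
only the even forms P_ν(x)² + P_ν(-x)² and P_ν(x)P_ν(-x). Comparing logarithmic growth as x → 1
fixes the constants: P_ν(x)P_ν(-x) = (S_ν/a(0)) ∂Φ and P_ν(x)² + P_ν(-x)² = (S_ν²/a(0)) ∂²Φ, the
derivatives being taken at ε = 0 (`legendreFn_mul_neg_eq`, `legendreFn_sq_add_sq_eq`).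

The moments M(s) = ∫ P_μ(x)(1-x²)^s dx satisfy a first-order recurrence, solved by the Gamma
quotient m(s) = `momentQuot`. The ratio M/m is 1-periodic; comparing sizes along n + ε and n as n →
∞ shows that it is constant near 0 (`logMoment_eq`). Moreover M(0) = 2S_μ/(μ(μ+1)).

Finally a(s)m(s) = c_{μ,ν}(s), so integrating Φ_ε against P_μ formally gives (M(0)/m(0)) ∑ c(k+ε) =
a(0)M(0) F(ε). One ε-derivative at 0 gives T. Two give U, with a factor 1/2 because U symmetrizes
P_μ. Rigorously, the jets of a(s)M(s) are compared at each k (`jet_mul_logMoment`), and sums,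
integrals and derivatives are interchanged by `hasSum_integral_logSum` and
`hasSum_deriv_deriv_of_summable`. The bounds needed come from asymptotics of Gamma quotients uniform
in ε, combined with Cauchy estimates. -/

/-! ### Uniform asymptotics of Γ(k+b)/Γ(k). -/

theorem norm_one_add_mul_exp_neg_mul_log_sub_one_le {B : ℝ} {b : ℂ} {u : ℝ} (hb : ‖b‖ ≤ B)
    (hu : 0 < u) (hBu : B * u ≤ 1) :
    ‖(1 + b * u) * Complex.exp (-b * (Real.log (1 + u) : ℝ)) - 1‖ ≤ (B + 3 * B ^ 2) * u ^ 2 := by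
  have hB : 0 ≤ B := (norm_nonneg _).trans hb
  set L := Real.log (1 + u) with hL
  have hL0 : 0 ≤ L := Real.log_nonneg (by linarith)
  have hL1 : L ≤ u := by
    have := Real.log_le_sub_one_of_pos (show 0 < 1 + u by linarith)
    linarith
  have hL2 : u - u ^ 2 ≤ L := by
    have h := Real.one_sub_inv_le_log_of_pos (show 0 < 1 + u by linarith)
    have h2 : u - u ^ 2 ≤ 1 - (1 + u)⁻¹ := by
      have : 1 - (1 + u)⁻¹ - (u - u ^ 2) = u ^ 3 / (1 + u) := by
        field_simp
        ring
      have h3 : 0 ≤ u ^ 3 / (1 + u) := by positivity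
      linarith
    linarith
  set w : ℂ := -b * (L : ℝ) with hw
  have hwn : ‖w‖ ≤ B * u := by
    rw [hw, norm_mul, norm_neg, Complex.norm_real, Real.norm_eq_abs, abs_of_nonneg hL0]
    gcongr
  obtain ⟨E, hE⟩ : ∃ E, E = Complex.exp w - 1 - w := ⟨_, rfl⟩
  have hEn : ‖E‖ ≤ (B * u) ^ 2 := by
    rw [hE]
    refine (Complex.norm_exp_sub_one_sub_id_le (hwn.trans hBu)).trans ?_
    gcongr
  have hexp : Complex.exp w = 1 + w + E := by rw [hE]; ring
  -- The first-order terms bu and -bL nearly cancel, because L = log(1+u) differs from u by at most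
  -- u². The remaining terms are quadratic in u.
  have key : (1 + b * u) * Complex.exp w - 1
      = b * ((u - L : ℝ) : ℂ) - b ^ 2 * ((u * L : ℝ) : ℂ) + E * (1 + b * u) := by
    rw [hexp, hw]; push_cast; ring
  rw [key]
  have h1 : ‖b * ((u - L : ℝ) : ℂ)‖ ≤ B * u ^ 2 := by
    rw [norm_mul, Complex.norm_real, Real.norm_eq_abs, abs_of_nonneg (by linarith)]
    gcongr
    linarith
  have h2 : ‖b ^ 2 * ((u * L : ℝ) : ℂ)‖ ≤ B ^ 2 * (u * u) := by
    rw [norm_mul, norm_pow, Complex.norm_real, Real.norm_eq_abs, abs_of_nonneg (by positivity)]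
    gcongr
  have h3 : ‖E * (1 + b * u)‖ ≤ (B * u) ^ 2 * 2 := by
    rw [norm_mul]
    gcongr
    refine (norm_add_le _ _).trans ?_
    rw [norm_one, norm_mul, Complex.norm_real, Real.norm_eq_abs, abs_of_pos hu]
    have : ‖b‖ * u ≤ B * u := by gcongr
    linarith
  calc _ ≤ _ := (norm_add_le _ _).trans (add_le_add_left (norm_sub_le _ _) _)
    _ ≤ B * u ^ 2 + B ^ 2 * (u * u) + (B * u) ^ 2 * 2 := by gcongr
    _ = _ := by ring

/-- The quotient `Γ(k + b) / (Γ(k) k ^ b)`. -/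
noncomputable def gammaShiftQuot (k : ℕ) (b : ℂ) : ℂ :=
  Complex.Gamma (k + b) / (Complex.Gamma k * (k : ℂ) ^ b)

/-- This is Euler's limit for Γ(b), rewritten with (b)_(k+1) = Γ(b+k+1)/Γ(b). The extra factor 1 +
b/k tends to 1. -/
theorem gammaShiftQuot_tendsto {b : ℂ} (hb : ∀ m : ℕ, b ≠ -m) :
    Tendsto (fun k => gammaShiftQuot k b) atTop (𝓝 1) := by
  have hG : Complex.Gamma b ≠ 0 := Complex.Gamma_ne_zero hb
  have hbm (m : ℕ) : b + m ≠ 0 := fun h => hb m (eq_neg_of_add_eq_zero_left h)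
  have h1 : Tendsto (fun k : ℕ => Complex.Gamma b / Complex.GammaSeq b k * (1 + b / k)⁻¹) atTop
      (𝓝 (Complex.Gamma b / Complex.Gamma b * (1 + 0)⁻¹)) := by
    refine (tendsto_const_nhds.div (Complex.GammaSeq_tendsto_Gamma b) hG).mul
      (Tendsto.inv₀ (tendsto_const_nhds.add ?_) (by simp))
    exact tendsto_const_div_atTop_nhds_zero_nat b
  rw [div_self hG] at h1
  simp only [add_zero, inv_one, mul_one] at h1
  refine h1.congr' ?_
  filter_upwards [eventually_ge_atTop 1] with k hk
  have hk0 : (k : ℂ) ≠ 0 := by exact_mod_cast (by omega : k ≠ 0)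
  have hprod : ∏ j ∈ Finset.range (k + 1), (b + j) = Complex.Gamma (b + (k + 1 : ℕ)) /
      Complex.Gamma b := by
    rw [Complex.Gamma_add_nat_div_Gamma_eq b hb]
    induction k + 1 with
    | zero => simp
    | succ n ih => rw [Finset.prod_range_succ, ih, ascPochhammer_succ_eval]
  have hGk : Complex.Gamma (b + (k + 1 : ℕ)) = (b + k) * Complex.Gamma (b + k) := by
    push_cast
    rw [← add_assoc, Complex.Gamma_add_one _ (hbm k)]
  have hf : (k.factorial : ℂ) = k * Complex.Gamma k := by
    rw [← Complex.Gamma_nat_eq_factorial, Complex.Gamma_add_one _ hk0]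
  rw [gammaShiftQuot, Complex.GammaSeq, hprod, hGk, hf, add_comm (k : ℂ) b]
  have h2 : Complex.Gamma (b + k) ≠ 0 := Complex.Gamma_ne_zero fun m h => hb (m + k) (by
    push_cast; linear_combination h)
  have h3 : Complex.Gamma (k : ℂ) ≠ 0 := Complex.Gamma_ne_zero fun m h => by
    have : ((k + m : ℕ) : ℂ) = 0 := by push_cast; rw [h]; ring
    norm_cast at this; omega
  have h4 : (k : ℂ) ^ b ≠ 0 := by simp [Complex.cpow_eq_zero_iff, hk0]
  have h5 := hbm k
  have h6 : 1 + b / k = (b + k) / k := by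
    field_simp
    ring
  rw [h6]
  field_simp

theorem gammaShiftQuot_succ {b : ℂ} (hb : ∀ m : ℕ, b ≠ -m) {k : ℕ} (hk : 1 ≤ k) :
    gammaShiftQuot (k + 1) b = gammaShiftQuot k b *
      ((1 + b * ((1 / k : ℝ) : ℂ)) * Complex.exp (-b * (Real.log (1 + 1 / k) : ℝ))) := by
  have hk0 : (k : ℂ) ≠ 0 := by exact_mod_cast (by omega : k ≠ 0)
  have hkr : (0 : ℝ) < k := by exact_mod_cast hk
  have hk1 : (k : ℂ) + 1 ≠ 0 := by exact_mod_cast (by omega : k + 1 ≠ 0)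
  have hbk : (k : ℂ) + b ≠ 0 := fun h => hb k (by linear_combination h)
  have hp : ((k : ℂ) + 1) ^ b = (k : ℂ) ^ b * Complex.exp (b * (Real.log (1 + 1 / k) : ℝ)) := by
    rw [Complex.cpow_def_of_ne_zero hk0, Complex.cpow_def_of_ne_zero hk1, ← Complex.exp_add]
    congr 1
    have e : ((k : ℂ) + 1) = (((k : ℝ) + 1 : ℝ) : ℂ) := by push_cast; rfl
    have e2 : (1 : ℝ) + 1 / k = (k + 1) / k := by field_simp
    rw [e, ← Complex.ofReal_natCast, ← Complex.ofReal_log (by positivity),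
      ← Complex.ofReal_log (by positivity), e2, Real.log_div (by positivity) (by positivity)]
    push_cast; ring
  have h3 : Complex.Gamma (k : ℂ) ≠ 0 := Complex.Gamma_ne_zero fun m h => by
    have : ((k + m : ℕ) : ℂ) = 0 := by push_cast; rw [h]; ring
    norm_cast at this; omega
  have h4 : (k : ℂ) ^ b ≠ 0 := by simp [Complex.cpow_eq_zero_iff, hk0]
  rw [gammaShiftQuot, gammaShiftQuot]
  push_cast
  rw [show (k : ℂ) + 1 + b = (k + b) + 1 by ring, Complex.Gamma_add_one _ hbk,
    Complex.Gamma_add_one _ hk0]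
  rw [hp, neg_mul, Complex.exp_neg]
  have := Complex.exp_ne_zero (b * (Real.log (1 + 1 / k) : ℝ))
  field_simp

/-- For t ≥ 1, 1/t² ≤ 2/t - 2/(t+1), and the right-hand side telescopes. -/
theorem sum_inv_sq_shift_le {k : ℕ} (hk : 1 ≤ k) (m : ℕ) :
    ∑ i ∈ Finset.range m, (1 / ((k + i : ℕ) : ℝ)) ^ 2 ≤ (2 / k : ℝ) := by
  have hkr : (0 : ℝ) < k := by exact_mod_cast hk
  have : ∑ i ∈ Finset.range m, (1 / ((k + i : ℕ) : ℝ)) ^ 2 ≤ (2 / k - 2 / (k + m) : ℝ) := by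
    induction m with
    | zero => simp
    | succ m ih =>
      rw [Finset.sum_range_succ]
      have : (1 / ((k + m : ℕ) : ℝ)) ^ 2 ≤ (2 / (k + m) - 2 / (k + (m + 1)) : ℝ) := by
        push_cast
        rw [← add_assoc]
        have h0 : (1 : ℝ) ≤ k + m := by
          have : (1 : ℝ) ≤ k := by exact_mod_cast hk
          linarith [(Nat.cast_nonneg m : (0 : ℝ) ≤ m)]
        generalize (k : ℝ) + m = t at h0
        have e : (2 : ℝ) / t - 2 / (t + 1) - (1 / t) ^ 2 = (t - 1) / (t ^ 2 * (t + 1)) := by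
          field_simp; ring
        have e2 : 0 ≤ (t - 1) / (t ^ 2 * (t + 1)) := by
          apply div_nonneg <;> first | linarith | positivity
        linarith
      push_cast at this ih ⊢
      linarith
  have h2 : (0 : ℝ) ≤ 2 / (k + m) := by positivity
  linarith

/-- The consecutive ratios are 1 + O(1/j²) uniformly in ‖b‖ ≤ B. Hence the product of all ratios
beyond k is 1 + O(1/k), while the quotient itself tends to 1 for each fixed b. Reading the product
backwards from infinity transfers the uniformity to the quotient at k. -/
theorem gammaShiftQuot_asymp {B : ℝ} (hB : 0 ≤ B) : ∃ C : ℝ, ∃ K : ℕ, ∀ k ≥ K, ∀ b : ℂ, ‖b‖ ≤ B →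
    (∀ m : ℕ, b ≠ -m) → ‖gammaShiftQuot k b - 1‖ ≤ C * (1 / k) := by
  set D := (B + 3 * B ^ 2) * 2 with hD
  have hD0 : 0 ≤ D := by positivity
  -- `k ≥ B` gives B/k ≤ 1, as the ratio estimate requires; `k ≥ 4D` gives D/k ≤ 1/4, so that
  -- exp(D/k) - 1 ≤ 2D/k.
  refine ⟨4 * D, max 1 (max ⌈B⌉₊ ⌈4 * D⌉₊), fun k hk b hb hpole => ?_⟩
  have hk1 : 1 ≤ k := (le_max_left _ _).trans hk
  have hkB : B ≤ k := Nat.ceil_le.1 (((le_max_left _ _).trans (le_max_right _ _)).trans hk)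
  have hkD : 4 * D ≤ k := Nat.ceil_le.1 (((le_max_right _ _).trans (le_max_right _ _)).trans hk)
  have hkr : (0 : ℝ) < k := by exact_mod_cast hk1
  let f : ℕ → ℂ := fun j =>
    (1 + b * ((1 / j : ℝ) : ℂ)) * Complex.exp (-b * (Real.log (1 + 1 / j) : ℝ)) - 1
  have hf (i : ℕ) : ‖f (k + i)‖ ≤ (B + 3 * B ^ 2) * (1 / ((k + i : ℕ) : ℝ)) ^ 2 := by
    have hki : (0 : ℝ) < ((k + i : ℕ) : ℝ) := by exact_mod_cast (by omega)
    refine norm_one_add_mul_exp_neg_mul_log_sub_one_le hb (by positivity) ?_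
    rw [mul_one_div, div_le_one hki]
    push_cast
    linarith [(Nat.cast_nonneg i : (0 : ℝ) ≤ i)]
  have hprod (m : ℕ) : gammaShiftQuot (k + m) b =
      gammaShiftQuot k b * ∏ i ∈ Finset.range m, (1 + f (k + i)) := by
    induction m with
    | zero => simp
    | succ m ih =>
      rw [Finset.prod_range_succ, ← mul_assoc, ← ih, ← add_assoc,
        gammaShiftQuot_succ hpole (by omega)]
      simp only [f]
      ring_nf
  set q := gammaShiftQuot k b
  have hδ (m : ℕ) : ‖∏ i ∈ Finset.range m, (1 + f (k + i)) - 1‖ ≤ 2 * (D / k) := by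
    refine (Finset.norm_prod_one_add_sub_one_le _ _).trans ?_
    have h1 : ∑ i ∈ Finset.range m, ‖f (k + i)‖ ≤ D / k := by
      calc _ ≤ ∑ i ∈ Finset.range m, (B + 3 * B ^ 2) * (1 / ((k + i : ℕ) : ℝ)) ^ 2 :=
            Finset.sum_le_sum fun i _ => hf i
        _ ≤ (B + 3 * B ^ 2) * (2 / k) := by
            rw [← Finset.mul_sum]
            gcongr
            exact sum_inv_sq_shift_le hk1 m
        _ = _ := by rw [hD]; ring
    have h2 : D / k ≤ 1 / 4 := by rw [div_le_iff₀ hkr]; linarith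
    have h3 : 0 ≤ D / k := by positivity
    calc _ ≤ Real.exp (D / k) - 1 := by gcongr
      _ ≤ _ := by
        have := Real.norm_exp_sub_one_sub_id_le (x := D / k)
          (by rw [Real.norm_eq_abs, abs_of_nonneg h3]; linarith)
        rw [Real.norm_eq_abs, Real.norm_eq_abs, sq_abs] at this
        have := (abs_le.1 this).2
        nlinarith
  have hlim : Tendsto (fun m => ‖gammaShiftQuot (k + m) b - q‖) atTop (𝓝 ‖1 - q‖) := by
    refine (Tendsto.sub_const ?_ _).norm
    have := (gammaShiftQuot_tendsto hpole).comp (tendsto_add_atTop_nat k)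
    refine this.congr fun m => ?_
    simp [add_comm]
  have hle : ‖1 - q‖ ≤ ‖q‖ * (2 * (D / k)) := by
    refine le_of_tendsto' hlim fun m => ?_
    rw [hprod m, show q * ∏ i ∈ Finset.range m, (1 + f (k + i)) - q =
      q * (∏ i ∈ Finset.range m, (1 + f (k + i)) - 1) by ring, norm_mul]
    gcongr
    exact hδ m
  have hq : ‖q‖ ≤ 1 + ‖1 - q‖ := by
    calc ‖q‖ = ‖1 - (1 - q)‖ := by congr 1; ring
      _ ≤ _ := by simpa using norm_sub_le (1 : ℂ) (1 - q)
  have h2 : D / k ≤ 1 / 4 := by rw [div_le_iff₀ hkr]; linarith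
  have h3 : 0 ≤ D / k := by positivity
  rw [norm_sub_rev, show 4 * D * (1 / (k : ℝ)) = 4 * (D / k) by ring]
  -- ‖1-q‖ ≤ (1 + ‖1-q‖)·2D/k with 2D/k ≤ 1/2, so the term on the right is absorbed at the cost of
  -- doubling the constant.
  nlinarith [norm_nonneg (1 - q)]

/-! ### Quotients of three Gamma functions by three. -/

/-- Complex numbers at which the Gamma function is regular. -/
def GammaRegular (s : ℂ) : Prop := ∀ m : ℕ, s ≠ -m

theorem GammaRegular.add_natCast {s : ℂ} (h : GammaRegular s) (k : ℕ) : GammaRegular (s + k) :=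
  fun m hm => h (m + k) (by push_cast; linear_combination hm)

theorem GammaRegular.natCast_add {s : ℂ} (h : GammaRegular s) (k : ℕ) : GammaRegular (k + s) := by
  rw [add_comm]; exact h.add_natCast k

/-- A quotient of products of three shifted Gamma functions. -/
noncomputable def gammaQuot (a₁ a₂ a₃ b₁ b₂ b₃ s : ℂ) : ℂ :=
  Complex.Gamma (s + a₁) * Complex.Gamma (s + a₂) * Complex.Gamma (s + a₃) /
    (Complex.Gamma (s + b₁) * Complex.Gamma (s + b₂) * Complex.Gamma (s + b₃))

/-- `s` is neither a zero nor a pole of `gammaQuot a₁ a₂ a₃ b₁ b₂ b₃`. -/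
structure GammaQuotRegular (a₁ a₂ a₃ b₁ b₂ b₃ s : ℂ) : Prop where
  a₁ : GammaRegular (s + a₁)
  a₂ : GammaRegular (s + a₂)
  a₃ : GammaRegular (s + a₃)
  b₁ : GammaRegular (s + b₁)
  b₂ : GammaRegular (s + b₂)
  b₃ : GammaRegular (s + b₃)

section
variable {a₁ a₂ a₃ b₁ b₂ b₃ s : ℂ}

theorem GammaQuotRegular.natCast_add (h : GammaQuotRegular a₁ a₂ a₃ b₁ b₂ b₃ s) (k : ℕ) :
    GammaQuotRegular a₁ a₂ a₃ b₁ b₂ b₃ (k + s) := by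
  constructor <;> rw [add_assoc] <;> apply GammaRegular.natCast_add
  exacts [h.a₁, h.a₂, h.a₃, h.b₁, h.b₂, h.b₃]

theorem gammaQuot_ne_zero (h : GammaQuotRegular a₁ a₂ a₃ b₁ b₂ b₃ s) :
    gammaQuot a₁ a₂ a₃ b₁ b₂ b₃ s ≠ 0 := by
  have g {t : ℂ} (h : GammaRegular t) := Complex.Gamma_ne_zero h
  exact div_ne_zero (mul_ne_zero (mul_ne_zero (g h.a₁) (g h.a₂)) (g h.a₃))
    (mul_ne_zero (mul_ne_zero (g h.b₁) (g h.b₂)) (g h.b₃))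

theorem differentiableAt_gammaQuot (h : GammaQuotRegular a₁ a₂ a₃ b₁ b₂ b₃ s) :
    DifferentiableAt ℂ (gammaQuot a₁ a₂ a₃ b₁ b₂ b₃) s := by
  have d {c : ℂ} (h : GammaRegular (s + c)) :
      DifferentiableAt ℂ (fun s => Complex.Gamma (s + c)) s :=
    (Complex.differentiableAt_Gamma _ h).comp s (differentiableAt_id.add_const c)
  have g {t : ℂ} (h : GammaRegular t) := Complex.Gamma_ne_zero h
  exact (((d h.a₁).mul (d h.a₂)).mul (d h.a₃)).div (((d h.b₁).mul (d h.b₂)).mul (d h.b₃))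
    (mul_ne_zero (mul_ne_zero (g h.b₁) (g h.b₂)) (g h.b₃))

theorem gammaQuot_add_one (h : GammaQuotRegular a₁ a₂ a₃ b₁ b₂ b₃ s) :
    gammaQuot a₁ a₂ a₃ b₁ b₂ b₃ (s + 1) * ((s + b₁) * (s + b₂) * (s + b₃)) =
      gammaQuot a₁ a₂ a₃ b₁ b₂ b₃ s * ((s + a₁) * (s + a₂) * (s + a₃)) := by
  have e {c : ℂ} (h : GammaRegular (s + c)) :
      Complex.Gamma (s + 1 + c) = (s + c) * Complex.Gamma (s + c) := by
    rw [← Complex.Gamma_add_one _ (by simpa using h 0)]; ring_nf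
  have g {t : ℂ} (h : GammaRegular t) := Complex.Gamma_ne_zero h
  have n {t : ℂ} (h : GammaRegular t) : t ≠ 0 := by simpa using h 0
  rw [gammaQuot, gammaQuot, e h.a₁, e h.a₂, e h.a₃, e h.b₁, e h.b₂, e h.b₃]
  have := g h.b₁; have := g h.b₂; have := g h.b₃
  have := n h.b₁; have := n h.b₂; have := n h.b₃
  field_simp
end

/-! ### Asymptotics of Gamma quotients, uniform in a small shift. -/

open Asymptotics

/-- The uniformity filter used for asymptotics as `k → ∞`, uniformly for `‖ε‖ ≤ r`. -/
noncomputable def unifFilter (r : ℝ) : Filter (ℕ × ℂ) := atTop ×ˢ 𝓟 (Metric.closedBall 0 r)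

theorem eventually_unifFilter {r : ℝ} {p : ℕ × ℂ → Prop} :
    (∀ᶠ x in unifFilter r, p x) ↔ ∃ K : ℕ, ∀ k ≥ K, ∀ ε : ℂ, ‖ε‖ ≤ r → p (k, ε) := by
  rw [unifFilter, (atTop_basis.prod (hasBasis_principal _)).eventually_iff]
  constructor
  · rintro ⟨⟨K, _⟩, -, h⟩
    exact ⟨K, fun k hk ε hε => h ⟨hk, by simpa using hε⟩⟩
  · rintro ⟨K, h⟩
    exact ⟨⟨K, ()⟩, by simp, fun x hx => h x.1 hx.1 x.2 (by simpa using hx.2)⟩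

theorem tendsto_inv_unifFilter (r : ℝ) :
    Tendsto (fun x : ℕ × ℂ => 1 / (x.1 : ℝ)) (unifFilter r) (𝓝 0) :=
  tendsto_one_div_atTop_nhds_zero_nat.comp tendsto_fst

section
variable {α : Type*} {l : Filter α} {f g : α → ℂ} {u : α → ℝ}

theorem tendsto_one_of_isBigO_sub_one (hu : Tendsto u l (𝓝 0))
    (hf : (fun x => f x - 1) =O[l] u) : Tendsto f l (𝓝 1) := by
  simpa using (hf.trans_tendsto hu).add_const 1

theorem isBigO_mul_sub_one (hu : Tendsto u l (𝓝 0)) (hf : (fun x => f x - 1) =O[l] u)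
    (hg : (fun x => g x - 1) =O[l] u) : (fun x => f x * g x - 1) =O[l] u := by
  have h1 : (fun x => (f x - 1) * g x) =O[l] fun x => u x * 1 :=
    hf.mul ((tendsto_one_of_isBigO_sub_one hu hg).isBigO_one ℝ)
  simp only [mul_one] at h1
  refine (h1.add hg).congr_left fun x => ?_
  ring

theorem isBigO_inv_sub_one (hu : Tendsto u l (𝓝 0)) (hf : (fun x => f x - 1) =O[l] u) :
    (fun x => (f x)⁻¹ - 1) =O[l] u := by
  have hft := tendsto_one_of_isBigO_sub_one hu hf
  have hi : Tendsto (fun x => (f x)⁻¹) l (𝓝 1) := by simpa using hft.inv₀ one_ne_zero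
  have h1 : (fun x => (f x - 1) * -(f x)⁻¹) =O[l] fun x => u x * 1 :=
    hf.mul (hi.neg.isBigO_one ℝ)
  simp only [mul_one] at h1
  refine h1.congr' ?_ EventuallyEq.rfl
  filter_upwards [hft.eventually_ne one_ne_zero] with x hx
  field_simp
  ring
end

theorem gammaShiftQuot_isBigO {r : ℝ} (c : ℂ) (h : ∀ ε : ℂ, ‖ε‖ ≤ r → GammaRegular (ε + c)) :
    (fun x : ℕ × ℂ => gammaShiftQuot x.1 (x.2 + c) - 1) =O[unifFilter r]
      fun x => 1 / (x.1 : ℝ) := by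
  obtain ⟨C, K, hC⟩ := gammaShiftQuot_asymp (B := |r| + ‖c‖) (by positivity)
  refine IsBigO.of_bound C (eventually_unifFilter.2 ⟨K, fun k hk ε hε => ?_⟩)
  rw [Real.norm_of_nonneg (by positivity)]
  refine hC k hk _ ?_ (h ε hε)
  exact (norm_add_le _ _).trans (by linarith [le_abs_self r])

/-- With as many Gamma factors above as below, the powers of Γ(k) cancel and so does k^ε. The
remaining powers combine to k^(-σ), with an exponent independent of ε. -/
theorem gammaQuot_isBigO {r σ : ℝ} {a₁ a₂ a₃ b₁ b₂ b₃ : ℂ}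
    (h : ∀ ε : ℂ, ‖ε‖ ≤ r → GammaQuotRegular a₁ a₂ a₃ b₁ b₂ b₃ ε)
    (hσ : b₁ + b₂ + b₃ - a₁ - a₂ - a₃ = σ) :
    (fun x : ℕ × ℂ => gammaQuot a₁ a₂ a₃ b₁ b₂ b₃ (x.1 + x.2) * (x.1 : ℂ) ^ (σ : ℂ) - 1)
      =O[unifFilter r] fun x => 1 / (x.1 : ℝ) := by
  have hu := tendsto_inv_unifFilter r
  have A {f g : ℕ × ℂ → ℂ} := isBigO_mul_sub_one (f := f) (g := g) hu
  have I {f : ℕ × ℂ → ℂ} := isBigO_inv_sub_one (f := f) hu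
  have G (c : ℂ) := gammaShiftQuot_isBigO (r := r) c
  have key := A (A (A (G a₁ fun ε hε => (h ε hε).a₁) (G a₂ fun ε hε => (h ε hε).a₂))
    (G a₃ fun ε hε => (h ε hε).a₃)) (I (A (A (G b₁ fun ε hε => (h ε hε).b₁)
      (G b₂ fun ε hε => (h ε hε).b₂)) (G b₃ fun ε hε => (h ε hε).b₃)))
  refine key.congr' (eventually_unifFilter.2 ⟨1, fun k hk ε hε => ?_⟩) EventuallyEq.rfl
  have hk0 : (k : ℂ) ≠ 0 := by exact_mod_cast (by omega : k ≠ 0)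
  have h3 : Complex.Gamma (k : ℂ) ≠ 0 := Complex.Gamma_ne_zero fun m h => by
    have : ((k + m : ℕ) : ℂ) = 0 := by push_cast; rw [h]; ring
    norm_cast at this; omega
  have h4 (b : ℂ) : (k : ℂ) ^ b ≠ 0 := by simp [Complex.cpow_eq_zero_iff, hk0]
  have g {t : ℂ} (h : GammaRegular t) := Complex.Gamma_ne_zero h
  have hr := (h ε hε).natCast_add k
  have := g hr.b₁; have := g hr.b₂; have := g hr.b₃
  have hpow : (k : ℂ) ^ (σ : ℂ) * ((k : ℂ) ^ (ε + a₁) * (k : ℂ) ^ (ε + a₂) * (k : ℂ) ^ (ε + a₃)) =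
      (k : ℂ) ^ (ε + b₁) * (k : ℂ) ^ (ε + b₂) * (k : ℂ) ^ (ε + b₃) := by
    simp only [← Complex.cpow_add _ _ hk0]
    congr 1
    rw [← hσ]; ring
  simp only [gammaShiftQuot, gammaQuot]
  have e1 := h4 (ε + a₁); have e2 := h4 (ε + a₂); have e3 := h4 (ε + a₃)
  have e4 := h4 (ε + b₁); have e5 := h4 (ε + b₂); have e6 := h4 (ε + b₃)
  rw [sub_left_inj]
  simp only [← add_assoc] at *
  generalize Complex.Gamma (k + ε + a₁) = G₁ at *
  generalize Complex.Gamma (k + ε + a₂) = G₂ at *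
  generalize Complex.Gamma (k + ε + a₃) = G₃ at *
  generalize (k : ℂ) ^ (ε + a₁) = A₁ at *
  generalize (k : ℂ) ^ (ε + a₂) = A₂ at *
  generalize (k : ℂ) ^ (ε + a₃) = A₃ at *
  generalize (k : ℂ) ^ (ε + b₁) = B₁ at *
  generalize (k : ℂ) ^ (ε + b₂) = B₂ at *
  generalize (k : ℂ) ^ (ε + b₃) = B₃ at *
  field_simp
  linear_combination (-(G₁ * G₂ * G₃)) * hpow

/-- Uniform bounds for the deviation of a Gamma quotient from its leading asymptotics. -/
theorem gammaQuot_sub_rpow_le {r σ : ℝ} {a₁ a₂ a₃ b₁ b₂ b₃ : ℂ}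
    (h : ∀ ε : ℂ, ‖ε‖ ≤ r → GammaQuotRegular a₁ a₂ a₃ b₁ b₂ b₃ ε)
    (hσ : b₁ + b₂ + b₃ - a₁ - a₂ - a₃ = σ) :
    ∃ C : ℝ, ∀ k : ℕ, ∀ ε : ℂ, ‖ε‖ ≤ r →
      ‖gammaQuot a₁ a₂ a₃ b₁ b₂ b₃ (k + ε) - (((k : ℝ) ^ (-σ) : ℝ) : ℂ)‖ ≤
        C * ((k : ℝ) + 1) ^ (-σ - 1) := by
  obtain ⟨C, hC⟩ := (gammaQuot_isBigO h hσ).bound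
  obtain ⟨K, hK⟩ := eventually_unifFilter.1 hC
  have hcpt (k : ℕ) : ∃ D : ℝ, ∀ ε : ℂ, ‖ε‖ ≤ r →
      ‖gammaQuot a₁ a₂ a₃ b₁ b₂ b₃ (k + ε) - (((k : ℝ) ^ (-σ) : ℝ) : ℂ)‖ ≤ D := by
    have hc : ContinuousOn (fun ε => gammaQuot a₁ a₂ a₃ b₁ b₂ b₃ (k + ε) -
        (((k : ℝ) ^ (-σ) : ℝ) : ℂ)) (Metric.closedBall 0 r) := by
      intro ε hε
      refine (ContinuousAt.sub ?_ continuousAt_const).continuousWithinAt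
      have := (differentiableAt_gammaQuot
        ((h ε (by simpa using hε)).natCast_add k)).continuousAt
      exact ContinuousAt.comp (f := fun ε : ℂ => (k : ℂ) + ε) this (by fun_prop)
    obtain ⟨D, hD⟩ := (isCompact_closedBall (0 : ℂ) r).exists_bound_of_continuousOn hc
    exact ⟨D, fun ε hε => hD ε (by simpa using hε)⟩
  choose D hD using hcpt
  -- The first term covers large k, where (k+1)/k ≤ 2 exchanges k for k+1. The finite sum covers k ≤
  -- K, where only compactness in ε is used.
  refine ⟨|C| * 2 ^ |σ + 1| + ∑ k ∈ Finset.range (K + 1), |D k| / ((k : ℝ) + 1) ^ (-σ - 1),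
    fun k ε hε => ?_⟩
  have hk1 : (0 : ℝ) < (k : ℝ) + 1 := by positivity
  have hpos : (0 : ℝ) < ((k : ℝ) + 1) ^ (-σ - 1) := by positivity
  have hsum : (0 : ℝ) ≤ ∑ k ∈ Finset.range (K + 1), |D k| / ((k : ℝ) + 1) ^ (-σ - 1) :=
    Finset.sum_nonneg fun i _ => by positivity
  rw [add_mul]
  rcases lt_or_ge k (K + 1) with hk | hk
  · refine (hD k ε hε).trans ((le_abs_self _).trans ?_)
    have h1 : |D k| = |D k| / ((k : ℝ) + 1) ^ (-σ - 1) * ((k : ℝ) + 1) ^ (-σ - 1) := by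
      field_simp
    have h2 : |D k| / ((k : ℝ) + 1) ^ (-σ - 1) ≤
        ∑ k ∈ Finset.range (K + 1), |D k| / ((k : ℝ) + 1) ^ (-σ - 1) :=
      Finset.single_le_sum (f := fun k : ℕ => |D k| / ((k : ℝ) + 1) ^ (-σ - 1))
        (fun i _ => by positivity) (Finset.mem_range.2 hk)
    rw [h1]
    have h3 : 0 ≤ |C| * 2 ^ |σ + 1| * ((k : ℝ) + 1) ^ (-σ - 1) := by positivity
    have := mul_le_mul_of_nonneg_right h2 hpos.le
    linarith
  · have hkpos : (0 : ℝ) < k := by exact_mod_cast (by omega : 0 < k)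
    have hk1' : (1 : ℝ) ≤ k := by exact_mod_cast (by omega : 1 ≤ k)
    have h1 := hK k (by omega) ε hε
    simp only at h1
    rw [Real.norm_of_nonneg (by positivity)] at h1
    have hcp : (k : ℂ) ^ (σ : ℂ) = (((k : ℝ) ^ σ : ℝ) : ℂ) := by
      rw [Complex.ofReal_cpow hkpos.le]; simp
    have hcp2 : (((k : ℝ) ^ σ : ℝ) : ℂ) * (((k : ℝ) ^ (-σ) : ℝ) : ℂ) = 1 := by
      rw [← Complex.ofReal_mul, ← Real.rpow_add hkpos]; simp
    rw [hcp] at h1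
    have h2 : gammaQuot a₁ a₂ a₃ b₁ b₂ b₃ (k + ε) - (((k : ℝ) ^ (-σ) : ℝ) : ℂ) =
        (gammaQuot a₁ a₂ a₃ b₁ b₂ b₃ (k + ε) * (((k : ℝ) ^ σ : ℝ) : ℂ) - 1) *
          (((k : ℝ) ^ (-σ) : ℝ) : ℂ) := by
      linear_combination (-gammaQuot a₁ a₂ a₃ b₁ b₂ b₃ (k + ε)) * hcp2
    rw [h2, norm_mul, Complex.norm_real, Real.norm_of_nonneg (by positivity)]
    have h4 : (k : ℝ) ^ (-σ - 1) ≤ 2 ^ |σ + 1| * ((k : ℝ) + 1) ^ (-σ - 1) := by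
      have h5 : ((k : ℝ) / (k + 1)) ^ (-σ - 1) ≤ 2 ^ |σ + 1| := by
        rw [show -σ - 1 = -(σ + 1) by ring, Real.rpow_neg (by positivity),
          ← Real.inv_rpow (by positivity), inv_div]
        have h6 : 1 ≤ ((k : ℝ) + 1) / k := by rw [one_le_div hkpos]; linarith
        have h7 : ((k : ℝ) + 1) / k ≤ 2 := by rw [div_le_iff₀ hkpos]; linarith
        calc (((k : ℝ) + 1) / k) ^ (σ + 1) ≤ (((k : ℝ) + 1) / k) ^ |σ + 1| :=
              Real.rpow_le_rpow_of_exponent_le h6 (le_abs_self _)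
          _ ≤ _ := by gcongr
      rwa [Real.div_rpow hkpos.le hk1.le, div_le_iff₀ hpos] at h5
    calc _ ≤ |C| * (1 / k) * (k : ℝ) ^ (-σ) := by
          gcongr
          exact h1.trans (by gcongr; exact le_abs_self C)
      _ = |C| * (k : ℝ) ^ (-σ - 1) := by
          rw [sub_eq_add_neg, Real.rpow_add hkpos, Real.rpow_neg_one]; ring
      _ ≤ |C| * (2 ^ |σ + 1| * ((k : ℝ) + 1) ^ (-σ - 1)) := by gcongr
      _ ≤ _ := by
        have := mul_nonneg hsum hpos.le
        linarith

/-! ### Power series with coefficients of polynomial growth. -/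

/-- Sequences of at most polynomial growth. -/
def PolyBounded (α : ℕ → ℂ) : Prop := ∃ C : ℝ, ∃ n : ℕ, ∀ k, ‖α k‖ ≤ C * ((k : ℝ) + 1) ^ n

theorem PolyBounded.of_le {α : ℕ → ℂ} {C : ℝ} (h : ∀ k, ‖α k‖ ≤ C) : PolyBounded α :=
  ⟨C, 0, by simpa using h⟩

theorem PolyBounded.add {α β : ℕ → ℂ} (hα : PolyBounded α) (hβ : PolyBounded β) :
    PolyBounded fun k => α k + β k := by
  obtain ⟨C, n, h⟩ := hα
  obtain ⟨D, m, h'⟩ := hβ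
  refine ⟨|C| + |D|, n + m, fun k => (norm_add_le _ _).trans ?_⟩
  have hk : (1 : ℝ) ≤ (k : ℝ) + 1 := by linarith [(Nat.cast_nonneg k : (0 : ℝ) ≤ k)]
  have h1 : ‖α k‖ ≤ |C| * ((k : ℝ) + 1) ^ (n + m) := (h k).trans (by
    gcongr
    · exact le_abs_self C
    · omega)
  have h2 : ‖β k‖ ≤ |D| * ((k : ℝ) + 1) ^ (n + m) := (h' k).trans (by
    gcongr
    · exact le_abs_self D
    · omega)
  linarith

theorem PolyBounded.const_mul {α : ℕ → ℂ} (hα : PolyBounded α) (c : ℂ) :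
    PolyBounded fun k => c * α k := by
  obtain ⟨C, n, h⟩ := hα
  refine ⟨‖c‖ * C, n, fun k => ?_⟩
  rw [norm_mul, mul_assoc]
  gcongr
  exact h k

theorem PolyBounded.natCast_mul {α : ℕ → ℂ} (hα : PolyBounded α) :
    PolyBounded fun k => k * α k := by
  obtain ⟨C, n, h⟩ := hα
  refine ⟨C, n + 1, fun k => ?_⟩
  rw [norm_mul, Complex.norm_natCast, pow_succ, ← mul_assoc, mul_comm (k : ℝ)]
  have h0 := (norm_nonneg _).trans (h k)
  exact mul_le_mul (h k) (by linarith) (by positivity) h0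

theorem PolyBounded.shift {α : ℕ → ℂ} (hα : PolyBounded α) : PolyBounded fun k => α (k + 1) := by
  obtain ⟨C, n, h⟩ := hα
  refine ⟨|C| * 2 ^ n, n, fun k => (h _).trans ?_⟩
  rw [mul_assoc, ← mul_pow]
  have : (0 : ℝ) ≤ k := Nat.cast_nonneg k
  push_cast
  gcongr
  · exact le_abs_self C
  · linarith

/-- The sum of the power series with coefficients `α`. -/
noncomputable def powSum (α : ℕ → ℂ) (z : ℂ) : ℂ := ∑' k, α k * z ^ k

theorem PolyBounded.summable_norm {α : ℕ → ℂ} (hα : PolyBounded α) {z : ℝ} (h0 : 0 ≤ z)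
    (hz : z < 1) : Summable fun k => ‖α k‖ * z ^ k := by
  rw [← summable_nat_add_iff 1]
  obtain ⟨C, n, h⟩ := hα
  have hs : Summable fun k : ℕ => C * (((k + 1 : ℕ) : ℝ) ^ n * z ^ k) := by
    refine Summable.mul_left C ?_
    rcases h0.eq_or_lt with rfl | h0
    · refine summable_of_ne_finset_zero (s := {0}) fun k hk => ?_
      simp at hk
      simp [hk]
    · have := (summable_nat_add_iff 1).2 (summable_pow_mul_geometric_of_norm_lt_one n
        (r := z) (by rwa [Real.norm_of_nonneg h0.le]))
      refine (this.mul_left z⁻¹).congr fun k => ?_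
      rw [pow_succ' z]
      field_simp
  have hs' := (summable_nat_add_iff 1).2 hs
  refine Summable.of_nonneg_of_le (fun k => by positivity) (fun k => ?_) hs'
  calc ‖α (k + 1)‖ * z ^ (k + 1) ≤ (C * ((k + 1 : ℕ) + 1 : ℝ) ^ n) * z ^ (k + 1) := by
        gcongr
        exact h (k + 1)
    _ = _ := by push_cast; ring

theorem PolyBounded.summable {α : ℕ → ℂ} (hα : PolyBounded α) {z : ℂ} (hz : ‖z‖ < 1) :
    Summable fun k => α k * z ^ k := by
  refine Summable.of_norm ((hα.summable_norm (norm_nonneg z) hz).congr fun k => ?_)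
  rw [norm_mul, norm_pow]

theorem powSum_add {α β : ℕ → ℂ} (hα : PolyBounded α) (hβ : PolyBounded β) {z : ℂ}
    (hz : ‖z‖ < 1) : powSum (fun k => α k + β k) z = powSum α z + powSum β z := by
  rw [powSum, powSum, powSum, ← (hα.summable hz).tsum_add (hβ.summable hz)]
  exact tsum_congr fun k => by ring

theorem powSum_const_mul (α : ℕ → ℂ) (c z : ℂ) :
    powSum (fun k => c * α k) z = c * powSum α z := by
  rw [powSum, powSum, ← tsum_mul_left]
  exact tsum_congr fun k => by ring

theorem powSum_eq_zero_add {α : ℕ → ℂ} (hα : PolyBounded α) {z : ℂ} (hz : ‖z‖ < 1) :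
    powSum α z = α 0 + z * powSum (fun k => α (k + 1)) z := by
  rw [powSum, powSum, (hα.summable hz).tsum_eq_zero_add, ← tsum_mul_left]
  simp only [pow_zero, mul_one]
  congr 1
  exact tsum_congr fun k => by ring

theorem hasDerivAt_powSum {α : ℕ → ℂ} (hα : PolyBounded α) {z : ℂ} (hz : ‖z‖ < 1) :
    HasDerivAt (powSum α) (powSum (fun k => (k + 1) * α (k + 1)) z) z := by
  obtain ⟨ρ, h1, h2⟩ := exists_between hz
  have hρ : 0 ≤ ρ := (norm_nonneg z).trans h1.le
  have hu := hα.summable_norm hρ h2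
  have hd : ∀ k : ℕ, DifferentiableOn ℂ (fun w : ℂ => α k * w ^ k) (Metric.ball 0 ρ) :=
    fun k => by fun_prop
  have hb : ∀ (k : ℕ) (w : ℂ), w ∈ Metric.ball 0 ρ → ‖α k * w ^ k‖ ≤ ‖α k‖ * ρ ^ k := by
    intro k w hw
    rw [norm_mul, norm_pow]
    have : ‖w‖ < ρ := by simpa using hw
    gcongr
  have hzm : z ∈ Metric.ball (0 : ℂ) ρ := by simpa using h1
  have hdiff := (Complex.differentiableOn_tsum_of_summable_norm hu hd Metric.isOpen_ball hb
    ).differentiableAt (Metric.isOpen_ball.mem_nhds hzm)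
  have hs := Complex.hasSum_deriv_of_summable_norm hu hd Metric.isOpen_ball hb hzm
  have he : deriv (powSum α) z = powSum (fun k => (k + 1) * α (k + 1)) z := by
    have h3 : (fun k : ℕ => deriv (fun w : ℂ => α k * w ^ k) z) =
        fun k : ℕ => α k * (k * z ^ (k - 1)) := by
      funext k
      simp
    rw [h3] at hs
    change deriv (fun w => ∑' k, α k * w ^ k) z = _
    rw [← hs.tsum_eq, hs.summable.tsum_eq_zero_add, powSum]
    simp only [Nat.cast_zero, zero_mul, mul_zero, zero_add]
    refine tsum_congr fun k => ?_
    push_cast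
    ring
  rw [← he]
  exact hdiff.hasDerivAt

theorem mul_powSum_deriv {α : ℕ → ℂ} (hα : PolyBounded α) {z : ℂ} (hz : ‖z‖ < 1) :
    z * powSum (fun k => (k + 1) * α (k + 1)) z = powSum (fun k => k * α k) z := by
  rw [powSum_eq_zero_add hα.natCast_mul hz]
  simp

theorem hasDerivAt_powSum_real {α : ℕ → ℂ} (hα : PolyBounded α) {z : ℝ} (h0 : 0 < z)
    (hz : z < 1) :
    HasDerivAt (fun t : ℝ => powSum α t) (powSum (fun k => k * α k) z / z) z := by
  have hn : ‖(z : ℂ)‖ < 1 := by rwa [Complex.norm_real, Real.norm_of_nonneg h0.le]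
  have := (hasDerivAt_powSum hα hn).comp_ofReal
  rw [← mul_powSum_deriv hα hn, mul_div_cancel_left₀ _ (by exact_mod_cast h0.ne')]
  exact this

theorem continuousAt_powSum {α : ℕ → ℂ} (hα : PolyBounded α) {z : ℂ} (hz : ‖z‖ < 1) :
    ContinuousAt (powSum α) z := (hasDerivAt_powSum hα hz).continuousAt

/-- Boundedness on the unit interval of absolutely convergent power series. -/
theorem norm_powSum_le_tsum {α : ℕ → ℂ} (hα : Summable fun k => ‖α k‖) {z : ℝ} (h0 : 0 ≤ z)
    (hz : z ≤ 1) : ‖powSum α z‖ ≤ ∑' k, ‖α k‖ := by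
  refine tsum_of_norm_bounded hα.hasSum fun k => ?_
  rw [norm_mul, norm_pow, Complex.norm_real, Real.norm_of_nonneg h0]
  exact mul_le_of_le_one_right (norm_nonneg _) (pow_le_one₀ h0 hz)

theorem norm_powSum_le_div {α : ℕ → ℂ} {C : ℝ} (hα : ∀ k, ‖α k‖ ≤ C) {z : ℝ} (h0 : 0 ≤ z)
    (hz : z < 1) : ‖powSum α z‖ ≤ C / (1 - z) := by
  have hs : HasSum (fun k : ℕ => C * z ^ k) (C * (1 - z)⁻¹) :=
    (hasSum_geometric_of_lt_one h0 hz).mul_left C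
  refine tsum_of_norm_bounded hs fun k => ?_
  rw [norm_mul, norm_pow, Complex.norm_real, Real.norm_of_nonneg h0]
  gcongr
  exact hα k

/-- Abel's theorem in the absolutely convergent case. -/
theorem tendsto_powSum_one {α : ℕ → ℂ} (hα : Summable fun k => ‖α k‖) :
    Tendsto (fun t : ℝ => powSum α t) (𝓝[<] 1) (𝓝 (∑' k, α k)) := by
  refine tendsto_tsum_of_dominated_convergence hα (fun k => ?_) ?_
  · have : Tendsto (fun t : ℝ => α k * (t : ℂ) ^ k) (𝓝 1) (𝓝 (α k * ((1 : ℝ) : ℂ) ^ k)) :=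
      Continuous.tendsto (by fun_prop) 1
    simpa using this.mono_left nhdsWithin_le_nhds
  · filter_upwards [Ioo_mem_nhdsLT (show (0 : ℝ) < 1 by norm_num)] with t ht k
    rw [norm_mul, norm_pow, Complex.norm_real, Real.norm_of_nonneg ht.1.le]
    exact mul_le_of_le_one_right (norm_nonneg _) (pow_le_one₀ ht.1.le ht.2.le)

/-! ### Frobenius series with logarithms, and the symmetric square of the Legendre equation. -/

/-- The action of `z d/dz` on the coefficients of
`∑ (α 2 k + 2 (log z) α 1 k + (log z) ^ 2 α 0 k) z ^ k`. -/
def logTheta (α : Fin 3 → ℕ → ℂ) : Fin 3 → ℕ → ℂ :=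
  ![fun k => k * α 0 k, fun k => k * α 1 k + α 0 k, fun k => k * α 2 k + 2 * α 1 k]

/-- The function `∑ (α 2 k + 2 (log z) α 1 k + (log z) ^ 2 α 0 k) z ^ k`. -/
noncomputable def logSum (α : Fin 3 → ℕ → ℂ) (z : ℝ) : ℂ :=
  powSum (α 2) z + 2 * (Real.log z : ℂ) * powSum (α 1) z + (Real.log z : ℂ) ^ 2 * powSum (α 0) z

theorem PolyBounded.logTheta {α : Fin 3 → ℕ → ℂ} (h : ∀ j, PolyBounded (α j)) (j : Fin 3) :
    PolyBounded (logTheta α j) := by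
  fin_cases j
  · exact (h 0).natCast_mul
  · exact (h 1).natCast_mul.add (h 0)
  · exact (h 2).natCast_mul.add ((h 1).const_mul 2)

section
variable {α : Fin 3 → ℕ → ℂ} {z : ℝ}

theorem hasDerivAt_logSum (h : ∀ j, PolyBounded (α j)) (h0 : 0 < z) (hz : z < 1) :
    HasDerivAt (logSum α) (logSum (logTheta α) z / z) z := by
  have hn : ‖(z : ℂ)‖ < 1 := by rwa [Complex.norm_real, Real.norm_of_nonneg h0.le]
  have hz0 : (z : ℂ) ≠ 0 := by exact_mod_cast h0.ne'
  have hl : HasDerivAt (fun t : ℝ => (Real.log t : ℂ)) ((z⁻¹ : ℝ) : ℂ) z :=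
    (Real.hasDerivAt_log h0.ne').ofReal_comp
  have d (j : Fin 3) := hasDerivAt_powSum_real (h j) h0 hz
  have key := ((d 2).add ((hl.const_mul 2).mul (d 1))).add ((hl.pow 2).mul (d 0))
  refine (key.congr_deriv ?_)
  simp only [logSum, logTheta, Matrix.cons_val, Pi.pow_apply]
  rw [powSum_add (h 2).natCast_mul ((h 1).const_mul 2) hn, powSum_add (h 1).natCast_mul (h 0) hn,
    powSum_const_mul]
  push_cast
  field_simp
  ring

/-- The recurrence satisfied by the coefficients of logarithmic solutions of the symmetric square
of the Legendre equation, in the variable `1 - x ^ 2`. -/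
def SymSqRec (lam : ℂ) (α : Fin 3 → ℕ → ℂ) : Prop :=
  ∀ j k, 4 * logTheta (logTheta (logTheta α)) j (k + 1) =
    4 * logTheta (logTheta (logTheta α)) j k + 6 * logTheta (logTheta α) j k +
      (2 - 4 * lam) * logTheta α j k + -2 * lam * α j k

/-- With θ = z d/dz this is 4θ³f = z(4θ³ + 6θ² + (2-4λ)θ - 2λ)f. The recurrence compares
coefficients of z^(k+1), separately for each power of log z. -/
theorem SymSqRec.logSum_eq {lam : ℂ} (hrec : SymSqRec lam α) (h : ∀ j, PolyBounded (α j))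
    (h0 : 0 < z) (hz : z < 1) :
    4 * logSum (logTheta (logTheta (logTheta α))) z =
      z * (4 * logSum (logTheta (logTheta (logTheta α))) z + 6 * logSum (logTheta (logTheta α)) z +
        (2 - 4 * lam) * logSum (logTheta α) z - 2 * lam * logSum α z) := by
  have hn : ‖(z : ℂ)‖ < 1 := by rwa [Complex.norm_real, Real.norm_of_nonneg h0.le]
  have h1 := PolyBounded.logTheta h
  have h2 := PolyBounded.logTheta h1
  have h3 := PolyBounded.logTheta h2
  have key (j : Fin 3) : 4 * powSum (logTheta (logTheta (logTheta α)) j) z =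
      z * (4 * powSum (logTheta (logTheta (logTheta α)) j) z +
        6 * powSum (logTheta (logTheta α) j) z +
        (2 - 4 * lam) * powSum (logTheta α j) z + -2 * lam * powSum (α j) z) := by
    -- `logTheta` is the Leibniz rule for multiplying a 2-jet by s. The 2-jet of s³ at s = 0
    -- vanishes, so the recurrence imposes no condition on the coefficients at k = 0.
    have hzero : logTheta (logTheta (logTheta α)) j 0 = 0 := by
      fin_cases j <;> simp [logTheta]
    have e : 4 * powSum (logTheta (logTheta (logTheta α)) j) z =
        z * powSum (fun k => 4 * logTheta (logTheta (logTheta α)) j (k + 1)) z := by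
      rw [← powSum_const_mul, powSum_eq_zero_add ((h3 j).const_mul 4) hn, hzero, mul_zero,
        zero_add]
    refine e.trans (congrArg _ ?_)
    simp only [hrec j]
    rw [powSum_add ((((h3 j).const_mul 4).add ((h2 j).const_mul 6)).add ((h1 j).const_mul _))
        ((h j).const_mul _) hn,
      powSum_add (((h3 j).const_mul 4).add ((h2 j).const_mul 6)) ((h1 j).const_mul _) hn,
      powSum_add ((h3 j).const_mul 4) ((h2 j).const_mul 6) hn]
    simp only [powSum_const_mul]
  simp only [logSum]
  linear_combination key 2 + 2 * (Real.log z : ℂ) * key 1 + (Real.log z : ℂ) ^ 2 * key 0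

end

/-- First-order form of the symmetric square of the Legendre equation. -/
structure SymSqSystem (lam : ℂ) (f φ E : ℝ → ℂ) : Prop where
  df : ∀ x ∈ Set.Ioo (0 : ℝ) 1, HasDerivAt f (φ x / (1 - x ^ 2)) x
  dφ : ∀ x ∈ Set.Ioo (0 : ℝ) 1, HasDerivAt φ (E x / (1 - x ^ 2) - 2 * lam * f x) x
  dE : ∀ x ∈ Set.Ioo (0 : ℝ) 1, HasDerivAt E (-2 * lam * φ x) x

/-- Since dz/dx = -2x, the functions are f, φ = (1-x²)f' and E = (1-x²)(φ' + 2λf) written through θ.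
Only the equation for E' uses the recurrence; the other two are the chain rule. -/
theorem SymSqRec.symSqSystem {lam : ℂ} {α : Fin 3 → ℕ → ℂ} (hrec : SymSqRec lam α)
    (h : ∀ j, PolyBounded (α j)) :
    SymSqSystem lam (fun x => logSum α (1 - x ^ 2))
      (fun x => -2 * x * logSum (logTheta α) (1 - x ^ 2))
      (fun x => 4 * x ^ 2 * logSum (logTheta (logTheta α)) (1 - x ^ 2) -
        2 * (1 - x ^ 2) * logSum (logTheta α) (1 - x ^ 2) +
        2 * lam * (1 - x ^ 2) * logSum α (1 - x ^ 2)) := by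
  have h1 := PolyBounded.logTheta h
  have h2 := PolyBounded.logTheta h1
  have hz (x : ℝ) (hx : x ∈ Set.Ioo (0 : ℝ) 1) : 0 < 1 - x ^ 2 ∧ 1 - x ^ 2 < 1 := by
    constructor <;> nlinarith [hx.1, hx.2]
  have hp (x : ℝ) : HasDerivAt (fun x : ℝ => 1 - x ^ 2) (-(2 * x)) x := by
    simpa using (hasDerivAt_pow 2 x).const_sub 1
  have hc (x : ℝ) : HasDerivAt (fun x : ℝ => (x : ℂ)) 1 x := Complex.ofRealCLM.hasDerivAt
  have D {β : Fin 3 → ℕ → ℂ} (hβ : ∀ j, PolyBounded (β j)) (x : ℝ) (hx : x ∈ Set.Ioo (0 : ℝ) 1) :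
      HasDerivAt (fun x : ℝ => logSum β (1 - x ^ 2))
        (-2 * x * logSum (logTheta β) (1 - x ^ 2) / (1 - x ^ 2)) x := by
    have := (hasDerivAt_logSum hβ (hz x hx).1 (hz x hx).2).scomp x (hp x)
    refine this.congr_deriv ?_
    rw [Complex.real_smul]
    push_cast
    ring
  have hne (x : ℝ) (hx : x ∈ Set.Ioo (0 : ℝ) 1) : (1 : ℂ) - x ^ 2 ≠ 0 := by
    exact_mod_cast (hz x hx).1.ne'
  refine ⟨fun x hx => D h x hx, fun x hx => ?_, fun x hx => ?_⟩
  · refine (((hc x).const_mul (-2)).mul (D h1 x hx)).congr_deriv ?_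
    have := hne x hx
    field_simp
    ring
  · have h3 := ((((hc x).pow 2).const_mul 4).mul (D h2 x hx))
    have h4 := (((((hc x).pow 2).const_sub 1).const_mul 2).mul (D h1 x hx))
    have h5 := (((((hc x).pow 2).const_sub 1).const_mul (2 * lam)).mul (D h x hx))
    refine ((h3.sub h4).add h5).congr_deriv ?_
    have := hne x hx
    have key := hrec.logSum_eq h (hz x hx).1 (hz x hx).2
    push_cast at key
    simp only [Pi.pow_apply]
    field_simp
    simp only [Nat.cast_ofNat, Nat.add_one_sub_one, pow_one]
    linear_combination (-2 * x : ℂ) * key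

/-- As x → 0 the variable z = 1 - x² reaches the circle of convergence. Bounded coefficients only
give O(1/(1-z)), but they come multiplied by powers of log z = O(1-z). The series stays bounded and
the factor x gives the limit. -/
theorem tendsto_logSum_logTheta {α : Fin 3 → ℕ → ℂ} {C : ℝ}
    (h0 : ∀ k, ‖logTheta α 0 k‖ ≤ C) (h1 : ∀ k, ‖logTheta α 1 k‖ ≤ C)
    (h2 : Summable fun k => ‖logTheta α 2 k‖) :
    Tendsto (fun x : ℝ => -2 * (x : ℂ) * logSum (logTheta α) (1 - x ^ 2)) (𝓝[>] 0) (𝓝 0) := by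
  have hC : 0 ≤ C := (norm_nonneg _).trans (h0 0)
  set M := ∑' k, ‖logTheta α 2 k‖
  have hlim : Tendsto (fun x : ℝ => 2 * x * (M + 2 * (2 * C) + 4 * C)) (𝓝[>] 0) (𝓝 0) := by
    have : Tendsto (fun x : ℝ => 2 * x * (M + 2 * (2 * C) + 4 * C)) (𝓝 0)
      (𝓝 (2 * 0 * (M + 2 * (2 * C) + 4 * C))) := Continuous.tendsto (by fun_prop) 0
    simpa using this.mono_left nhdsWithin_le_nhds
  refine squeeze_zero_norm' ?_ hlim
  filter_upwards [Ioo_mem_nhdsGT (show (0 : ℝ) < 1 / 2 by norm_num)] with x hx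
  set z := 1 - x ^ 2 with hz
  have hz0 : 1 / 2 ≤ z := by nlinarith [hx.1, hx.2]
  have hz1 : z < 1 := by nlinarith [hx.1]
  have hz' : 0 < 1 - z := by linarith
  have hlog : |Real.log z| ≤ 2 * (1 - z) := by
    rw [abs_of_nonpos (Real.log_nonpos (by linarith) hz1.le)]
    have := Real.one_sub_inv_le_log_of_pos (show 0 < z by linarith)
    have h3 : z⁻¹ - 1 ≤ 2 * (1 - z) := by
      rw [inv_eq_one_div, div_sub_one (by linarith), div_le_iff₀ (by linarith)]
      nlinarith
    linarith
  have b2 := norm_powSum_le_tsum h2 (z := z) (by linarith) hz1.le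
  have b1 := norm_powSum_le_div h1 (z := z) (by linarith) hz1
  have b0 := norm_powSum_le_div h0 (z := z) (by linarith) hz1
  have n1 : ‖2 * (Real.log z : ℂ) * powSum (logTheta α 1) z‖ ≤ 2 * (2 * C) := by
    rw [norm_mul, norm_mul, Complex.norm_real, Real.norm_eq_abs, Complex.norm_ofNat]
    calc _ ≤ 2 * (2 * (1 - z)) * (C / (1 - z)) := by gcongr
      _ = _ := by field_simp
  have n0 : ‖(Real.log z : ℂ) ^ 2 * powSum (logTheta α 0) z‖ ≤ 4 * C := by
    rw [norm_mul, norm_pow, Complex.norm_real, Real.norm_eq_abs]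
    calc _ ≤ (2 * (1 - z)) ^ 2 * (C / (1 - z)) := by gcongr
      _ = 4 * C * (1 - z) := by field_simp; ring
      _ ≤ _ := by nlinarith
  rw [norm_mul, norm_mul, norm_neg, Complex.norm_ofNat, Complex.norm_real,
    Real.norm_of_nonneg hx.1.le]
  have h2x : 0 ≤ 2 * x := by linarith [hx.1]
  refine mul_le_mul_of_nonneg_left ?_ h2x
  rw [logSum]
  refine (norm_add_le _ _).trans (add_le_add ((norm_add_le _ _).trans (add_le_add b2 n1)) n0)

theorem exists_const_of_hasDerivAt_zero {f : ℝ → ℂ} {a b : ℝ}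
    (h : ∀ x ∈ Set.Ioo a b, HasDerivAt f 0 x) : ∃ c, ∀ x ∈ Set.Ioo a b, f x = c :=
  isOpen_Ioo.exists_is_const_of_deriv_eq_zero isPreconnected_Ioo
    (fun x hx => (h x hx).differentiableAt.differentiableWithinAt) fun x hx => (h x hx).deriv

/-- First-order form of the Legendre equation. -/
structure LegendreSystem (lam : ℂ) (y Y : ℝ → ℂ) : Prop where
  dy : ∀ x ∈ Set.Ioo (-1 : ℝ) 1, HasDerivAt y (Y x / (1 - x ^ 2)) x
  dY : ∀ x ∈ Set.Ioo (-1 : ℝ) 1, HasDerivAt Y (-lam * y x) x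

theorem one_sub_sq_ne_zero {x : ℝ} (hx : x ∈ Set.Ioo (-1 : ℝ) 1) : (1 : ℂ) - x ^ 2 ≠ 0 := by
  have : (1 : ℝ) - x ^ 2 ≠ 0 := by nlinarith [hx.1, hx.2]
  exact_mod_cast this

theorem LegendreSystem.exists_wronskian_eq {lam : ℂ} {y₁ Y₁ y₂ Y₂ : ℝ → ℂ}
    (h₁ : LegendreSystem lam y₁ Y₁) (h₂ : LegendreSystem lam y₂ Y₂) :
    ∃ W, ∀ x ∈ Set.Ioo (-1 : ℝ) 1, y₁ x * Y₂ x - Y₁ x * y₂ x = W := by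
  refine exists_const_of_hasDerivAt_zero fun x hx => ?_
  refine (((h₁.dy x hx).mul (h₂.dY x hx)).sub ((h₁.dY x hx).mul (h₂.dy x hx))).congr_deriv ?_
  have := one_sub_sq_ne_zero hx
  field_simp
  ring

/-- Solutions of the symmetric square equation are quadratic forms in two solutions with nonzero
Wronskian. -/
theorem SymSqSystem.exists_quadratic {lam W : ℂ} {f φ E y₁ Y₁ y₂ Y₂ : ℝ → ℂ}
    (hf : SymSqSystem lam f φ E) (h₁ : LegendreSystem lam y₁ Y₁) (h₂ : LegendreSystem lam y₂ Y₂)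
    (hW : ∀ x ∈ Set.Ioo (-1 : ℝ) 1, y₁ x * Y₂ x - Y₁ x * y₂ x = W) (hW0 : W ≠ 0) :
    ∃ α β γ : ℂ, ∀ x ∈ Set.Ioo (0 : ℝ) 1,
      f x = α * y₁ x ^ 2 + β * (y₁ x * y₂ x) + γ * y₂ x ^ 2 := by
  have hsub {x : ℝ} (hx : x ∈ Set.Ioo (0 : ℝ) 1) : x ∈ Set.Ioo (-1 : ℝ) 1 :=
    ⟨by linarith [hx.1], hx.2⟩
  -- For f = y² one has φ = 2yY and E = 2Y², and this expression becomes 2(yU - Yu)(yV - Yv), a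
  -- product of Wronskians. Its constancy for general f is a consequence of the three first-order
  -- equations.
  have C {u U v V : ℝ → ℂ} (hu : LegendreSystem lam u U) (hv : LegendreSystem lam v V) :
      ∃ c, ∀ x ∈ Set.Ioo (0 : ℝ) 1, 2 * f x * (U x * V x) - φ x * (u x * V x + U x * v x) +
        u x * v x * E x = c := by
    refine exists_const_of_hasDerivAt_zero fun x hx => ?_
    have hx' := hsub hx
    refine (((((hf.df x hx).const_mul 2).mul ((hu.dY x hx').mul (hv.dY x hx'))).sub
      ((hf.dφ x hx).mul (((hu.dy x hx').mul (hv.dY x hx')).add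
        ((hu.dY x hx').mul (hv.dy x hx'))))).add
      (((hu.dy x hx').mul (hv.dy x hx')).mul (hf.dE x hx))).congr_deriv ?_
    have := one_sub_sq_ne_zero hx'
    simp only [Pi.mul_apply, Pi.add_apply]
    field_simp
    ring
  obtain ⟨c₁₁, hc₁₁⟩ := C h₁ h₁
  obtain ⟨c₁₂, hc₁₂⟩ := C h₁ h₂
  obtain ⟨c₂₂, hc₂₂⟩ := C h₂ h₂
  refine ⟨c₂₂ / (2 * W ^ 2), -2 * c₁₂ / (2 * W ^ 2), c₁₁ / (2 * W ^ 2), fun x hx => ?_⟩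
  have e1 := hc₁₁ x hx
  have e2 := hc₁₂ x hx
  have e3 := hc₂₂ x hx
  have e4 := hW x (hsub hx)
  -- The three invariants are linear in f, φ, E. Eliminating φ and E leaves f multiplied by twice
  -- the squared Wronskian.
  have key : 2 * W ^ 2 * f x = c₂₂ * y₁ x ^ 2 - 2 * c₁₂ * (y₁ x * y₂ x) + c₁₁ * y₂ x ^ 2 := by
    rw [← e1, ← e2, ← e3, ← e4]
    ring
  field_simp
  linear_combination key

theorem LegendreSystem.comp_neg {lam : ℂ} {y Y : ℝ → ℂ} (h : LegendreSystem lam y Y) :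
    LegendreSystem lam (fun x => y (-x)) (fun x => -Y (-x)) := by
  have hneg {x : ℝ} (hx : x ∈ Set.Ioo (-1 : ℝ) 1) : -x ∈ Set.Ioo (-1 : ℝ) 1 :=
    ⟨by linarith [hx.2], by linarith [hx.1]⟩
  constructor
  · intro x hx
    refine ((h.dy _ (hneg hx)).scomp x (hasDerivAt_neg x)).congr_deriv ?_
    simp [neg_div]
  · intro x hx
    refine ((h.dY _ (hneg hx)).scomp x (hasDerivAt_neg x)).neg.congr_deriv ?_
    simp

/-- Solutions of the symmetric square equation that are even across the origin. -/
theorem SymSqSystem.exists_even_quadratic {lam W : ℂ} {f φ E y Y : ℝ → ℂ}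
    (hf : SymSqSystem lam f φ E) (h : LegendreSystem lam y Y)
    (hW : ∀ x ∈ Set.Ioo (-1 : ℝ) 1, y x * -Y (-x) - Y x * y (-x) = W) (hW0 : W ≠ 0)
    (hφ : Tendsto φ (𝓝[>] 0) (𝓝 0)) :
    ∃ α β : ℂ, ∀ x ∈ Set.Ioo (0 : ℝ) 1,
      f x = α * (y x ^ 2 + y (-x) ^ 2) + β * (y x * y (-x)) := by
  have hsub {x : ℝ} (hx : x ∈ Set.Ioo (0 : ℝ) 1) : x ∈ Set.Ioo (-1 : ℝ) 1 :=
    ⟨by linarith [hx.1], hx.2⟩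
  have h₂ := h.comp_neg
  obtain ⟨α, β, γ, hq⟩ := hf.exists_quadratic h h₂ hW hW0
  have hφe : ∀ x ∈ Set.Ioo (0 : ℝ) 1, φ x = α * (2 * y x * Y x) +
      β * (y x * -Y (-x) + Y x * y (-x)) + γ * (2 * y (-x) * -Y (-x)) := by
    intro x hx
    have hx' := hsub hx
    have d := ((((h.dy x hx').pow 2).const_mul α).add
      (((h.dy x hx').mul (h₂.dy x hx')).const_mul β)).add (((h₂.dy x hx').pow 2).const_mul γ)
    have d2 := (hf.df x hx).congr_of_eventuallyEq (f₁ := fun x => α * y x ^ 2 +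
      β * (y x * y (-x)) + γ * y (-x) ^ 2) (by
        filter_upwards [isOpen_Ioo.mem_nhds hx] with t ht
        exact (hq t ht).symm)
    have := d2.unique d
    have hne := one_sub_sq_ne_zero hx'
    simp only [Nat.cast_ofNat, Nat.add_one_sub_one, pow_one] at this
    field_simp at this
    linear_combination this
  have h0 : (0 : ℝ) ∈ Set.Ioo (-1 : ℝ) 1 := by norm_num
  have hyc : ContinuousAt y 0 := (h.dy 0 h0).continuousAt
  have hYc : ContinuousAt Y 0 := (h.dY 0 h0).continuousAt
  have hyc' : ContinuousAt (fun x => y (-x)) 0 := (h₂.dy 0 h0).continuousAt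
  have hYc' : ContinuousAt (fun x => -Y (-x)) 0 := (h₂.dY 0 h0).continuousAt
  have hlim : Tendsto φ (𝓝[>] 0) (𝓝 (α * (2 * y 0 * Y 0) +
      β * (y 0 * -Y (-0) + Y 0 * y (-0)) + γ * (2 * y (-0) * -Y (-0)))) := by
    have hc : ContinuousAt (fun x => α * (2 * y x * Y x) +
      β * (y x * -Y (-x) + Y x * y (-x)) + γ * (2 * y (-x) * -Y (-x))) 0 :=
      (((continuousAt_const.mul ((continuousAt_const.mul hyc).mul hYc))).add
        (continuousAt_const.mul ((hyc.mul hYc').add (hYc.mul hyc')))).add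
        (continuousAt_const.mul ((continuousAt_const.mul hyc').mul hYc'))
    refine (hc.tendsto.mono_left nhdsWithin_le_nhds).congr' ?_
    filter_upwards [Ioo_mem_nhdsGT (show (0 : ℝ) < 1 by norm_num)] with x hx
    exact (hφe x hx).symm
  have he := tendsto_nhds_unique hφ hlim
  have hW1 := hW 0 h0
  rw [neg_zero] at he hW1
  -- At x = 0 the β-term drops out and φ tends to 2(α-γ)y(0)Y(0), while W = -2y(0)Y(0) is nonzero.
  have hαγ : α = γ := by
    have : (α - γ) * W = 0 := by
      rw [← hW1]
      linear_combination he
    rcases mul_eq_zero.1 this with h | h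
    · exact sub_eq_zero.1 h
    · exact absurd h hW0
  refine ⟨α, β, fun x hx => ?_⟩
  rw [hq x hx, hαγ]
  ring

theorem gammaQuot_le {r σ : ℝ} (hσ0 : 0 < σ) {a₁ a₂ a₃ b₁ b₂ b₃ : ℂ}
    (h : ∀ ε : ℂ, ‖ε‖ ≤ r → GammaQuotRegular a₁ a₂ a₃ b₁ b₂ b₃ ε)
    (hσ : b₁ + b₂ + b₃ - a₁ - a₂ - a₃ = σ) :
    ∃ C : ℝ, 0 ≤ C ∧ ∀ k : ℕ, ∀ ε : ℂ, ‖ε‖ ≤ r →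
      ‖gammaQuot a₁ a₂ a₃ b₁ b₂ b₃ (k + ε)‖ ≤ C * ((k : ℝ) + 1) ^ (-σ) := by
  obtain ⟨C, hC⟩ := gammaQuot_sub_rpow_le h hσ
  -- For k ≥ 1, 1/k ≤ 2/(k+1) accounts for 2^σ. At k = 0 the real power 0^(-σ) is 0 because σ ≠ 0.
  refine ⟨|C| + 2 ^ σ, by positivity, fun k ε hε => ?_⟩
  have hk1 : (1 : ℝ) ≤ (k : ℝ) + 1 := by linarith [(Nat.cast_nonneg k : (0 : ℝ) ≤ k)]
  have h1 : ((k : ℝ) + 1) ^ (-σ - 1) ≤ ((k : ℝ) + 1) ^ (-σ) :=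
    Real.rpow_le_rpow_of_exponent_le hk1 (by linarith)
  have h2 : (k : ℝ) ^ (-σ) ≤ 2 ^ σ * ((k : ℝ) + 1) ^ (-σ) := by
    rcases Nat.eq_zero_or_pos k with rfl | hk
    · rw [Nat.cast_zero, Real.zero_rpow (by linarith)]
      positivity
    · have hkp : (0 : ℝ) < k := by exact_mod_cast hk
      have hk' : (1 : ℝ) ≤ k := by exact_mod_cast hk
      rw [Real.rpow_neg hkp.le, Real.rpow_neg (by linarith), ← div_eq_mul_inv,
        ← Real.div_rpow (by norm_num) (by linarith), ← Real.inv_rpow hkp.le]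
      refine Real.rpow_le_rpow (by positivity) ?_ hσ0.le
      rw [inv_eq_one_div, div_le_div_iff₀ hkp (by linarith)]
      linarith
  have h3 := norm_sub_norm_le (gammaQuot a₁ a₂ a₃ b₁ b₂ b₃ (k + ε)) (((k : ℝ) ^ (-σ) : ℝ) : ℂ)
  rw [Complex.norm_real, Real.norm_of_nonneg (by positivity)] at h3
  have h4 : C * ((k : ℝ) + 1) ^ (-σ - 1) ≤ |C| * ((k : ℝ) + 1) ^ (-σ) := by
    refine (mul_le_mul_of_nonneg_right (le_abs_self C) (by positivity)).trans ?_
    gcongr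
  linarith [hC k ε hε]

/-! ### The Legendre function: coefficients, endpoint behaviour, Wronskian. -/

/-- The constant `sin (ν π) / π`. -/
noncomputable def sinDivPi (ν : ℂ) : ℂ := Complex.sin (ν * Real.pi) / Real.pi

theorem sinDivPi_ne_zero {ν : ℂ} (hν : ∀ n : ℤ, ν ≠ n) : sinDivPi ν ≠ 0 := by
  have hpi : (Real.pi : ℂ) ≠ 0 := by exact_mod_cast Real.pi_ne_zero
  refine div_ne_zero (fun h => ?_) hpi
  obtain ⟨k, hk⟩ := Complex.sin_eq_zero_iff.1 h
  exact hν k (mul_right_cancel₀ hpi hk)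

theorem gammaRegular_of_not_int {s : ℂ} (h : ∀ n : ℤ, s ≠ n) : GammaRegular s :=
  fun m hm => h (-m) (by simpa using hm)

theorem gammaRegular_of_re_pos {s : ℂ} (h : 0 < s.re) : GammaRegular s := by
  rintro m rfl
  simp at h
  have : (0 : ℝ) ≤ m := Nat.cast_nonneg m
  linarith

/-- The coefficients of the Legendre function in powers of `(1 - x) / 2`. -/
noncomputable def legendreCoeff (ν : ℂ) (n : ℕ) : ℂ :=
  (ascPochhammer ℂ n).eval (-ν) * (ascPochhammer ℂ n).eval (ν + 1) / (n.factorial : ℂ) ^ 2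

theorem legendreFn_eq_powSum (ν : ℂ) (x : ℝ) :
    legendreFn ν x = powSum (legendreCoeff ν) (((1 - x) / 2 : ℝ) : ℂ) := by
  rw [legendreFn, ordinaryHypergeometric_eq_tsum, powSum]
  refine tsum_congr fun n => ?_
  rw [ascPochhammer_eval_one, smul_eq_mul, legendreCoeff]
  have : (n.factorial : ℂ) ≠ 0 := by exact_mod_cast n.factorial_ne_zero
  field_simp

theorem legendreCoeff_zero (ν : ℂ) : legendreCoeff ν 0 = 1 := by simp [legendreCoeff]

theorem legendreCoeff_succ (ν : ℂ) (n : ℕ) :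
    ((n : ℂ) + 1) ^ 2 * legendreCoeff ν (n + 1) =
      ((n : ℂ) ^ 2 + n - ν * (ν + 1)) * legendreCoeff ν n := by
  have h1 : (n.factorial : ℂ) ≠ 0 := by exact_mod_cast n.factorial_ne_zero
  have h2 : (n : ℂ) + 1 ≠ 0 := by exact_mod_cast n.succ_ne_zero
  rw [legendreCoeff, legendreCoeff, ascPochhammer_succ_eval, ascPochhammer_succ_eval,
    Nat.factorial_succ]
  push_cast
  field_simp
  ring

section
variable {ν : ℂ}

theorem legendre_gammaQuotRegular (hν : ∀ n : ℤ, ν ≠ n) :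
    GammaQuotRegular (-ν) (ν + 1) 1 1 1 1 0 := by
  have h1 : GammaRegular (0 + 1) := gammaRegular_of_re_pos (by simp)
  refine ⟨?_, ?_, h1, h1, h1, h1⟩ <;> refine gammaRegular_of_not_int fun n hn => ?_
  · exact hν (-n) (by push_cast; linear_combination -hn)
  · exact hν (n - 1) (by push_cast; linear_combination hn)

/-- The reflection formula gives 1/(Γ(-ν)Γ(ν+1)) = -sin(νπ)/π. A factor Γ(n+1) is inserted above and
below to fit the three-by-three format. -/
theorem legendreCoeff_eq (hν : ∀ n : ℤ, ν ≠ n) (n : ℕ) :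
    legendreCoeff ν n = -sinDivPi ν * gammaQuot (-ν) (ν + 1) 1 1 1 1 n := by
  have hr := legendre_gammaQuotRegular hν
  have r1 := hr.a₁
  have r2 := hr.a₂
  rw [zero_add] at r1 r2
  have hpi : (Real.pi : ℂ) ≠ 0 := by exact_mod_cast Real.pi_ne_zero
  have hs : Complex.sin (ν * Real.pi) ≠ 0 := fun h => sinDivPi_ne_zero hν (by simp [sinDivPi, h])
  have hrefl := Complex.Gamma_mul_Gamma_one_sub (-ν)
  rw [show 1 - -ν = ν + 1 by ring, show (Real.pi : ℂ) * -ν = -(ν * Real.pi) by ring,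
    Complex.sin_neg] at hrefl
  have g1 := Complex.Gamma_ne_zero r1
  have g2 := Complex.Gamma_ne_zero r2
  have hf : (n.factorial : ℂ) ≠ 0 := by exact_mod_cast n.factorial_ne_zero
  have hS : -sinDivPi ν = 1 / (Complex.Gamma (-ν) * Complex.Gamma (ν + 1)) := by
    rw [hrefl, sinDivPi]
    field_simp
  rw [hS, legendreCoeff, ← Complex.Gamma_add_nat_div_Gamma_eq _ r1,
    ← Complex.Gamma_add_nat_div_Gamma_eq _ r2, gammaQuot, Complex.Gamma_nat_eq_factorial,
    add_comm (n : ℂ) (-ν), add_comm (n : ℂ) (ν + 1)]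
  field_simp

/-- The leading term -S_ν/n of the coefficients is what produces the logarithm of P_ν at -1; the
remainder is absolutely summable. At n = 0 the term n⁻¹ is 0 by convention. -/
theorem legendreCoeff_sub_le (hν : ∀ n : ℤ, ν ≠ n) : ∃ C : ℝ, ∀ n : ℕ,
    ‖legendreCoeff ν n + sinDivPi ν * (n : ℂ)⁻¹‖ ≤ C * ((n : ℝ) + 1) ^ (-2 : ℝ) := by
  obtain ⟨C, hC⟩ := gammaQuot_sub_rpow_le (r := 0) (σ := 1)
    (a₁ := -ν) (a₂ := ν + 1) (a₃ := 1) (b₁ := 1) (b₂ := 1) (b₃ := 1)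
    (fun ε hε => by
      rw [norm_le_zero_iff.1 hε]
      exact legendre_gammaQuotRegular hν) (by push_cast; ring)
  refine ⟨‖sinDivPi ν‖ * C, fun n => ?_⟩
  have := hC n 0 (by simp)
  rw [add_zero, Real.rpow_neg_one, show (-1 - 1 : ℝ) = -2 by norm_num] at this
  push_cast at this
  rw [legendreCoeff_eq hν, show -sinDivPi ν * gammaQuot (-ν) (ν + 1) 1 1 1 1 n +
    sinDivPi ν * (n : ℂ)⁻¹ = -sinDivPi ν * (gammaQuot (-ν) (ν + 1) 1 1 1 1 n - (n : ℂ)⁻¹) by ring,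
    norm_mul, norm_neg, mul_assoc]
  gcongr

theorem legendreCoeff_le (hν : ∀ n : ℤ, ν ≠ n) : ∃ C : ℝ, 0 ≤ C ∧ ∀ n : ℕ,
    ‖legendreCoeff ν n‖ ≤ C * ((n : ℝ) + 1)⁻¹ := by
  obtain ⟨C, hC0, hC⟩ := gammaQuot_le (r := 0) (σ := 1) one_pos
    (a₁ := -ν) (a₂ := ν + 1) (a₃ := 1) (b₁ := 1) (b₂ := 1) (b₃ := 1)
    (fun ε hε => by
      rw [norm_le_zero_iff.1 hε]
      exact legendre_gammaQuotRegular hν) (by push_cast; ring)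
  refine ⟨‖sinDivPi ν‖ * C, by positivity, fun n => ?_⟩
  have := hC n 0 (by simp)
  rw [add_zero, Real.rpow_neg_one] at this
  rw [legendreCoeff_eq hν, norm_mul, norm_neg, mul_assoc]
  gcongr

theorem legendreCoeff_le_const (hν : ∀ n : ℤ, ν ≠ n) : ∃ C : ℝ, 0 ≤ C ∧ ∀ n : ℕ,
    ‖legendreCoeff ν n‖ ≤ C := by
  obtain ⟨C, hC0, hC⟩ := legendreCoeff_le hν
  refine ⟨C, hC0, fun n => (hC n).trans (mul_le_of_le_one_right hC0 ?_)⟩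
  exact inv_le_one_of_one_le₀ (by linarith [(Nat.cast_nonneg n : (0 : ℝ) ≤ n)])

theorem polyBounded_legendreCoeff (hν : ∀ n : ℤ, ν ≠ n) : PolyBounded (legendreCoeff ν) :=
  let ⟨_, _, hC⟩ := legendreCoeff_le_const hν
  .of_le hC

theorem summable_add_one_rpow {s : ℝ} (hs : 1 < s) :
    Summable fun n : ℕ => ((n : ℝ) + 1) ^ (-s) := by
  have := (summable_nat_add_iff 1).2 (Real.summable_nat_rpow.2 (show -s < -1 by linarith))
  simpa using this

/-- The coefficients of `-(1 - x ^ 2) P_ν'(x) / (1 - x)` in powers of `(1 - x) / 2`. -/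
noncomputable def legendreDerivCoeff (ν : ℂ) (n : ℕ) : ℂ :=
  -(ν * (ν + 1)) * legendreCoeff ν n / (n + 1)

theorem legendreDerivCoeff_eq (ν : ℂ) (n : ℕ) :
    legendreDerivCoeff ν n =
      ((n + 1 : ℕ) : ℂ) * legendreCoeff ν (n + 1) - n * legendreCoeff ν n := by
  have h2 : (n : ℂ) + 1 ≠ 0 := by exact_mod_cast n.succ_ne_zero
  rw [legendreDerivCoeff]
  push_cast
  field_simp
  linear_combination -legendreCoeff_succ ν n

theorem summable_legendreDerivCoeff (hν : ∀ n : ℤ, ν ≠ n) :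
    Summable fun n => ‖legendreDerivCoeff ν n‖ := by
  obtain ⟨C, hC0, hC⟩ := legendreCoeff_le hν
  refine Summable.of_nonneg_of_le (fun n => norm_nonneg _) (fun n => ?_)
    ((summable_add_one_rpow (s := 2) (by norm_num)).mul_left (‖ν * (ν + 1)‖ * C))
  have hn : ‖(n : ℂ) + 1‖ = (n : ℝ) + 1 := by
    rw [show (n : ℂ) + 1 = ((n + 1 : ℕ) : ℂ) by push_cast; rfl, Complex.norm_natCast]
    push_cast; rfl
  have hn0 : (0 : ℝ) < n + 1 := by positivity
  rw [legendreDerivCoeff, norm_div, norm_mul, norm_neg, hn, Real.rpow_neg hn0.le, Real.rpow_two,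
    div_eq_mul_inv, mul_assoc, mul_assoc]
  refine mul_le_mul_of_nonneg_left ?_ (norm_nonneg _)
  calc _ ≤ (C * ((n : ℝ) + 1)⁻¹) * ((n : ℝ) + 1)⁻¹ := by gcongr; exact hC n
    _ = _ := by rw [mul_assoc, ← mul_inv, sq]

theorem tendsto_natCast_mul_legendreCoeff (hν : ∀ n : ℤ, ν ≠ n) :
    Tendsto (fun n : ℕ => n * legendreCoeff ν n) atTop (𝓝 (-sinDivPi ν)) := by
  obtain ⟨C, hC⟩ := legendreCoeff_sub_le hν
  rw [tendsto_iff_norm_sub_tendsto_zero]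
  refine squeeze_zero' (Eventually.of_forall fun n => norm_nonneg _) ?_
    (tendsto_const_div_atTop_nhds_zero_nat |C|)
  filter_upwards [eventually_ge_atTop 1] with n hn
  have hn0 : (n : ℂ) ≠ 0 := by exact_mod_cast (by omega : n ≠ 0)
  have hnr : (0 : ℝ) < n := by exact_mod_cast hn
  have e : n * legendreCoeff ν n - -sinDivPi ν =
      n * (legendreCoeff ν n + sinDivPi ν * (n : ℂ)⁻¹) := by
    field_simp
    ring
  rw [e, norm_mul, Complex.norm_natCast]
  calc (n : ℝ) * _ ≤ n * (|C| * ((n : ℝ) ^ 2)⁻¹) := by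
        gcongr
        refine (hC n).trans ?_
        rw [Real.rpow_neg (by positivity), Real.rpow_two]
        gcongr
        · exact le_abs_self C
        · linarith
    _ = |C| / n := by field_simp

/-- The coefficients are the differences of n ↦ n · `legendreCoeff ν n`, so their sum is the limit
of that sequence. -/
theorem tsum_legendreDerivCoeff (hν : ∀ n : ℤ, ν ≠ n) :
    ∑' n, legendreDerivCoeff ν n = -sinDivPi ν := by
  have h1 := (summable_legendreDerivCoeff hν).of_norm.hasSum.tendsto_sum_nat
  refine tendsto_nhds_unique h1 ((tendsto_natCast_mul_legendreCoeff hν).congr fun N => ?_)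
  simp only [legendreDerivCoeff_eq]
  rw [Finset.sum_range_sub (fun n : ℕ => (n : ℂ) * legendreCoeff ν n)]
  simp

/-- The function `(1 - x ^ 2) P_ν'(x)`. -/
noncomputable def legendreDeriv (ν : ℂ) (x : ℝ) : ℂ :=
  -(1 - x) * powSum (legendreDerivCoeff ν) (((1 - x) / 2 : ℝ) : ℂ)

theorem mem_Ioo_half {x : ℝ} (hx : x ∈ Set.Ioo (-1 : ℝ) 1) : (1 - x) / 2 ∈ Set.Ioo (0 : ℝ) 1 := by
  constructor <;> linarith [hx.1, hx.2]

theorem norm_half_lt {x : ℝ} (hx : x ∈ Set.Ioo (-1 : ℝ) 1) : ‖(((1 - x) / 2 : ℝ) : ℂ)‖ < 1 := by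
  have := mem_Ioo_half hx
  rw [Complex.norm_real, Real.norm_of_nonneg this.1.le]
  exact this.2

theorem legendreSystem (hν : ∀ n : ℤ, ν ≠ n) :
    LegendreSystem (ν * (ν + 1)) (legendreFn ν) (legendreDeriv ν) := by
  have hc := polyBounded_legendreCoeff hν
  have he : PolyBounded (legendreDerivCoeff ν) :=
    .of_le fun n => (summable_legendreDerivCoeff hν).le_tsum n fun _ _ => norm_nonneg _
  have ht (x : ℝ) : HasDerivAt (fun x : ℝ => (((1 - x) / 2 : ℝ) : ℂ)) (-1 / 2) x := by
    have := (((hasDerivAt_id x).const_sub 1).div_const 2).ofReal_comp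
    simpa using this
  constructor
  · intro x hx
    have hn := norm_half_lt hx
    have h1 := (hasDerivAt_powSum hc hn).comp x (ht x)
    have h2 : legendreFn ν = powSum (legendreCoeff ν) ∘ fun x : ℝ => (((1 - x) / 2 : ℝ) : ℂ) :=
      funext fun x => legendreFn_eq_powSum ν x
    rw [h2]
    refine h1.congr_deriv ?_
    set t : ℂ := (((1 - x) / 2 : ℝ) : ℂ) with htd
    have hx' : (x : ℂ) = 1 - 2 * t := by rw [htd]; push_cast; ring
    -- In terms of t = (1-x)/2 one has 1 - x² = 4t(1-t). Multiplying the series of the derivative by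
    -- 1 - t turns its coefficients into the differences defining `legendreDerivCoeff`.
    have key : (1 - t) * powSum (fun k => (k + 1) * legendreCoeff ν (k + 1)) t =
        powSum (legendreDerivCoeff ν) t := by
      rw [sub_mul, one_mul, mul_powSum_deriv hc hn, sub_eq_add_neg, ← neg_one_mul,
        ← powSum_const_mul]
      have hs : PolyBounded fun k : ℕ => ((k : ℂ) + 1) * legendreCoeff ν (k + 1) := by
        simpa using hc.natCast_mul.shift
      rw [← powSum_add hs (hc.natCast_mul.const_mul (-1)) hn]
      congr 1
      funext k
      rw [legendreDerivCoeff_eq]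
      push_cast
      ring
    have hne := one_sub_sq_ne_zero hx
    rw [legendreDeriv, ← key]
    rw [hx'] at hne ⊢
    field_simp
    ring
  · intro x hx
    have hn := norm_half_lt hx
    have h1 := (hasDerivAt_powSum he hn).comp x (ht x)
    have hc' : HasDerivAt (fun x : ℝ => -(1 - (x : ℂ))) 1 x := by
      have h := ((Complex.ofRealCLM.hasDerivAt (x := x)).const_sub 1).neg
      rw [Complex.ofRealCLM_apply, Complex.ofReal_one, neg_neg] at h
      exact h
    refine (hc'.mul h1).congr_deriv ?_
    simp only [Function.comp_apply]
    rw [legendreFn_eq_powSum]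
    set t : ℂ := (((1 - x) / 2 : ℝ) : ℂ) with htd
    have hx' : (x : ℂ) = 1 - 2 * t := by rw [htd]; push_cast; ring
    have h3 := mul_powSum_deriv he hn
    have key : powSum (fun k => k * legendreDerivCoeff ν k) t + powSum (legendreDerivCoeff ν) t =
        -(ν * (ν + 1)) * powSum (legendreCoeff ν) t := by
      rw [← powSum_add he.natCast_mul he hn, ← powSum_const_mul]
      congr 1
      funext k
      have h2 : (k : ℂ) + 1 ≠ 0 := by exact_mod_cast k.succ_ne_zero
      rw [legendreDerivCoeff]
      field_simp
      ring
    rw [hx']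
    linear_combination key + h3

/-- Removing -S_ν/n from the coefficients removes -S_ν ∑ t^n/n = S_ν log(1-t), where 1 - t =
(1+x)/2. The rest converges absolutely up to t = 1. -/
theorem norm_legendreFn_sub_log_le (hν : ∀ n : ℤ, ν ≠ n) : ∃ C : ℝ, 0 ≤ C ∧
    ∀ x ∈ Set.Ioo (-1 : ℝ) 1,
      ‖legendreFn ν x - sinDivPi ν * (Real.log ((1 + x) / 2) : ℂ)‖ ≤ C := by
  obtain ⟨C, hC⟩ := legendreCoeff_sub_le hν
  have hs : Summable fun n => ‖legendreCoeff ν n + sinDivPi ν * (n : ℂ)⁻¹‖ :=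
    Summable.of_nonneg_of_le (fun n => norm_nonneg _) hC
      ((summable_add_one_rpow (s := 2) (by norm_num)).mul_left C)
  refine ⟨∑' n, ‖legendreCoeff ν n + sinDivPi ν * (n : ℂ)⁻¹‖,
    tsum_nonneg fun _ => norm_nonneg _, fun x hx => ?_⟩
  have ht := mem_Ioo_half hx
  have hn := norm_half_lt hx
  have hinv : PolyBounded fun n : ℕ => (n : ℂ)⁻¹ := by
    refine .of_le (C := 1) fun n => ?_
    rw [norm_inv, Complex.norm_natCast]
    exact Nat.cast_inv_le_one n
  have hlog : powSum (fun n : ℕ => (n : ℂ)⁻¹) (((1 - x) / 2 : ℝ) : ℂ) =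
      -(Real.log ((1 + x) / 2) : ℂ) := by
    have h1 := Real.hasSum_pow_div_log_of_abs_lt_one (x := (1 - x) / 2)
      (by rw [abs_of_pos ht.1]; exact ht.2)
    have h2 := (Complex.hasSum_ofReal.2 h1).tsum_eq
    rw [powSum_eq_zero_add hinv hn, powSum, ← tsum_mul_left, ← Complex.ofReal_neg,
      show (1 + x) / 2 = 1 - (1 - x) / 2 by ring, ← h2]
    simp only [Nat.cast_zero, inv_zero, zero_add]
    refine tsum_congr fun n => ?_
    push_cast
    ring
  have e := norm_powSum_le_tsum hs ht.1.le ht.2.le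
  rw [powSum_add (polyBounded_legendreCoeff hν) (hinv.const_mul _) hn, powSum_const_mul, hlog,
    ← legendreFn_eq_powSum] at e
  rwa [mul_neg, ← sub_eq_add_neg] at e

theorem norm_legendreFn_sub_one_le (hν : ∀ n : ℤ, ν ≠ n) : ∃ C : ℝ, 0 ≤ C ∧
    ∀ x ∈ Set.Ico (0 : ℝ) 1, ‖legendreFn ν x - 1‖ ≤ C * (1 - x) := by
  obtain ⟨C, hC0, hC⟩ := legendreCoeff_le_const hν
  refine ⟨C, hC0, fun x hx => ?_⟩
  have hx' : x ∈ Set.Ioo (-1 : ℝ) 1 := ⟨by linarith [hx.1], hx.2⟩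
  have ht := mem_Ioo_half hx'
  rw [legendreFn_eq_powSum, powSum_eq_zero_add (polyBounded_legendreCoeff hν) (norm_half_lt hx'),
    legendreCoeff_zero, add_sub_cancel_left, norm_mul, Complex.norm_real,
    Real.norm_of_nonneg ht.1.le]
  have h1 := norm_powSum_le_div (fun k => hC (k + 1)) ht.1.le ht.2
  calc _ ≤ (1 - x) / 2 * (C / (1 - (1 - x) / 2)) := by
        have := ht.1.le
        gcongr
    _ ≤ (1 - x) / 2 * (C / (1 / 2)) := by
        have := ht.1.le
        gcongr
        linarith [hx.1]
    _ = _ := by ring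

theorem norm_legendreDeriv_le (hν : ∀ n : ℤ, ν ≠ n) : ∃ C : ℝ, 0 ≤ C ∧
    ∀ x ∈ Set.Ioo (-1 : ℝ) 1, ‖legendreDeriv ν x‖ ≤ C * (1 - x) := by
  refine ⟨∑' n, ‖legendreDerivCoeff ν n‖, tsum_nonneg fun _ => norm_nonneg _, fun x hx => ?_⟩
  have ht := mem_Ioo_half hx
  have h1 := norm_powSum_le_tsum (summable_legendreDerivCoeff hν) ht.1.le ht.2.le
  have h2 : ‖-(1 - (x : ℂ))‖ = 1 - x := by
    rw [norm_neg, ← Complex.ofReal_one, ← Complex.ofReal_sub, Complex.norm_real,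
      Real.norm_of_nonneg (by linarith [hx.2])]
  rw [legendreDeriv, norm_mul, h2, mul_comm]
  have : 0 ≤ 1 - x := by linarith [hx.2]
  gcongr

theorem tendsto_legendreDeriv_neg_one (hν : ∀ n : ℤ, ν ≠ n) :
    Tendsto (legendreDeriv ν) (𝓝[>] (-1)) (𝓝 (2 * sinDivPi ν)) := by
  have h1 := tendsto_powSum_one (summable_legendreDerivCoeff hν)
  rw [tsum_legendreDerivCoeff hν] at h1
  have h2 : Tendsto (fun x : ℝ => (1 - x) / 2) (𝓝[>] (-1)) (𝓝[<] 1) := by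
    refine tendsto_nhdsWithin_iff.2 ⟨?_, ?_⟩
    · have : Tendsto (fun x : ℝ => (1 - x) / 2) (𝓝 (-1)) (𝓝 ((1 - -1) / 2)) :=
        Continuous.tendsto (by fun_prop) (-1)
      norm_num at this
      exact this.mono_left nhdsWithin_le_nhds
    · filter_upwards [self_mem_nhdsWithin] with x hx
      have : -1 < x := hx
      simp only [Set.mem_Iio]
      linarith
  have h3 : Tendsto (fun x : ℝ => -(1 - (x : ℂ))) (𝓝[>] (-1)) (𝓝 (-2)) := by
    have : Tendsto (fun x : ℝ => -(1 - (x : ℂ))) (𝓝 (-1)) (𝓝 (-(1 - ((-1 : ℝ) : ℂ)))) :=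
      Continuous.tendsto (by fun_prop) (-1)
    rw [show -(1 - ((-1 : ℝ) : ℂ)) = -2 by norm_num] at this
    exact this.mono_left nhdsWithin_le_nhds
  have := h3.mul (h1.comp h2)
  rw [neg_mul_neg] at this
  exact this

theorem tendsto_legendreFn_one (hν : ∀ n : ℤ, ν ≠ n) :
    Tendsto (legendreFn ν) (𝓝[<] 1) (𝓝 1) := by
  obtain ⟨C, hC0, hC⟩ := norm_legendreFn_sub_one_le hν
  rw [tendsto_iff_norm_sub_tendsto_zero]
  have : Tendsto (fun x : ℝ => C * (1 - x)) (𝓝 1) (𝓝 (C * (1 - 1))) :=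
    Continuous.tendsto (by fun_prop) 1
  rw [sub_self, mul_zero] at this
  refine squeeze_zero' (Eventually.of_forall fun x => norm_nonneg _) ?_
    (this.mono_left nhdsWithin_le_nhds)
  filter_upwards [Ico_mem_nhdsLT (show (0 : ℝ) < 1 by norm_num)] with x hx
  exact hC x hx

/-- Any small negative power dominates the logarithm. With exponent 1/8, a product of three such
functions, or one with a weight and logarithms, stays below the integrable (1-x²)^(-1/2). -/
theorem norm_legendreFn_le_rpow (hν : ∀ n : ℤ, ν ≠ n) : ∃ C : ℝ, 0 ≤ C ∧
    ∀ x ∈ Set.Ioo (-1 : ℝ) 1, ‖legendreFn ν x‖ ≤ C * (1 - x ^ 2) ^ (-(1 / 8) : ℝ) := by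
  obtain ⟨C, hC0, hC⟩ := norm_legendreFn_sub_log_le hν
  refine ⟨C + ‖sinDivPi ν‖ * (8 * 4), by positivity, fun x hx => ?_⟩
  have hz0 : 0 < 1 - x ^ 2 := by nlinarith [hx.1, hx.2]
  have hz1 : 1 - x ^ 2 ≤ 1 := by nlinarith
  have hx0 : 0 < (1 + x) / 2 := by linarith [hx.1]
  have h1 : 1 ≤ (1 - x ^ 2) ^ (-(1 / 8) : ℝ) :=
    Real.one_le_rpow_of_pos_of_le_one_of_nonpos hz0 hz1 (by norm_num)
  have hlog : |Real.log ((1 + x) / 2)| ≤ 8 * 4 * (1 - x ^ 2) ^ (-(1 / 8) : ℝ) := by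
    rw [abs_of_nonpos (Real.log_nonpos hx0.le (by linarith [hx.2])), ← Real.log_inv]
    refine (Real.log_le_rpow_div (ε := 1 / 8) (by positivity) (by norm_num)).trans ?_
    rw [Real.inv_rpow hx0.le, ← Real.rpow_neg hx0.le]
    have h2 : ((1 + x) / 2) ^ (-(1 / 8) : ℝ) ≤ ((1 - x ^ 2) / 4) ^ (-(1 / 8) : ℝ) :=
      Real.rpow_le_rpow_of_nonpos (by positivity) (by nlinarith [hx.1, hx.2]) (by norm_num)
    rw [Real.div_rpow hz0.le (by norm_num)] at h2
    have h3 : ((4 : ℝ) ^ (-(1 / 8) : ℝ))⁻¹ ≤ 4 := by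
      rw [← Real.rpow_neg (by norm_num), neg_neg]
      calc (4 : ℝ) ^ (1 / 8 : ℝ) ≤ 4 ^ (1 : ℝ) :=
            Real.rpow_le_rpow_of_exponent_le (by norm_num) (by norm_num)
        _ = 4 := Real.rpow_one 4
    have h4 : (1 - x ^ 2) ^ (-(1 / 8) : ℝ) / 4 ^ (-(1 / 8) : ℝ) ≤
        (1 - x ^ 2) ^ (-(1 / 8) : ℝ) * 4 := by
      rw [div_eq_mul_inv]
      gcongr
    rw [div_le_iff₀ (by norm_num)]
    linarith
  have h5 := norm_le_norm_sub_add (legendreFn ν x) (sinDivPi ν * (Real.log ((1 + x) / 2) : ℂ))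
  rw [norm_mul, Complex.norm_real, Real.norm_eq_abs] at h5
  have h6 : ‖sinDivPi ν‖ * |Real.log ((1 + x) / 2)| ≤
      ‖sinDivPi ν‖ * (8 * 4 * (1 - x ^ 2) ^ (-(1 / 8) : ℝ)) := by gcongr
  have h7 := hC x hx
  nlinarith

theorem continuousOn_legendreFn (hν : ∀ n : ℤ, ν ≠ n) :
    ContinuousOn (legendreFn ν) (Set.Ioo (-1) 1) :=
  fun x hx => ((legendreSystem hν).dy x hx).continuousAt.continuousWithinAt

/-- The constant is evaluated as x → 1: P_ν(x) → 1, (1-x²)P_ν' at -x tends to 2S_ν, and the other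
product vanishes because O(1-x) beats the logarithm. -/
theorem legendre_wronskian (hν : ∀ n : ℤ, ν ≠ n) : ∀ x ∈ Set.Ioo (-1 : ℝ) 1,
    legendreFn ν x * -legendreDeriv ν (-x) - legendreDeriv ν x * legendreFn ν (-x) =
      -2 * sinDivPi ν := by
  have h := legendreSystem hν
  have hneg {x : ℝ} (hx : x ∈ Set.Ioo (-1 : ℝ) 1) : -x ∈ Set.Ioo (-1 : ℝ) 1 :=
    ⟨by linarith [hx.2], by linarith [hx.1]⟩
  have h₂ := h.comp_neg
  obtain ⟨W, hW⟩ := h.exists_wronskian_eq h₂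
  have hmem : Set.Ioo (0 : ℝ) 1 ∈ 𝓝[<] (1 : ℝ) := Ioo_mem_nhdsLT (by norm_num)
  have hnegt : Tendsto (fun x : ℝ => -x) (𝓝[<] 1) (𝓝[>] (-1)) := by
    refine tendsto_nhdsWithin_iff.2 ⟨?_, ?_⟩
    · exact (continuous_neg.tendsto 1).mono_left nhdsWithin_le_nhds
    · filter_upwards [self_mem_nhdsWithin] with x hx
      exact neg_lt_neg (Set.mem_Iio.1 hx)
  have t1 := (tendsto_legendreFn_one hν).mul ((tendsto_legendreDeriv_neg_one hν).comp hnegt).neg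
  have t2 : Tendsto (fun x => legendreDeriv ν x * legendreFn ν (-x)) (𝓝[<] 1) (𝓝 0) := by
    obtain ⟨C, hC0, hC⟩ := norm_legendreDeriv_le hν
    obtain ⟨D, hD0, hD⟩ := norm_legendreFn_le_rpow hν
    have hlim : Tendsto (fun x : ℝ => C * D * (1 - x) ^ (7 / 8 : ℝ)) (𝓝[<] 1) (𝓝 0) := by
      have : ContinuousAt (fun x : ℝ => C * D * (1 - x) ^ (7 / 8 : ℝ)) 1 :=
        continuousAt_const.mul ((continuousAt_const.sub continuousAt_id).rpow_const
          (Or.inr (by norm_num)))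
      have := this.tendsto.mono_left (nhdsWithin_le_nhds (s := Set.Iio 1))
      rwa [sub_self, Real.zero_rpow (by norm_num), mul_zero] at this
    refine squeeze_zero_norm' ?_ hlim
    filter_upwards [hmem] with x hx
    have hx' : x ∈ Set.Ioo (-1 : ℝ) 1 := ⟨by linarith [hx.1], hx.2⟩
    have hx1 : 0 < 1 - x := by linarith [hx.2]
    have h4 := hD (-x) (hneg hx')
    rw [neg_sq] at h4
    have h5 : (1 - x ^ 2) ^ (-(1 / 8) : ℝ) ≤ (1 - x) ^ (-(1 / 8) : ℝ) :=
      Real.rpow_le_rpow_of_nonpos hx1 (by nlinarith [hx.1]) (by norm_num)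
    rw [norm_mul]
    calc _ ≤ (C * (1 - x)) * (D * (1 - x) ^ (-(1 / 8) : ℝ)) := by
          gcongr
          · exact hC x hx'
          · exact h4.trans (by gcongr)
      _ = C * D * ((1 - x) ^ (1 : ℝ) * (1 - x) ^ (-(1 / 8) : ℝ)) := by rw [Real.rpow_one]; ring
      _ = _ := by rw [← Real.rpow_add hx1]; norm_num
  have t3 := t1.sub t2
  rw [one_mul, sub_zero] at t3
  have hWe : W = -2 * sinDivPi ν := by
    refine tendsto_nhds_unique (tendsto_const_nhds.congr' ?_)
      (t3.trans_eq (by rw [neg_mul]))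
    filter_upwards [hmem] with x hx
    exact (hW x ⟨by linarith [hx.1], hx.2⟩).symm
  exact fun x hx => (hW x hx).trans hWe
end

/-! ### Cauchy estimates for derivatives of Gamma quotients. -/

theorem gammaRegular_iff {s : ℂ} : GammaRegular s ↔ (Complex.Gamma s)⁻¹ ≠ 0 := by
  rw [ne_eq, inv_eq_zero, Complex.Gamma_eq_zero_iff]
  simp [GammaRegular]

/-- 1/Γ is entire, and the regular points are those where it does not vanish. -/
theorem isOpen_gammaRegular (c : ℂ) : IsOpen {s : ℂ | GammaRegular (s + c)} := by
  simp only [gammaRegular_iff]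
  exact isOpen_ne.preimage
    (Complex.differentiable_one_div_Gamma.continuous.comp (continuous_id.add continuous_const))

theorem isOpen_gammaQuotRegular (a₁ a₂ a₃ b₁ b₂ b₃ : ℂ) :
    IsOpen {s : ℂ | GammaQuotRegular a₁ a₂ a₃ b₁ b₂ b₃ s} := by
  have : {s : ℂ | GammaQuotRegular a₁ a₂ a₃ b₁ b₂ b₃ s} = {s | GammaRegular (s + a₁)} ∩
      {s | GammaRegular (s + a₂)} ∩ {s | GammaRegular (s + a₃)} ∩ {s | GammaRegular (s + b₁)} ∩
      {s | GammaRegular (s + b₂)} ∩ {s | GammaRegular (s + b₃)} := by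
    ext s
    exact ⟨fun h => ⟨⟨⟨⟨⟨h.a₁, h.a₂⟩, h.a₃⟩, h.b₁⟩, h.b₂⟩, h.b₃⟩,
      fun ⟨⟨⟨⟨⟨h1, h2⟩, h3⟩, h4⟩, h5⟩, h6⟩ => ⟨h1, h2, h3, h4, h5, h6⟩⟩
  rw [this]
  exact (((((isOpen_gammaRegular a₁).inter (isOpen_gammaRegular a₂)).inter
    (isOpen_gammaRegular a₃)).inter (isOpen_gammaRegular b₁)).inter
    (isOpen_gammaRegular b₂)).inter (isOpen_gammaRegular b₃)

section
variable {a₁ a₂ a₃ b₁ b₂ b₃ : ℂ}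

theorem GammaQuotRegular.exists_radius (h : GammaQuotRegular a₁ a₂ a₃ b₁ b₂ b₃ 0) :
    ∃ r > 0, ∀ ε : ℂ, ‖ε‖ ≤ r → GammaQuotRegular a₁ a₂ a₃ b₁ b₂ b₃ ε := by
  obtain ⟨r, hr, hb⟩ := Metric.nhds_basis_closedBall.mem_iff.1
    ((isOpen_gammaQuotRegular a₁ a₂ a₃ b₁ b₂ b₃).mem_nhds h)
  exact ⟨r, hr, fun ε hε => hb (by simpa using hε)⟩

theorem differentiableOn_gammaQuot :
    DifferentiableOn ℂ (gammaQuot a₁ a₂ a₃ b₁ b₂ b₃) {s | GammaQuotRegular a₁ a₂ a₃ b₁ b₂ b₃ s} :=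
  fun _ hs => (differentiableAt_gammaQuot hs).differentiableWithinAt

theorem GammaQuotRegular.natCast (h : GammaQuotRegular a₁ a₂ a₃ b₁ b₂ b₃ 0) (k : ℕ) :
    GammaQuotRegular a₁ a₂ a₃ b₁ b₂ b₃ k := by simpa using h.natCast_add k

/-- Cauchy estimates for the derivatives of a Gamma quotient at the natural numbers. -/
theorem iteratedDeriv_gammaQuot_le {σ : ℝ} (h : GammaQuotRegular a₁ a₂ a₃ b₁ b₂ b₃ 0)
    (hσ : b₁ + b₂ + b₃ - a₁ - a₂ - a₃ = σ) (n : ℕ) :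
    ∃ C : ℝ, ∀ k : ℕ, ‖iteratedDeriv (n + 1) (gammaQuot a₁ a₂ a₃ b₁ b₂ b₃) k‖ ≤
      C * ((k : ℝ) + 1) ^ (-σ - 1) := by
  obtain ⟨r, hr, hreg⟩ := h.exists_radius
  obtain ⟨C, hC⟩ := gammaQuot_sub_rpow_le hreg hσ
  refine ⟨(n + 1).factorial * C / r ^ (n + 1), fun k => ?_⟩
  -- Subtracting the constant k^(-σ) leaves all derivatives unchanged but improves the bound on the
  -- circle around k by one power. Every derivative thus decays one power faster than the quotient.
  set f : ℂ → ℂ := fun s => gammaQuot a₁ a₂ a₃ b₁ b₂ b₃ s - (((k : ℝ) ^ (-σ) : ℝ) : ℂ) with hf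
  have hmem (s : ℂ) (hs : s ∈ Metric.closedBall (k : ℂ) r) :
      GammaQuotRegular a₁ a₂ a₃ b₁ b₂ b₃ s := by
    have := (hreg (s - k) (by rwa [← dist_eq_norm])).natCast_add k
    rwa [add_sub_cancel] at this
  have hd : DifferentiableOn ℂ f (Metric.closedBall (k : ℂ) r) := fun s hs =>
    ((differentiableAt_gammaQuot (hmem s hs)).sub_const _).differentiableWithinAt
  have hcl : DiffContOnCl ℂ f (Metric.ball (k : ℂ) r) := by
    refine DifferentiableOn.diffContOnCl ?_
    rwa [closure_ball _ hr.ne']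
  have key := Complex.norm_iteratedDeriv_le_of_forall_mem_sphere_norm_le (n + 1) hr hcl
    (C := C * ((k : ℝ) + 1) ^ (-σ - 1)) (fun s hs => by
      have h1 : ‖s - k‖ = r := by rwa [← dist_eq_norm]
      have := hC k (s - k) h1.le
      rwa [add_sub_cancel] at this)
  have he : iteratedDeriv (n + 1) f = iteratedDeriv (n + 1) (gammaQuot a₁ a₂ a₃ b₁ b₂ b₃) := by
    rw [iteratedDeriv_succ', iteratedDeriv_succ']
    congr 1
    funext s
    exact deriv_sub_const _
  rw [he] at key
  refine key.trans (le_of_eq ?_)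
  ring
end

/-! ### The two logarithmic solutions and their coefficients. -/

theorem iteratedDeriv_two_eq (f : ℂ → ℂ) : iteratedDeriv 2 f = deriv (deriv f) := by
  rw [iteratedDeriv_succ, iteratedDeriv_one]

/-- Derivatives of the functional equation behind `SymSqRec`. -/
theorem deriv_symSq_functional {f : ℂ → ℂ} {U : Set ℂ} {lam : ℂ} (hU : IsOpen U)
    (hU1 : ∀ s ∈ U, s + 1 ∈ U) (hf : DifferentiableOn ℂ f U)
    (h : ∀ s ∈ U, 4 * ((s + 1) ^ 3 * f (s + 1)) =
      (4 * s ^ 3 + 6 * s ^ 2 + (2 - 4 * lam) * s + -2 * lam) * f s) :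
    (∀ s ∈ U, 4 * ((s + 1) ^ 3 * deriv f (s + 1) + 3 * (s + 1) ^ 2 * f (s + 1)) =
      (4 * s ^ 3 + 6 * s ^ 2 + (2 - 4 * lam) * s + -2 * lam) * deriv f s +
        (12 * s ^ 2 + 12 * s + (2 - 4 * lam)) * f s) ∧
    ∀ s ∈ U, 4 * ((s + 1) ^ 3 * deriv (deriv f) (s + 1) + 6 * (s + 1) ^ 2 * deriv f (s + 1) +
        6 * (s + 1) * f (s + 1)) =
      (4 * s ^ 3 + 6 * s ^ 2 + (2 - 4 * lam) * s + -2 * lam) * deriv (deriv f) s +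
        2 * (12 * s ^ 2 + 12 * s + (2 - 4 * lam)) * deriv f s + (24 * s + 12) * f s := by
  have hf' : DifferentiableOn ℂ (deriv f) U := hf.deriv hU
  have d0 {g : ℂ → ℂ} (hg : DifferentiableOn ℂ g U) (s : ℂ) (hs : s ∈ U) :
      HasDerivAt g (deriv g s) s := (hg.differentiableAt (hU.mem_nhds hs)).hasDerivAt
  have d1 {g : ℂ → ℂ} (hg : DifferentiableOn ℂ g U) (s : ℂ) (hs : s ∈ U) :
      HasDerivAt (fun s => g (s + 1)) (deriv g (s + 1)) s :=
    (d0 hg (s + 1) (hU1 s hs)).comp_add_const s 1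
  have hid (s : ℂ) : HasDerivAt (fun s : ℂ => s) 1 s := hasDerivAt_id s
  have p3 (s : ℂ) : HasDerivAt (fun s : ℂ => (s + 1) ^ 3) (3 * (s + 1) ^ 2) s := by
    refine (((hid s).add_const 1).pow 3).congr_deriv ?_
    simp
  have p2 (s : ℂ) : HasDerivAt (fun s : ℂ => 3 * (s + 1) ^ 2) (6 * (s + 1)) s := by
    refine ((((hid s).add_const 1).pow 2).const_mul 3).congr_deriv ?_
    simp
    ring
  have q3 (s : ℂ) : HasDerivAt
      (fun s : ℂ => 4 * s ^ 3 + 6 * s ^ 2 + (2 - 4 * lam) * s + -2 * lam)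
      (12 * s ^ 2 + 12 * s + (2 - 4 * lam)) s := by
    refine (((((hid s).pow 3).const_mul 4).add (((hid s).pow 2).const_mul 6)).add
      ((hid s).const_mul (2 - 4 * lam)) |>.add_const _).congr_deriv ?_
    simp
    ring
  have q2 (s : ℂ) : HasDerivAt (fun s : ℂ => 12 * s ^ 2 + 12 * s + (2 - 4 * lam))
      (24 * s + 12) s := by
    refine (((((hid s).pow 2).const_mul 12).add ((hid s).const_mul 12)).add_const _).congr_deriv ?_
    simp
    ring
  have h1 : ∀ s ∈ U, 4 * ((s + 1) ^ 3 * deriv f (s + 1) + 3 * (s + 1) ^ 2 * f (s + 1)) =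
      (4 * s ^ 3 + 6 * s ^ 2 + (2 - 4 * lam) * s + -2 * lam) * deriv f s +
        (12 * s ^ 2 + 12 * s + (2 - 4 * lam)) * f s := by
    intro s hs
    have l := ((p3 s).mul (d1 hf s hs)).const_mul 4
    have r := (q3 s).mul (d0 hf s hs)
    have e := l.unique (r.congr_of_eventuallyEq (by
      filter_upwards [hU.mem_nhds hs] with t ht
      exact h t ht))
    linear_combination e
  refine ⟨h1, fun s hs => ?_⟩
  have l := (((p3 s).mul (d1 hf' s hs)).add ((p2 s).mul (d1 hf s hs))).const_mul 4
  have r := ((q3 s).mul (d0 hf' s hs)).add ((q2 s).mul (d0 hf s hs))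
  have e := l.unique (r.congr_of_eventuallyEq (by
    filter_upwards [hU.mem_nhds hs] with t ht
    exact h1 t ht))
  linear_combination e

/-- The Gamma quotient generating the logarithmic solutions of the symmetric square of the
Legendre equation. -/
noncomputable def symSqQuot (ν : ℂ) : ℂ → ℂ := gammaQuot (1 / 2) (-ν) (ν + 1) 1 1 1

section
variable {ν : ℂ}

theorem symSq_gammaQuotRegular (hν : ∀ n : ℤ, ν ≠ n) :
    GammaQuotRegular (1 / 2) (-ν) (ν + 1) 1 1 1 0 := by
  have h := legendre_gammaQuotRegular hν
  exact ⟨gammaRegular_of_re_pos (by norm_num), h.a₁, h.a₂, h.b₁, h.b₁, h.b₁⟩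

theorem symSqQuot_zero_ne_zero (hν : ∀ n : ℤ, ν ≠ n) : symSqQuot ν 0 ≠ 0 :=
  gammaQuot_ne_zero (symSq_gammaQuotRegular hν)

theorem symSqQuot_le (hν : ∀ n : ℤ, ν ≠ n) : ∃ C : ℝ, 0 ≤ C ∧
    ∀ k : ℕ, ‖symSqQuot ν k‖ ≤ C * ((k : ℝ) + 1) ^ (-(3 / 2) : ℝ) := by
  obtain ⟨C, hC0, hC⟩ := gammaQuot_le (r := 0) (σ := 3 / 2) (by norm_num)
    (a₁ := 1 / 2) (a₂ := -ν) (a₃ := ν + 1) (b₁ := 1) (b₂ := 1) (b₃ := 1)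
    (fun ε hε => by
      rw [norm_le_zero_iff.1 hε]
      exact symSq_gammaQuotRegular hν) (by push_cast; ring)
  exact ⟨C, hC0, fun k => by simpa [symSqQuot] using hC k 0 (by simp)⟩

theorem deriv_symSqQuot_le (hν : ∀ n : ℤ, ν ≠ n) : ∃ C : ℝ, 0 ≤ C ∧
    ∀ k : ℕ, ‖deriv (symSqQuot ν) k‖ ≤ C * ((k : ℝ) + 1) ^ (-(5 / 2) : ℝ) ∧
      ‖deriv (deriv (symSqQuot ν)) k‖ ≤ C * ((k : ℝ) + 1) ^ (-(5 / 2) : ℝ) := by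
  have hσ : (1 : ℂ) + 1 + 1 - 1 / 2 - -ν - (ν + 1) = ((3 / 2 : ℝ) : ℂ) := by push_cast; ring
  obtain ⟨C, hC⟩ := iteratedDeriv_gammaQuot_le (symSq_gammaQuotRegular hν) hσ 0
  obtain ⟨D, hD⟩ := iteratedDeriv_gammaQuot_le (symSq_gammaQuotRegular hν) hσ 1
  rw [zero_add, iteratedDeriv_one, show (-(3 / 2) - 1 : ℝ) = -(5 / 2) by norm_num] at hC
  rw [one_add_one_eq_two, iteratedDeriv_two_eq,
    show (-(3 / 2) - 1 : ℝ) = -(5 / 2) by norm_num] at hD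
  refine ⟨|C| + |D|, by positivity, fun k => ?_⟩
  have hp : (0 : ℝ) < ((k : ℝ) + 1) ^ (-(5 / 2) : ℝ) := by positivity
  constructor
  · refine (hC k).trans ?_
    gcongr
    linarith [le_abs_self C, abs_nonneg D]
  · refine (hD k).trans ?_
    gcongr
    linarith [le_abs_self D, abs_nonneg C]

/-- Coefficients of the solution with a single logarithm. -/
noncomputable def logCoeffOne (ν : ℂ) : Fin 3 → ℕ → ℂ :=
  ![fun _ => 0, fun k => symSqQuot ν k / 2, fun k => deriv (symSqQuot ν) k]

/-- Coefficients of the solution with a squared logarithm. -/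
noncomputable def logCoeffTwo (ν : ℂ) : Fin 3 → ℕ → ℂ :=
  ![fun k => symSqQuot ν k, fun k => deriv (symSqQuot ν) k, fun k => deriv (deriv (symSqQuot ν)) k]

/-- The shift equation a(s+1)(s+1)³ = a(s)(s+1/2)(s-ν)(s+ν+1), together with its first and second
derivatives at s = k, is exactly the recurrence for the 2-jet of a. The halved entry of
`logCoeffOne` compensates the 2 in front of the single logarithm in `logSum`. -/
theorem symSqRec_logCoeff (hν : ∀ n : ℤ, ν ≠ n) :
    SymSqRec (ν * (ν + 1)) (logCoeffOne ν) ∧ SymSqRec (ν * (ν + 1)) (logCoeffTwo ν) := by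
  have hreg := symSq_gammaQuotRegular hν
  have h0 : ∀ s ∈ {s : ℂ | GammaQuotRegular (1 / 2) (-ν) (ν + 1) 1 1 1 s},
      4 * ((s + 1) ^ 3 * symSqQuot ν (s + 1)) =
      (4 * s ^ 3 + 6 * s ^ 2 + (2 - 4 * (ν * (ν + 1))) * s + -2 * (ν * (ν + 1))) *
        symSqQuot ν s := by
    intro s hs
    have := gammaQuot_add_one hs
    rw [symSqQuot]
    linear_combination 4 * this
  obtain ⟨h1, h2⟩ := deriv_symSq_functional (isOpen_gammaQuotRegular _ _ _ _ _ _)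
    (fun s hs => by simpa [add_comm] using GammaQuotRegular.natCast_add hs 1)
    differentiableOn_gammaQuot h0
  constructor
  · intro j k
    have hk := hreg.natCast k
    have e0 := h0 k hk
    have e1 := h1 k hk
    fin_cases j <;> simp only [logTheta, logCoeffOne, Matrix.cons_val, Fin.zero_eta, Fin.mk_one,
      Fin.reduceFinMk] <;> push_cast
    · ring
    · linear_combination e0 / 2
    · rw [← symSqQuot] at e1
      linear_combination e1
  · intro j k
    have hk := hreg.natCast k
    have e0 := h0 k hk
    have e1 := h1 k hk
    have e2 := h2 k hk
    rw [← symSqQuot] at e1 e2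
    fin_cases j <;> simp only [logTheta, logCoeffTwo, Matrix.cons_val, Fin.zero_eta, Fin.mk_one,
      Fin.reduceFinMk] <;> push_cast
    · linear_combination e0
    · linear_combination e1
    · linear_combination e2

/-- a(k) decays like k^(-3/2), while a' and a'' are O(k^(-5/2)). So only k·a(k) fails to be
summable, and boundedness suffices there because it is multiplied by a logarithm at z = 1. -/
theorem symSq_coeff_bounds (hν : ∀ n : ℤ, ν ≠ n) : ∃ C : ℝ, 0 ≤ C ∧ ∀ k : ℕ,
    ‖symSqQuot ν k‖ ≤ C * ((k : ℝ) + 1) ^ (-(3 / 2) : ℝ) ∧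
    ‖deriv (symSqQuot ν) k‖ ≤ C * ((k : ℝ) + 1) ^ (-(3 / 2) : ℝ) ∧
    ‖deriv (deriv (symSqQuot ν)) k‖ ≤ C * ((k : ℝ) + 1) ^ (-(3 / 2) : ℝ) ∧
    ‖k * symSqQuot ν k‖ ≤ C ∧
    ‖k * deriv (symSqQuot ν) k‖ ≤ C * ((k : ℝ) + 1) ^ (-(3 / 2) : ℝ) ∧
    ‖k * deriv (deriv (symSqQuot ν)) k‖ ≤ C * ((k : ℝ) + 1) ^ (-(3 / 2) : ℝ) := by
  obtain ⟨C, hC0, hC⟩ := symSqQuot_le hν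
  obtain ⟨D, hD0, hD⟩ := deriv_symSqQuot_le hν
  refine ⟨C + D, by positivity, fun k => ?_⟩
  have hk0 : (0 : ℝ) ≤ k := Nat.cast_nonneg k
  have hk : (1 : ℝ) ≤ k + 1 := by linarith
  have hkp : (0 : ℝ) < k + 1 := by linarith
  have hle : ((k : ℝ) + 1) ^ (-(5 / 2) : ℝ) ≤ ((k : ℝ) + 1) ^ (-(3 / 2) : ℝ) :=
    Real.rpow_le_rpow_of_exponent_le hk (by norm_num)
  have hmul : (k : ℝ) * ((k : ℝ) + 1) ^ (-(5 / 2) : ℝ) ≤ ((k : ℝ) + 1) ^ (-(3 / 2) : ℝ) := by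
    have : ((k : ℝ) + 1) ^ (-(3 / 2) : ℝ) = (k + 1) * ((k : ℝ) + 1) ^ (-(5 / 2) : ℝ) := by
      rw [show (-(3 / 2) : ℝ) = 1 + -(5 / 2) by norm_num, Real.rpow_add hkp, Real.rpow_one]
    rw [this]
    gcongr
    linarith
  have hmul0 : (k : ℝ) * ((k : ℝ) + 1) ^ (-(3 / 2) : ℝ) ≤ 1 := by
    calc _ ≤ ((k : ℝ) + 1) * ((k : ℝ) + 1) ^ (-1 : ℝ) := by
          gcongr
          · linarith
          · norm_num
      _ = 1 := by rw [Real.rpow_neg_one]; field_simp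
  have hp : (0 : ℝ) < ((k : ℝ) + 1) ^ (-(3 / 2) : ℝ) := by positivity
  have hCp := mul_nonneg hC0 hp.le
  have hDp := mul_nonneg hD0 hp.le
  have f1 := hC k
  have f2 := (hD k).1
  have f3 := (hD k).2
  have g1 := mul_le_mul_of_nonneg_left f1 hk0
  have g2 := mul_le_mul_of_nonneg_left f2 hk0
  have g3 := mul_le_mul_of_nonneg_left f3 hk0
  have m1 := mul_le_mul_of_nonneg_left hle hD0
  have m2 := mul_le_mul_of_nonneg_left hmul hD0
  have m3 := mul_le_mul_of_nonneg_left hmul0 hC0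
  simp only [norm_mul, Complex.norm_natCast]
  refine ⟨?_, ?_, ?_, ?_, ?_, ?_⟩ <;> nlinarith

theorem rpow_neg_three_halves_le_one (k : ℕ) : ((k : ℝ) + 1) ^ (-(3 / 2) : ℝ) ≤ 1 :=
  Real.rpow_le_one_of_one_le_of_nonpos (by linarith [(Nat.cast_nonneg k : (0 : ℝ) ≤ k)])
    (by norm_num)

theorem polyBounded_logCoeff (hν : ∀ n : ℤ, ν ≠ n) :
    (∀ j, PolyBounded (logCoeffOne ν j)) ∧ ∀ j, PolyBounded (logCoeffTwo ν j) := by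
  obtain ⟨C, hC0, hC⟩ := symSq_coeff_bounds hν
  have B {f : ℕ → ℂ} (hf : ∀ k, ‖f k‖ ≤ C * ((k : ℝ) + 1) ^ (-(3 / 2) : ℝ)) : PolyBounded f :=
    .of_le fun k => (hf k).trans (mul_le_of_le_one_right hC0 (rpow_neg_three_halves_le_one k))
  have b0 := B fun k => (hC k).1
  have b1 := B fun k => (hC k).2.1
  have b2 := B fun k => (hC k).2.2.1
  constructor <;> intro j <;> fin_cases j
  · exact .of_le (C := 0) fun k => by simp [logCoeffOne]
  · have := b0.const_mul (1 / 2)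
    simpa [logCoeffOne, div_eq_inv_mul] using this
  · exact b1
  · exact b0
  · exact b1
  · exact b2

theorem tendsto_logCoeff_zero (hν : ∀ n : ℤ, ν ≠ n) :
    Tendsto (fun x : ℝ => -2 * (x : ℂ) * logSum (logTheta (logCoeffOne ν)) (1 - x ^ 2))
      (𝓝[>] 0) (𝓝 0) ∧
    Tendsto (fun x : ℝ => -2 * (x : ℂ) * logSum (logTheta (logCoeffTwo ν)) (1 - x ^ 2))
      (𝓝[>] 0) (𝓝 0) := by
  obtain ⟨C, hC0, hC⟩ := symSq_coeff_bounds hν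
  have hs : Summable fun k : ℕ => 3 * C * ((k : ℝ) + 1) ^ (-(3 / 2) : ℝ) :=
    (summable_add_one_rpow (by norm_num)).mul_left (3 * C)
  have hw (k : ℕ) : C * ((k : ℝ) + 1) ^ (-(3 / 2) : ℝ) ≤ C :=
    mul_le_of_le_one_right hC0 (rpow_neg_three_halves_le_one k)
  constructor
  · refine tendsto_logSum_logTheta (C := 2 * C) (fun k => ?_) (fun k => ?_)
      (.of_nonneg_of_le (fun _ => norm_nonneg _) (fun k => ?_) hs)
    · simpa [logTheta, logCoeffOne] using hC0
    · simp only [logTheta, logCoeffOne, Matrix.cons_val, add_zero]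
      have := (hC k).2.2.2.1
      rw [← mul_div_assoc, norm_div, Complex.norm_ofNat]
      linarith [norm_nonneg (k * symSqQuot ν k)]
    · simp only [logTheta, logCoeffOne, Matrix.cons_val]
      have h1 := (hC k).2.2.2.2.1
      have h2 := (hC k).1
      rw [mul_div_cancel₀ _ two_ne_zero]
      have h3 : 0 ≤ C * ((k : ℝ) + 1) ^ (-(3 / 2) : ℝ) := by positivity
      refine (norm_add_le _ _).trans ?_
      linarith
  · refine tendsto_logSum_logTheta (C := 2 * C) (fun k => ?_) (fun k => ?_)
      (.of_nonneg_of_le (fun _ => norm_nonneg _) (fun k => ?_) hs)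
    · simp only [logTheta, logCoeffTwo, Matrix.cons_val]
      linarith [(hC k).2.2.2.1]
    · simp only [logTheta, logCoeffTwo, Matrix.cons_val]
      have h1 := (hC k).2.2.2.2.1
      have h2 := (hC k).1
      refine (norm_add_le _ _).trans ?_
      linarith [hw k]
    · simp only [logTheta, logCoeffTwo, Matrix.cons_val]
      have h1 := (hC k).2.2.2.2.2
      have h2 := (hC k).2.1
      have h3 : ‖2 * deriv (symSqQuot ν) k‖ = 2 * ‖deriv (symSqQuot ν) k‖ := by
        rw [norm_mul, Complex.norm_ofNat]
      refine (norm_add_le _ _).trans ?_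
      linarith

end

/-! ### Comparison of logarithmic growth at x = 1, and the product formulas. -/

/-- `log (1 - x ^ 2)` as a complex number. -/
noncomputable def logOneSubSq (x : ℝ) : ℂ := (Real.log (1 - x ^ 2) : ℂ)

theorem tendsto_one_sub_sq : Tendsto (fun x : ℝ => 1 - x ^ 2) (𝓝[<] 1) (𝓝[>] 0) := by
  refine tendsto_nhdsWithin_iff.2 ⟨?_, ?_⟩
  · have : Tendsto (fun x : ℝ => 1 - x ^ 2) (𝓝 1) (𝓝 (1 - 1 ^ 2)) :=
      Continuous.tendsto (by fun_prop) 1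
    rw [one_pow, sub_self] at this
    exact this.mono_left nhdsWithin_le_nhds
  · filter_upwards [Ioo_mem_nhdsLT (show (0 : ℝ) < 1 by norm_num)] with x hx
    simp only [Set.mem_Ioi]
    nlinarith [hx.1, hx.2]

theorem tendsto_inv_logOneSubSq : Tendsto (fun x => (logOneSubSq x)⁻¹) (𝓝[<] 1) (𝓝 0) := by
  have h := (Real.tendsto_log_nhdsGT_zero.comp tendsto_one_sub_sq).inv_tendsto_atBot
  have h2 := (Complex.continuous_ofReal.tendsto 0).comp h
  rw [Complex.ofReal_zero] at h2
  refine h2.congr fun x => ?_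
  simp [logOneSubSq]

theorem eventually_logOneSubSq_ne_zero : ∀ᶠ x in 𝓝[<] (1 : ℝ), logOneSubSq x ≠ 0 := by
  filter_upwards [Ioo_mem_nhdsLT (show (0 : ℝ) < 1 by norm_num)] with x hx
  have h0 : 0 < 1 - x ^ 2 := by nlinarith [hx.1, hx.2]
  have h1 : 1 - x ^ 2 < 1 := by nlinarith [hx.1]
  rw [logOneSubSq]
  exact_mod_cast (Real.log_neg h0 h1).ne

theorem abs_log_sq_mul_le {z : ℝ} (h0 : 0 < z) (h1 : z ≤ 1) : Real.log z ^ 2 * z ≤ 4 := by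
  have h := Real.log_le_rpow_div (x := z⁻¹) (ε := 1 / 2) (by positivity) (by norm_num)
  rw [Real.log_inv, Real.inv_rpow h0.le, ← Real.sqrt_eq_rpow] at h
  have h2 : -Real.log z ≤ 2 * (√z)⁻¹ := by linarith
  have h3 : 0 ≤ -Real.log z := by linarith [Real.log_nonpos h0.le h1]
  have hs : 0 < √z := Real.sqrt_pos.2 h0
  calc Real.log z ^ 2 * z = (-Real.log z) ^ 2 * (√z) ^ 2 := by rw [Real.sq_sqrt h0.le]; ring
    _ ≤ (2 * (√z)⁻¹) ^ 2 * (√z) ^ 2 := by gcongr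
    _ = 4 := by field_simp; norm_num

theorem logOneSubSq_sq_mul_isBigO :
    (fun x : ℝ => logOneSubSq x ^ 2 * (1 - (x : ℂ) ^ 2)) =O[𝓝[<] 1] fun _ => (1 : ℂ) := by
  refine IsBigO.of_bound 4 ?_
  filter_upwards [Ioo_mem_nhdsLT (show (0 : ℝ) < 1 by norm_num)] with x hx
  have h0 : 0 < 1 - x ^ 2 := by nlinarith [hx.1, hx.2]
  have h1 : 1 - x ^ 2 ≤ 1 := by nlinarith
  have := abs_log_sq_mul_le h0 h1
  rw [logOneSubSq, show (1 : ℂ) - (x : ℂ) ^ 2 = ((1 - x ^ 2 : ℝ) : ℂ) by push_cast; rfl,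
    ← Complex.ofReal_pow, ← Complex.ofReal_mul, Complex.norm_real,
    Real.norm_of_nonneg (by positivity), norm_one, mul_one]
  exact this

theorem one_isBigO_logOneSubSq : (fun _ : ℝ => (1 : ℂ)) =O[𝓝[<] 1] logOneSubSq := by
  have h := tendsto_inv_logOneSubSq.isBigO_one ℂ
  have := h.mul (isBigO_refl logOneSubSq (𝓝[<] 1))
  refine (this.congr' ?_ ?_)
  · filter_upwards [eventually_logOneSubSq_ne_zero] with x hx
    exact inv_mul_cancel₀ hx
  · exact Eventually.of_forall fun x => one_mul _

theorem logOneSubSq_mul_isBigO :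
    (fun x : ℝ => logOneSubSq x * (1 - (x : ℂ) ^ 2)) =O[𝓝[<] 1] fun _ => (1 : ℂ) := by
  have h := (one_isBigO_logOneSubSq.mul
    (isBigO_refl (fun x : ℝ => logOneSubSq x * (1 - (x : ℂ) ^ 2)) (𝓝[<] 1)))
  refine (h.congr_left (fun x => one_mul _)).trans
    (logOneSubSq_sq_mul_isBigO.congr_left fun x => ?_)
  ring

theorem powSum_sub_isBigO {α : ℕ → ℂ} (hα : PolyBounded α) :
    (fun x : ℝ => powSum α ((1 - x ^ 2 : ℝ) : ℂ) - α 0) =O[𝓝[<] 1]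
      fun x : ℝ => 1 - (x : ℂ) ^ 2 := by
  have hz : Tendsto (fun x : ℝ => ((1 - x ^ 2 : ℝ) : ℂ)) (𝓝[<] 1) (𝓝 0) := by
    have := (Complex.continuous_ofReal.tendsto 0).comp
      (tendsto_one_sub_sq.mono_right nhdsWithin_le_nhds)
    rwa [Complex.ofReal_zero] at this
  have hb := (((continuousAt_powSum hα.shift (z := 0) (by simp)).tendsto.comp hz).isBigO_one ℂ)
  have := (isBigO_refl (fun x : ℝ => 1 - (x : ℂ) ^ 2) (𝓝[<] 1)).mul hb
  simp only [mul_one] at this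
  refine this.congr' ?_ EventuallyEq.rfl
  filter_upwards [Ioo_mem_nhdsLT (show (0 : ℝ) < 1 by norm_num)] with x hx
  have h0 : 0 < 1 - x ^ 2 := by nlinarith [hx.1, hx.2]
  have h1 : 1 - x ^ 2 < 1 := by nlinarith [hx.1]
  rw [powSum_eq_zero_add hα (by rwa [Complex.norm_real, Real.norm_of_nonneg h0.le])]
  simp

theorem powSum_isBigO_one {α : ℕ → ℂ} (hα : PolyBounded α) :
    (fun x : ℝ => powSum α ((1 - x ^ 2 : ℝ) : ℂ)) =O[𝓝[<] 1] fun _ => (1 : ℂ) := by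
  have hz : Tendsto (fun x : ℝ => ((1 - x ^ 2 : ℝ) : ℂ)) (𝓝[<] 1) (𝓝 0) := by
    have := (Complex.continuous_ofReal.tendsto 0).comp
      (tendsto_one_sub_sq.mono_right nhdsWithin_le_nhds)
    rwa [Complex.ofReal_zero] at this
  exact (((continuousAt_powSum hα (z := 0) (by simp)).tendsto.comp hz).isBigO_one ℂ)

section
variable {ν : ℂ}

theorem legendreFn_sub_one_isBigO (hν : ∀ n : ℤ, ν ≠ n) :
    (fun x => legendreFn ν x - 1) =O[𝓝[<] 1] fun x : ℝ => 1 - (x : ℂ) ^ 2 := by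
  obtain ⟨C, hC0, hC⟩ := norm_legendreFn_sub_one_le hν
  refine IsBigO.of_bound C ?_
  filter_upwards [Ioo_mem_nhdsLT (show (0 : ℝ) < 1 by norm_num)] with x hx
  have h0 : 0 < 1 - x ^ 2 := by nlinarith [hx.1, hx.2]
  rw [show (1 : ℂ) - (x : ℂ) ^ 2 = ((1 - x ^ 2 : ℝ) : ℂ) by push_cast; rfl, Complex.norm_real,
    Real.norm_of_nonneg h0.le]
  refine (hC x ⟨hx.1.le, hx.2⟩).trans ?_
  gcongr
  nlinarith [hx.1, hx.2]

theorem legendreFn_neg_sub_log_isBigO (hν : ∀ n : ℤ, ν ≠ n) :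
    (fun x => legendreFn ν (-x) - sinDivPi ν * logOneSubSq x) =O[𝓝[<] 1] fun _ => (1 : ℂ) := by
  obtain ⟨C, hC0, hC⟩ := norm_legendreFn_sub_log_le hν
  refine IsBigO.of_bound (C + ‖sinDivPi ν‖ * 3) ?_
  filter_upwards [Ioo_mem_nhdsLT (show (0 : ℝ) < 1 by norm_num)] with x hx
  have h1 := hC (-x) ⟨by linarith [hx.2], by linarith [hx.1]⟩
  have hlog : Real.log (1 - x ^ 2) = Real.log ((1 + -x) / 2) + Real.log (2 * (1 + x)) := by
    rw [← Real.log_mul (by linarith [hx.2]) (by linarith [hx.1])]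
    congr 1
    ring
  have hb : |Real.log (2 * (1 + x))| ≤ 3 := by
    rw [abs_of_nonneg (Real.log_nonneg (by linarith [hx.1]))]
    have := Real.log_le_sub_one_of_pos (show 0 < 2 * (1 + x) by linarith [hx.1])
    linarith [hx.2]
  rw [logOneSubSq, hlog, norm_one, mul_one]
  push_cast
  have e : legendreFn ν (-x) - sinDivPi ν * ((Real.log ((1 + -x) / 2) : ℂ) +
      (Real.log (2 * (1 + x)) : ℂ)) =
      (legendreFn ν (-x) - sinDivPi ν * (Real.log ((1 + -x) / 2) : ℂ)) -
        sinDivPi ν * (Real.log (2 * (1 + x)) : ℂ) := by ring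
  rw [e]
  refine (norm_sub_le _ _).trans (add_le_add h1 ?_)
  rw [norm_mul, Complex.norm_real, Real.norm_eq_abs]
  gcongr

theorem legendreFn_neg_isBigO_log (hν : ∀ n : ℤ, ν ≠ n) :
    (fun x => legendreFn ν (-x)) =O[𝓝[<] 1] logOneSubSq := by
  have h := ((legendreFn_neg_sub_log_isBigO hν).trans one_isBigO_logOneSubSq).add
    ((isBigO_refl logOneSubSq _).const_mul_left (sinDivPi ν))
  refine h.congr_left fun x => ?_
  ring

theorem tendsto_legendreFn_neg_div_log (hν : ∀ n : ℤ, ν ≠ n) :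
    Tendsto (fun x => legendreFn ν (-x) * (logOneSubSq x)⁻¹) (𝓝[<] 1) (𝓝 (sinDivPi ν)) := by
  have h := ((legendreFn_neg_sub_log_isBigO hν).mul
    (isBigO_refl (fun x => (logOneSubSq x)⁻¹) (𝓝[<] 1)))
  have h2 : Tendsto (fun x => (1 : ℂ) * (logOneSubSq x)⁻¹) (𝓝[<] 1) (𝓝 0) := by
    simpa using tendsto_inv_logOneSubSq
  have h3 := (h.trans_tendsto h2).add_const (sinDivPi ν)
  rw [zero_add] at h3
  refine h3.congr' ?_
  filter_upwards [eventually_logOneSubSq_ne_zero] with x hx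
  field_simp
  ring

/-- A combination of the even quadratic forms that stays bounded at `1` vanishes. -/
theorem eq_zero_of_even_quadratic_isBigO (hν : ∀ n : ℤ, ν ≠ n) {α β : ℂ}
    (h : (fun x => α * (legendreFn ν x ^ 2 + legendreFn ν (-x) ^ 2) +
      β * (legendreFn ν x * legendreFn ν (-x))) =O[𝓝[<] 1] fun _ => (1 : ℂ)) :
    α = 0 ∧ β = 0 := by
  have hP := tendsto_legendreFn_one hν
  have hQ := tendsto_legendreFn_neg_div_log hν
  have hL := tendsto_inv_logOneSubSq
  have hS := sinDivPi_ne_zero hν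
  have hα : α = 0 := by
    -- P_ν(-x) grows like S_ν log(1-x²). Dividing by the squared logarithm isolates α S_ν²; once α =
    -- 0, dividing by one logarithm isolates β S_ν.
    have t1 := ((hP.pow 2).mul (hL.pow 2)).add (hQ.pow 2)
    have t2 := (hP.mul hQ).mul hL
    have t := (t1.const_mul α).add (t2.const_mul β)
    have z := (h.mul (isBigO_refl (fun x => (logOneSubSq x)⁻¹ ^ 2) (𝓝[<] 1))).trans_tendsto
      (by simpa using hL.pow 2)
    have := tendsto_nhds_unique z (t.congr fun x => by ring)
    simpa [hS] using this
  refine ⟨hα, ?_⟩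
  have t := (hP.mul hQ).const_mul β
  have z := (h.mul (isBigO_refl (fun x => (logOneSubSq x)⁻¹) (𝓝[<] 1))).trans_tendsto
    (by simpa using hL)
  have := tendsto_nhds_unique z (t.congr fun x => by rw [hα]; ring)
  simpa [hS] using this

theorem logSum_logCoeffOne (x : ℝ) : logSum (logCoeffOne ν) (1 - x ^ 2) =
    powSum (fun k => deriv (symSqQuot ν) k) ((1 - x ^ 2 : ℝ) : ℂ) +
      logOneSubSq x * powSum (fun k => symSqQuot ν k) ((1 - x ^ 2 : ℝ) : ℂ) := by
  have h1 : powSum (fun k => symSqQuot ν k / 2) ((1 - x ^ 2 : ℝ) : ℂ) =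
      1 / 2 * powSum (fun k => symSqQuot ν k) ((1 - x ^ 2 : ℝ) : ℂ) := by
    rw [← powSum_const_mul]
    congr 1
    funext k
    ring
  have h2 : powSum (fun _ => 0) ((1 - x ^ 2 : ℝ) : ℂ) = 0 := by simp [powSum]
  simp only [logSum, logCoeffOne, Matrix.cons_val]
  rw [h1, h2, logOneSubSq]
  ring

theorem logSum_logCoeffTwo (x : ℝ) : logSum (logCoeffTwo ν) (1 - x ^ 2) =
    powSum (fun k => deriv (deriv (symSqQuot ν)) k) ((1 - x ^ 2 : ℝ) : ℂ) +
      2 * logOneSubSq x * powSum (fun k => deriv (symSqQuot ν) k) ((1 - x ^ 2 : ℝ) : ℂ) +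
      logOneSubSq x ^ 2 * powSum (fun k => symSqQuot ν k) ((1 - x ^ 2 : ℝ) : ℂ) := rfl

theorem exists_even_quadratic_logCoeff (hν : ∀ n : ℤ, ν ≠ n) {A : Fin 3 → ℕ → ℂ}
    (hrec : SymSqRec (ν * (ν + 1)) A) (hA : ∀ j, PolyBounded (A j))
    (h0 : Tendsto (fun x : ℝ => -2 * (x : ℂ) * logSum (logTheta A) (1 - x ^ 2))
      (𝓝[>] 0) (𝓝 0)) :
    ∃ α β : ℂ, ∀ x ∈ Set.Ioo (0 : ℝ) 1, logSum A (1 - x ^ 2) =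
      α * (legendreFn ν x ^ 2 + legendreFn ν (-x) ^ 2) +
        β * (legendreFn ν x * legendreFn ν (-x)) :=
  (hrec.symSqSystem hA).exists_even_quadratic (legendreSystem hν) (legendre_wronskian hν)
    (by simpa using sinDivPi_ne_zero hν) h0

/-- Near 1 the one-logarithm solution is a(0)·log(1-x²) + O(1) and the product is S_ν·log(1-x²) +
O(1). The combination cancelling the logarithms is a bounded even quadratic form, hence zero. -/
theorem legendreFn_mul_neg_eq (hν : ∀ n : ℤ, ν ≠ n) : ∀ x ∈ Set.Ioo (0 : ℝ) 1,
    legendreFn ν x * legendreFn ν (-x) =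
      sinDivPi ν / symSqQuot ν 0 * logSum (logCoeffOne ν) (1 - x ^ 2) := by
  have ha := symSqQuot_zero_ne_zero hν
  have hS := sinDivPi_ne_zero hν
  have hmem : Set.Ioo (0 : ℝ) 1 ∈ 𝓝[<] (1 : ℝ) := Ioo_mem_nhdsLT (by norm_num)
  obtain ⟨α, β, hq⟩ := exists_even_quadratic_logCoeff hν (symSqRec_logCoeff hν).1
    (polyBounded_logCoeff hν).1 (tendsto_logCoeff_zero hν).1
  have b0 : PolyBounded fun k => symSqQuot ν k := (polyBounded_logCoeff hν).2 0
  have b1 : PolyBounded fun k => deriv (symSqQuot ν) k := (polyBounded_logCoeff hν).2 1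
  have o1 : (fun x => logSum (logCoeffOne ν) (1 - x ^ 2) - symSqQuot ν 0 * logOneSubSq x)
      =O[𝓝[<] 1] fun _ => (1 : ℂ) := by
    have h1 := ((isBigO_refl logOneSubSq (𝓝[<] 1)).mul (powSum_sub_isBigO b0)).trans
      logOneSubSq_mul_isBigO
    refine ((powSum_isBigO_one b1).add h1).congr_left fun x => ?_
    rw [logSum_logCoeffOne, Nat.cast_zero]
    ring
  have o2 : (fun x => legendreFn ν x * legendreFn ν (-x) - sinDivPi ν * logOneSubSq x)
      =O[𝓝[<] 1] fun _ => (1 : ℂ) := by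
    have h1 := (((legendreFn_neg_isBigO_log hν).mul (legendreFn_sub_one_isBigO hν))).trans
      logOneSubSq_mul_isBigO
    refine ((legendreFn_neg_sub_log_isBigO hν).add h1).congr_left fun x => ?_
    ring
  have o3 := o1.sub (o2.const_mul_left (symSqQuot ν 0 / sinDivPi ν))
  have o4 : (fun x => α * (legendreFn ν x ^ 2 + legendreFn ν (-x) ^ 2) +
      (β - symSqQuot ν 0 / sinDivPi ν) * (legendreFn ν x * legendreFn ν (-x)))
      =O[𝓝[<] 1] fun _ => (1 : ℂ) := by
    refine o3.congr' ?_ EventuallyEq.rfl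
    filter_upwards [hmem] with x hx
    rw [hq x hx]
    field_simp
    ring
  obtain ⟨h1, h2⟩ := eq_zero_of_even_quadratic_isBigO hν o4
  intro x hx
  rw [hq x hx, h1, sub_eq_zero.1 h2]
  field_simp
  ring

/-- Both sides are compared with squares, so no subleading constants are needed. Up to O(1), P_ν(x)²
+ P_ν(-x)² equals (P_ν(x)P_ν(-x))², and a(0) times the two-logarithm solution equals the square of
the one-logarithm solution. The product formula links the squares. -/
theorem legendreFn_sq_add_sq_eq (hν : ∀ n : ℤ, ν ≠ n) : ∀ x ∈ Set.Ioo (0 : ℝ) 1,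
    legendreFn ν x ^ 2 + legendreFn ν (-x) ^ 2 =
      sinDivPi ν ^ 2 / symSqQuot ν 0 * logSum (logCoeffTwo ν) (1 - x ^ 2) := by
  have ha := symSqQuot_zero_ne_zero hν
  have hS := sinDivPi_ne_zero hν
  have hmem : Set.Ioo (0 : ℝ) 1 ∈ 𝓝[<] (1 : ℝ) := Ioo_mem_nhdsLT (by norm_num)
  obtain ⟨α, β, hq⟩ := exists_even_quadratic_logCoeff hν (symSqRec_logCoeff hν).2
    (polyBounded_logCoeff hν).2 (tendsto_logCoeff_zero hν).2
  have b0 : PolyBounded fun k => symSqQuot ν k := (polyBounded_logCoeff hν).2 0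
  have b1 : PolyBounded fun k => deriv (symSqQuot ν) k := (polyBounded_logCoeff hν).2 1
  have b2 : PolyBounded fun k => deriv (deriv (symSqQuot ν)) k := (polyBounded_logCoeff hν).2 2
  have hP : (fun x => legendreFn ν x) =O[𝓝[<] 1] fun _ => (1 : ℂ) :=
    (tendsto_legendreFn_one hν).isBigO_one ℂ
  have o1 : (fun x => legendreFn ν x ^ 2) =O[𝓝[<] 1] fun _ => (1 : ℂ) := by
    simpa using hP.pow 2
  have o2 : (fun x => (legendreFn ν x ^ 2 - 1) * legendreFn ν (-x) ^ 2)
      =O[𝓝[<] 1] fun _ => (1 : ℂ) := by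
    have h1 := (hP.add (isBigO_refl (fun _ => (1 : ℂ)) _)).mul
      (((legendreFn_neg_isBigO_log hν).pow 2).mul (legendreFn_sub_one_isBigO hν) |>.trans
        logOneSubSq_sq_mul_isBigO)
    simp only [mul_one] at h1
    refine h1.congr_left fun x => ?_
    ring
  have A0 := powSum_isBigO_one b0
  have A1 := powSum_isBigO_one b1
  have A2 := powSum_isBigO_one b2
  have A0' := powSum_sub_isBigO b0
  rw [Nat.cast_zero] at A0'
  -- Both log² and log terms cancel up to the factor A₀ - a(0) = O(1-x²), where A₀ = ∑ a(k)z^k, and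
  -- this factor absorbs the squared logarithm.
  have o3 : (fun x => logSum (logCoeffOne ν) (1 - x ^ 2) ^ 2 -
      symSqQuot ν 0 * logSum (logCoeffTwo ν) (1 - x ^ 2)) =O[𝓝[<] 1] fun _ => (1 : ℂ) := by
    have h1 := A1.pow 2
    have h2 := A2.const_mul_left (symSqQuot ν 0)
    have h3 := ((A1.const_mul_left 2).mul (((isBigO_refl logOneSubSq (𝓝[<] 1)).mul A0').trans
      logOneSubSq_mul_isBigO))
    have h4 := (A0.mul ((((isBigO_refl logOneSubSq (𝓝[<] 1)).pow 2).mul A0').trans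
      logOneSubSq_sq_mul_isBigO))
    simp only [mul_one, one_pow] at h1 h3 h4
    refine (((h1.sub h2).add h3).add h4).congr_left fun x => ?_
    rw [logSum_logCoeffOne, logSum_logCoeffTwo]
    ring
  have o4 := (o1.sub o2).add (o3.const_mul_left (sinDivPi ν ^ 2 / symSqQuot ν 0 ^ 2))
  have o5 : (fun x => (1 - sinDivPi ν ^ 2 / symSqQuot ν 0 * α) *
      (legendreFn ν x ^ 2 + legendreFn ν (-x) ^ 2) +
      (-(sinDivPi ν ^ 2 / symSqQuot ν 0 * β)) * (legendreFn ν x * legendreFn ν (-x)))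
      =O[𝓝[<] 1] fun _ => (1 : ℂ) := by
    refine o4.congr' ?_ EventuallyEq.rfl
    filter_upwards [hmem] with x hx
    have h1 := legendreFn_mul_neg_eq hν x hx
    have h2 : logSum (logCoeffOne ν) (1 - x ^ 2) =
        symSqQuot ν 0 / sinDivPi ν * (legendreFn ν x * legendreFn ν (-x)) := by
      rw [h1]
      field_simp
    rw [h2, hq x hx]
    field_simp
    ring
  obtain ⟨h1, h2⟩ := eq_zero_of_even_quadratic_isBigO hν o5
  intro x hx
  rw [hq x hx]
  linear_combination (legendreFn ν x ^ 2 + legendreFn ν (-x) ^ 2) * h1 +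
    (legendreFn ν x * legendreFn ν (-x)) * h2
end
-- Moments of the Legendre function against powers of 1 - x².
open MeasureTheory

/-- Lebesgue measure on `(-1, 1)`. -/
noncomputable abbrev cutMeasure : Measure ℝ := volume.restrict (Set.Ioo (-1) 1)

theorem one_sub_sq_pos {x : ℝ} (hx : x ∈ Set.Ioo (-1 : ℝ) 1) : 0 < 1 - x ^ 2 := by
  nlinarith [hx.1, hx.2]

theorem integrable_one_sub_sq_rpow :
    Integrable (fun x : ℝ => (1 - x ^ 2) ^ (-(1 / 2) : ℝ)) cutMeasure := by
  have h := Polynomial.Chebyshev.intervalIntegrable_sqrt_one_sub_sq_inv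
  rw [intervalIntegrable_iff_integrableOn_Ioo_of_le (by norm_num)] at h
  refine h.congr ?_
  filter_upwards [ae_restrict_mem measurableSet_Ioo] with x hx
  rw [Real.rpow_neg (one_sub_sq_pos hx).le, ← Real.sqrt_eq_rpow, Real.sqrt_inv]

theorem integrable_cutMeasure_of_le {f : ℝ → ℂ} {C : ℝ} (hf : ContinuousOn f (Set.Ioo (-1) 1))
    (hC : ∀ x ∈ Set.Ioo (-1 : ℝ) 1, ‖f x‖ ≤ C * (1 - x ^ 2) ^ (-(1 / 2) : ℝ)) :
    Integrable f cutMeasure := by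
  refine (integrable_one_sub_sq_rpow.const_mul C).mono'
    (hf.aestronglyMeasurable measurableSet_Ioo) ?_
  filter_upwards [ae_restrict_mem measurableSet_Ioo] with x hx
  exact hC x hx

theorem intervalIntegrable_iff_cutMeasure {f : ℝ → ℂ} :
    IntervalIntegrable f volume (-1) 1 ↔ Integrable f cutMeasure :=
  intervalIntegrable_iff_integrableOn_Ioo_of_le (by norm_num)

theorem intervalIntegral_eq_cutMeasure (f : ℝ → ℂ) :
    ∫ x in (-1 : ℝ)..1, f x = ∫ x, f x ∂cutMeasure := by
  rw [intervalIntegral.integral_of_le (by norm_num), integral_Ioc_eq_integral_Ioo]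

theorem continuousAt_logOneSubSq {x : ℝ} (hx : x ∈ Set.Ioo (-1 : ℝ) 1) :
    ContinuousAt logOneSubSq x := by
  have : ContinuousAt (fun x : ℝ => 1 - x ^ 2) x := by fun_prop
  exact Complex.continuous_ofReal.continuousAt.comp (this.log (one_sub_sq_pos hx).ne')

theorem continuousOn_logOneSubSq : ContinuousOn logOneSubSq (Set.Ioo (-1) 1) :=
  fun _ hx => (continuousAt_logOneSubSq hx).continuousWithinAt

theorem hasDerivAt_logOneSubSq {x : ℝ} (hx : x ∈ Set.Ioo (-1 : ℝ) 1) :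
    HasDerivAt logOneSubSq (-2 * x / (1 - (x : ℂ) ^ 2)) x := by
  have hp : HasDerivAt (fun x : ℝ => 1 - x ^ 2) (-(2 * x)) x := by
    simpa using (hasDerivAt_pow 2 x).const_sub 1
  refine ((hp.log (one_sub_sq_pos hx).ne').ofReal_comp).congr_deriv ?_
  push_cast
  ring

theorem exp_logOneSubSq {x : ℝ} (hx : x ∈ Set.Ioo (-1 : ℝ) 1) :
    Complex.exp (logOneSubSq x) = 1 - (x : ℂ) ^ 2 := by
  rw [logOneSubSq, ← Complex.ofReal_exp, Real.exp_log (one_sub_sq_pos hx)]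
  push_cast
  rfl

theorem exp_natCast_mul_logOneSubSq {x : ℝ} (hx : x ∈ Set.Ioo (-1 : ℝ) 1) (k : ℕ) :
    Complex.exp (k * logOneSubSq x) = ((1 - x ^ 2 : ℝ) : ℂ) ^ k := by
  rw [Complex.exp_nat_mul, exp_logOneSubSq hx]
  push_cast
  rfl

theorem norm_exp_mul_logOneSubSq {x : ℝ} (hx : x ∈ Set.Ioo (-1 : ℝ) 1) (s : ℂ) :
    ‖Complex.exp (s * logOneSubSq x)‖ = (1 - x ^ 2) ^ s.re := by
  rw [Complex.norm_exp, logOneSubSq, Complex.re_mul_ofReal,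
    Real.rpow_def_of_pos (one_sub_sq_pos hx), mul_comm]

/-- The logarithm is bounded with exponent 1/16, so that its square still costs only 1/8. -/
theorem norm_logOneSubSq_pow_le {x : ℝ} (hx : x ∈ Set.Ioo (-1 : ℝ) 1) {j : ℕ} (hj : j ≤ 2) :
    ‖logOneSubSq x ^ j‖ ≤ 16 ^ 2 * (1 - x ^ 2) ^ (-(1 / 8) : ℝ) := by
  have h0 := one_sub_sq_pos hx
  have h1 : 1 - x ^ 2 ≤ 1 := by nlinarith
  have hl := Real.log_le_rpow_div (x := (1 - x ^ 2)⁻¹) (ε := 1 / 16) (by positivity) (by norm_num)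
  rw [Real.log_inv, Real.inv_rpow h0.le, ← Real.rpow_neg h0.le] at hl
  have hn : ‖logOneSubSq x‖ ≤ 16 * (1 - x ^ 2) ^ (-(1 / 16) : ℝ) := by
    rw [logOneSubSq, Complex.norm_real, Real.norm_eq_abs, abs_of_nonpos (Real.log_nonpos h0.le h1)]
    linarith
  have hw : 1 ≤ 16 * (1 - x ^ 2) ^ (-(1 / 16) : ℝ) := by
    have := Real.one_le_rpow_of_pos_of_le_one_of_nonpos h0 h1
      (show (-(1 / 16) : ℝ) ≤ 0 by norm_num)
    linarith
  rw [norm_pow]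
  calc ‖logOneSubSq x‖ ^ j ≤ (16 * (1 - x ^ 2) ^ (-(1 / 16) : ℝ)) ^ j := by gcongr
    _ ≤ (16 * (1 - x ^ 2) ^ (-(1 / 16) : ℝ)) ^ 2 := pow_le_pow_right₀ hw hj
    _ = _ := by
      rw [mul_pow, ← Real.rpow_natCast, ← Real.rpow_natCast, ← Real.rpow_mul h0.le]
      norm_num

/-- The integrand of the logarithmic moments of the Legendre function. -/
noncomputable def momentIntegrand (μ : ℂ) (j : ℕ) (s : ℂ) (x : ℝ) : ℂ :=
  legendreFn μ x * (logOneSubSq x ^ j * Complex.exp (s * logOneSubSq x))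

/-- The moments `∫ P_μ(x) (1 - x ^ 2) ^ s (log (1 - x ^ 2)) ^ j` over `(-1, 1)`. -/
noncomputable def logMoment (μ : ℂ) (j : ℕ) (s : ℂ) : ℂ := ∫ x, momentIntegrand μ j s x ∂cutMeasure

section
variable {μ : ℂ}

theorem continuousOn_momentIntegrand (hμ : ∀ n : ℤ, μ ≠ n) (j : ℕ) (s : ℂ) :
    ContinuousOn (momentIntegrand μ j s) (Set.Ioo (-1) 1) :=
  (continuousOn_legendreFn hμ).mul ((continuousOn_logOneSubSq.pow j).mul
    (Complex.continuous_exp.comp_continuousOn (continuousOn_const.mul continuousOn_logOneSubSq)))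

/-- The exponents add up exactly: 1/8 for P_μ, 1/8 for the logarithms, 1/4 for the weight. -/
theorem momentIntegrand_le (hμ : ∀ n : ℤ, μ ≠ n) : ∃ C : ℝ, 0 ≤ C ∧
    ∀ x ∈ Set.Ioo (-1 : ℝ) 1, ∀ j ≤ 2, ∀ s : ℂ, -(1 / 4) ≤ s.re →
      ‖momentIntegrand μ j s x‖ ≤ C * (1 - x ^ 2) ^ (-(1 / 2) : ℝ) := by
  obtain ⟨C, hC0, hC⟩ := norm_legendreFn_le_rpow hμ
  refine ⟨C * 16 ^ 2, by positivity, fun x hx j hj s hs => ?_⟩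
  have h0 := one_sub_sq_pos hx
  have h1 : 1 - x ^ 2 ≤ 1 := by nlinarith
  rw [momentIntegrand, norm_mul, norm_mul, norm_exp_mul_logOneSubSq hx]
  have h2 : (1 - x ^ 2) ^ s.re ≤ (1 - x ^ 2) ^ (-(1 / 4) : ℝ) :=
    Real.rpow_le_rpow_of_exponent_ge h0 h1 hs
  calc _ ≤ (C * (1 - x ^ 2) ^ (-(1 / 8) : ℝ)) * ((16 ^ 2 * (1 - x ^ 2) ^ (-(1 / 8) : ℝ)) *
        (1 - x ^ 2) ^ (-(1 / 4) : ℝ)) := by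
        gcongr
        · exact hC x hx
        · exact norm_logOneSubSq_pow_le hx hj
    _ = C * 16 ^ 2 * ((1 - x ^ 2) ^ (-(1 / 8) : ℝ) * (1 - x ^ 2) ^ (-(1 / 8) : ℝ) *
        (1 - x ^ 2) ^ (-(1 / 4) : ℝ)) := by ring
    _ = _ := by
      rw [← Real.rpow_add h0, ← Real.rpow_add h0]
      norm_num

theorem integrable_momentIntegrand (hμ : ∀ n : ℤ, μ ≠ n) {j : ℕ} (hj : j ≤ 2) {s : ℂ}
    (hs : -(1 / 4) ≤ s.re) : Integrable (momentIntegrand μ j s) cutMeasure := by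
  obtain ⟨C, -, hC⟩ := momentIntegrand_le hμ
  exact integrable_cutMeasure_of_le (continuousOn_momentIntegrand hμ j s)
    fun x hx => hC x hx j hj s hs

/-- Differentiation in s brings down one logarithm. The disc of radius 1/8 around s stays in Re ≥
-1/4, where the uniform majorant is available. -/
theorem hasDerivAt_logMoment (hμ : ∀ n : ℤ, μ ≠ n) {j : ℕ} (hj : j ≤ 1) {s : ℂ}
    (hs : -(1 / 8) < s.re) : HasDerivAt (logMoment μ j) (logMoment μ (j + 1) s) s := by
  obtain ⟨C, -, hC⟩ := momentIntegrand_le hμ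
  have hball : ∀ w ∈ Metric.ball s (1 / 8), -(1 / 4) ≤ w.re := by
    intro w hw
    have h1 := (Complex.abs_re_le_norm (w - s)).trans_lt (by simpa [dist_eq_norm] using hw)
    rw [Complex.sub_re, abs_lt] at h1
    norm_num at h1
    linarith [h1.1]
  refine (hasDerivAt_integral_of_dominated_loc_of_deriv_le (F := momentIntegrand μ j)
    (F' := momentIntegrand μ (j + 1)) (bound := fun x => C * (1 - x ^ 2) ^ (-(1 / 2) : ℝ))
    (Metric.ball_mem_nhds s (by norm_num : (0 : ℝ) < 1 / 8)) ?_ ?_ ?_ ?_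
    (integrable_one_sub_sq_rpow.const_mul C) ?_).2
  · exact Eventually.of_forall fun w =>
      (continuousOn_momentIntegrand hμ j w).aestronglyMeasurable measurableSet_Ioo
  · exact integrable_momentIntegrand hμ (by omega) (by linarith)
  · exact (continuousOn_momentIntegrand hμ (j + 1) s).aestronglyMeasurable measurableSet_Ioo
  · filter_upwards [ae_restrict_mem measurableSet_Ioo] with x hx w hw
    exact hC x hx (j + 1) (by omega) w (hball w hw)
  · refine Eventually.of_forall fun x w _ => ?_
    have h1 : HasDerivAt (fun w : ℂ => Complex.exp (w * logOneSubSq x))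
        (Complex.exp (w * logOneSubSq x) * (1 * logOneSubSq x)) w :=
      ((hasDerivAt_id w).mul_const _).cexp
    refine ((h1.const_mul (logOneSubSq x ^ j)).const_mul (legendreFn μ x)).congr_deriv ?_
    rw [momentIntegrand]
    ring

theorem integral_eq_of_hasDerivAt {f f' : ℝ → ℂ} {fa fb : ℂ}
    (hd : ∀ x ∈ Set.Ioo (-1 : ℝ) 1, HasDerivAt f (f' x) x) (hi : Integrable f' cutMeasure)
    (ha : Tendsto f (𝓝[>] (-1)) (𝓝 fa)) (hb : Tendsto f (𝓝[<] 1) (𝓝 fb)) :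
    ∫ x, f' x ∂cutMeasure = fb - fa := by
  rw [← intervalIntegral_eq_cutMeasure]
  exact intervalIntegral.integral_eq_sub_of_hasDerivAt_of_tendsto (by norm_num) hd
    (intervalIntegrable_iff_cutMeasure.2 hi) ha hb

theorem tendsto_zero_of_le_one_sub_sq_rpow {f : ℝ → ℂ} {C r : ℝ} (hr : 0 < r)
    (h : ∀ x ∈ Set.Ioo (-1 : ℝ) 1, ‖f x‖ ≤ C * (1 - x ^ 2) ^ r) :
    Tendsto f (𝓝[>] (-1)) (𝓝 0) ∧ Tendsto f (𝓝[<] 1) (𝓝 0) := by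
  have hc (a : ℝ) (ha : 1 - a ^ 2 = 0) :
      Tendsto (fun x : ℝ => C * (1 - x ^ 2) ^ r) (𝓝 a) (𝓝 0) := by
    have : ContinuousAt (fun x : ℝ => C * (1 - x ^ 2) ^ r) a := by
      refine continuousAt_const.mul (ContinuousAt.rpow_const ?_ (Or.inr hr.le))
      fun_prop
    have h := this.tendsto
    rwa [ha, Real.zero_rpow hr.ne', mul_zero] at h
  constructor
  · refine squeeze_zero_norm' ?_ ((hc (-1) (by norm_num)).mono_left nhdsWithin_le_nhds)
    filter_upwards [Ioo_mem_nhdsGT (show (-1 : ℝ) < 1 by norm_num)] with x hx using h x hx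
  · refine squeeze_zero_norm' ?_ ((hc 1 (by norm_num)).mono_left nhdsWithin_le_nhds)
    filter_upwards [Ioo_mem_nhdsLT (show (-1 : ℝ) < 1 by norm_num)] with x hx using h x hx

/-- Integrating ((1-x²)P_μ')' = -μ(μ+1)P_μ leaves only the boundary value 2S_μ at -1. -/
theorem logMoment_zero_mul (hμ : ∀ n : ℤ, μ ≠ n) :
    μ * (μ + 1) * logMoment μ 0 0 = 2 * sinDivPi μ := by
  have hY1 : Tendsto (legendreDeriv μ) (𝓝[<] 1) (𝓝 0) := by
    obtain ⟨C, hC0, hC⟩ := norm_legendreDeriv_le hμ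
    have hlim : Tendsto (fun x : ℝ => C * (1 - x)) (𝓝 1) (𝓝 (C * (1 - 1))) :=
      Continuous.tendsto (by fun_prop) 1
    rw [sub_self, mul_zero] at hlim
    refine squeeze_zero_norm' ?_ (hlim.mono_left nhdsWithin_le_nhds)
    filter_upwards [Ioo_mem_nhdsLT (show (-1 : ℝ) < 1 by norm_num)] with x hx using hC x hx
  have hI : Integrable (fun x => -(μ * (μ + 1)) * momentIntegrand μ 0 0 x) cutMeasure :=
    (integrable_momentIntegrand hμ (by norm_num) (by norm_num)).const_mul _
  have h := integral_eq_of_hasDerivAt (fun x hx => ((legendreSystem hμ).dY x hx).congr_deriv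
    (by simp [momentIntegrand])) hI (tendsto_legendreDeriv_neg_one hμ) hY1
  rw [integral_const_mul, ← logMoment] at h
  linear_combination -h

theorem logMoment_rec (hμ : ∀ n : ℤ, μ ≠ n) {s : ℂ} (hs : -(1 / 4) ≤ s.re) :
    4 * (s + 1) ^ 2 * logMoment μ 0 s =
      (4 * (s + 1) ^ 2 + 2 * (s + 1) - μ * (μ + 1)) * logMoment μ 0 (s + 1) := by
  have hs1 : -(1 / 4) ≤ (s + 1).re := by
    rw [Complex.add_re, Complex.one_re]
    linarith
  -- The antiderivative (1-x²)^(s+1)·(1-x²)P_μ' + 2(s+1)x(1-x²)^(s+1)P_μ encodes two integrations by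
  -- parts. It vanishes at both endpoints since Re(s+1) ≥ 3/4.
  let f : ℝ → ℂ := fun x => legendreDeriv μ x * Complex.exp ((s + 1) * logOneSubSq x) +
    2 * (s + 1) * (x * (legendreFn μ x * Complex.exp ((s + 1) * logOneSubSq x)))
  have hd : ∀ x ∈ Set.Ioo (-1 : ℝ) 1, HasDerivAt f
      ((4 * (s + 1) ^ 2 + 2 * (s + 1) - μ * (μ + 1)) * momentIntegrand μ 0 (s + 1) x -
        4 * (s + 1) ^ 2 * momentIntegrand μ 0 s x) x := by
    intro x hx
    have hL := legendreSystem hμ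
    have he : HasDerivAt (fun x => Complex.exp ((s + 1) * logOneSubSq x))
        (Complex.exp ((s + 1) * logOneSubSq x) * ((s + 1) * (-2 * x / (1 - (x : ℂ) ^ 2)))) x :=
      ((hasDerivAt_logOneSubSq hx).const_mul (s + 1)).cexp
    have hx1 : HasDerivAt (fun x : ℝ => (x : ℂ)) 1 x := Complex.ofRealCLM.hasDerivAt
    refine (((hL.dY x hx).mul he).add
      ((hx1.mul ((hL.dy x hx).mul he)).const_mul (2 * (s + 1)))).congr_deriv ?_
    have hne := one_sub_sq_ne_zero hx
    have hexp : Complex.exp ((s + 1) * logOneSubSq x) =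
        Complex.exp (s * logOneSubSq x) * (1 - (x : ℂ) ^ 2) := by
      rw [add_mul, one_mul, Complex.exp_add, exp_logOneSubSq hx]
    simp only [momentIntegrand, pow_zero, one_mul, Pi.mul_apply]
    rw [hexp]
    field_simp
    ring
  have hI1 := (integrable_momentIntegrand hμ (j := 0) (by norm_num) hs1).const_mul
    (4 * (s + 1) ^ 2 + 2 * (s + 1) - μ * (μ + 1))
  have hI2 := (integrable_momentIntegrand hμ (j := 0) (by norm_num) hs).const_mul
    (4 * (s + 1) ^ 2)
  have hb : ∃ C : ℝ, ∀ x ∈ Set.Ioo (-1 : ℝ) 1, ‖f x‖ ≤ C * (1 - x ^ 2) ^ (1 / 4 : ℝ) := by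
    obtain ⟨C, hC0, hC⟩ := norm_legendreFn_le_rpow hμ
    obtain ⟨D, hD0, hD⟩ := norm_legendreDeriv_le hμ
    refine ⟨D * 2 + ‖2 * (s + 1)‖ * (1 * C), fun x hx => ?_⟩
    have h0 := one_sub_sq_pos hx
    have h1 : 1 - x ^ 2 ≤ 1 := by nlinarith
    have hx1 : ‖(x : ℂ)‖ ≤ 1 := by
      rw [Complex.norm_real, Real.norm_eq_abs, abs_le]
      exact ⟨hx.1.le, hx.2.le⟩
    have he : ‖Complex.exp ((s + 1) * logOneSubSq x)‖ ≤ (1 - x ^ 2) ^ (3 / 4 : ℝ) := by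
      rw [norm_exp_mul_logOneSubSq hx]
      refine Real.rpow_le_rpow_of_exponent_ge h0 h1 ?_
      rw [Complex.add_re, Complex.one_re]
      linarith
    have he2 : (1 - x ^ 2) ^ (3 / 4 : ℝ) ≤ (1 - x ^ 2) ^ (1 / 4 : ℝ) :=
      Real.rpow_le_rpow_of_exponent_ge h0 h1 (by norm_num)
    have he3 : (1 - x ^ 2) ^ (-(1 / 8) : ℝ) * (1 - x ^ 2) ^ (3 / 4 : ℝ) ≤
        (1 - x ^ 2) ^ (1 / 4 : ℝ) := by
      rw [← Real.rpow_add h0]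
      exact Real.rpow_le_rpow_of_exponent_ge h0 h1 (by norm_num)
    have hY : ‖legendreDeriv μ x‖ ≤ D * 2 :=
      (hD x hx).trans (mul_le_mul_of_nonneg_left (by linarith [hx.1]) hD0)
    rw [add_mul]
    refine (norm_add_le _ _).trans (add_le_add ?_ ?_)
    · rw [norm_mul]
      gcongr
      exact he.trans he2
    · have hX : ‖legendreFn μ x‖ * ‖Complex.exp ((s + 1) * logOneSubSq x)‖ ≤
          C * (1 - x ^ 2) ^ (1 / 4 : ℝ) := by
        calc _ ≤ (C * (1 - x ^ 2) ^ (-(1 / 8) : ℝ)) * (1 - x ^ 2) ^ (3 / 4 : ℝ) := by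
              gcongr
              exact hC x hx
          _ ≤ _ := by
            rw [mul_assoc]
            gcongr
      rw [norm_mul (2 * (s + 1)), norm_mul (x : ℂ), norm_mul (legendreFn μ x)]
      calc _ ≤ ‖2 * (s + 1)‖ * (1 * (C * (1 - x ^ 2) ^ (1 / 4 : ℝ))) := by gcongr
        _ = _ := by ring
  obtain ⟨C, hC⟩ := hb
  obtain ⟨t1, t2⟩ := tendsto_zero_of_le_one_sub_sq_rpow (by norm_num) hC
  have h := integral_eq_of_hasDerivAt hd (hI1.sub hI2) t1 t2
  rw [integral_sub hI1 hI2, integral_const_mul, integral_const_mul, ← logMoment, ← logMoment] at h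
  linear_combination -h

/-- With z = 1 - x², z^(n-1)(1-z) ≤ 1/n, and z^ε - 1 supplies the factor 1 - z through log z. The
exponent n+1 leaves powers of z to absorb 1/z from the logarithm and the two factors z^(-1/8). A
pointwise bound then suffices on the interval of length 2. -/
theorem norm_logMoment_sub_le (hμ : ∀ n : ℤ, μ ≠ n) : ∃ C : ℝ, 0 ≤ C ∧
    ∀ n : ℕ, 1 ≤ n → ∀ ε : ℂ, ‖ε‖ ≤ 1 / 8 →
      ‖logMoment μ 0 ((n + 1 : ℕ) + ε) - logMoment μ 0 (n + 1 : ℕ)‖ ≤ C / n := by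
  obtain ⟨C, hC0, hC⟩ := norm_legendreFn_le_rpow hμ
  refine ⟨C * 2, by positivity, fun n hn ε hε => ?_⟩
  have hn0 : (0 : ℝ) < n := by exact_mod_cast hn
  have hre := (abs_le.1 ((Complex.abs_re_le_norm ε).trans hε)).1
  have i1 := integrable_momentIntegrand hμ (j := 0) (by norm_num)
    (s := ((n + 1 : ℕ) : ℂ) + ε) (by
      rw [Complex.add_re, Complex.natCast_re]
      push_cast
      linarith)
  have i2 := integrable_momentIntegrand hμ (j := 0) (by norm_num) (s := ((n + 1 : ℕ) : ℂ)) (by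
      rw [Complex.natCast_re]
      push_cast
      linarith)
  rw [logMoment, logMoment, ← integral_sub i1 i2]
  have hbound : ∀ x ∈ Set.Ioo (-1 : ℝ) 1,
      ‖momentIntegrand μ 0 ((n + 1 : ℕ) + ε) x - momentIntegrand μ 0 (n + 1 : ℕ) x‖ ≤ C / n := by
    intro x hx
    have h0 := one_sub_sq_pos hx
    have h1 : 1 - x ^ 2 ≤ 1 := by nlinarith
    set z := 1 - x ^ 2 with hz
    have hL : ‖logOneSubSq x‖ = -Real.log z := by
      rw [logOneSubSq, Complex.norm_real, Real.norm_eq_abs,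
        abs_of_nonpos (Real.log_nonpos h0.le h1)]
    have hL1 : -Real.log z ≤ (1 - z) / z := by
      have := Real.one_sub_inv_le_log_of_pos h0
      rw [sub_div, div_self h0.ne', one_div]
      linarith
    have hL0 : 0 ≤ -Real.log z := by linarith [Real.log_nonpos h0.le h1]
    have e : momentIntegrand μ 0 ((n + 1 : ℕ) + ε) x - momentIntegrand μ 0 (n + 1 : ℕ) x =
        legendreFn μ x * ((((1 - x ^ 2 : ℝ) : ℂ) ^ (n + 1)) *
          (Complex.exp (ε * logOneSubSq x) - 1)) := by
      rw [momentIntegrand, momentIntegrand, add_mul, Complex.exp_add,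
        exp_natCast_mul_logOneSubSq hx]
      ring
    have hexp : ‖Complex.exp (ε * logOneSubSq x) - 1‖ ≤ (1 - z) / z * z ^ (-(1 / 8) : ℝ) := by
      have h2 := Complex.norm_exp_sub_sum_le_norm_mul_exp (ε * logOneSubSq x) 1
      rw [Finset.sum_range_one, pow_zero, pow_one, Nat.factorial_zero, Nat.cast_one, div_one,
        norm_mul, hL] at h2
      refine h2.trans ?_
      have h3 : ‖ε‖ * -Real.log z ≤ (1 / 8) * -Real.log z := by gcongr
      refine mul_le_mul (by linarith) ?_ (Real.exp_pos _).le (by linarith)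
      rw [Real.rpow_def_of_pos h0]
      exact Real.exp_le_exp.2 (by linarith)
    have hgeom : z ^ (n - 1) * (1 - z) * n ≤ 1 := by
      have h2 : (∑ i ∈ Finset.range n, z ^ i) * (1 - z) = 1 - z ^ n := by
        linear_combination -geom_sum_mul z n
      have h3 : (n : ℝ) * z ^ (n - 1) ≤ ∑ i ∈ Finset.range n, z ^ i := by
        calc (n : ℝ) * z ^ (n - 1) = ∑ i ∈ Finset.range n, z ^ (n - 1) := by simp
          _ ≤ _ := Finset.sum_le_sum fun i hi =>
            pow_le_pow_of_le_one h0.le h1 (by have := Finset.mem_range.1 hi; omega)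
      have h4 : 0 ≤ 1 - z := by linarith
      have h5 := mul_le_mul_of_nonneg_right h3 h4
      have h6 : 0 ≤ z ^ n := by positivity
      linarith
    have hpow : z ^ (n + 1) * ((1 - z) / z) = z ^ (n - 1) * (1 - z) * z := by
      obtain ⟨m, rfl⟩ : ∃ m, n = m + 1 := ⟨n - 1, by omega⟩
      rw [Nat.add_sub_cancel, show z ^ (m + 1 + 1) = z ^ m * z * z by ring]
      field_simp
    have hz8 : z ^ (-(1 / 8) : ℝ) * z ^ (-(1 / 8) : ℝ) * z ≤ 1 := by
      nth_rewrite 3 [← Real.rpow_one z]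
      rw [← Real.rpow_add h0, ← Real.rpow_add h0]
      exact Real.rpow_le_one h0.le h1 (by norm_num)
    have hg : z ^ (n - 1) * (1 - z) ≤ 1 / n := by rwa [le_div_iff₀ hn0]
    have h1z : 0 ≤ 1 - z := by linarith
    rw [e, norm_mul, norm_mul, norm_pow, Complex.norm_real, Real.norm_of_nonneg h0.le]
    calc _ ≤ (C * z ^ (-(1 / 8) : ℝ)) * (z ^ (n + 1) * ((1 - z) / z * z ^ (-(1 / 8) : ℝ))) := by
          gcongr
          exact hC x hx
      _ = C * (z ^ (n - 1) * (1 - z)) * (z ^ (-(1 / 8) : ℝ) * z ^ (-(1 / 8) : ℝ) * z) := by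
          linear_combination (C * z ^ (-(1 / 8) : ℝ) * z ^ (-(1 / 8) : ℝ)) * hpow
      _ ≤ C * (1 / n) * 1 := by gcongr
      _ = C / n := by ring
  have := norm_setIntegral_le_of_norm_le_const (μ := volume) (s := Set.Ioo (-1 : ℝ) 1)
    (by simp) hbound
  refine this.trans (le_of_eq ?_)
  simp only [Measure.real, Real.volume_Ioo]
  norm_num
  ring

/-- The Gamma quotient describing the moments of the Legendre function. -/
noncomputable def momentQuot (μ : ℂ) : ℂ → ℂ := gammaQuot 1 1 1 1 ((2 - μ) / 2) ((μ + 3) / 2)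

theorem moment_gammaQuotRegular (hμ : ∀ n : ℤ, μ ≠ n) :
    GammaQuotRegular 1 1 1 1 ((2 - μ) / 2) ((μ + 3) / 2) 0 := by
  have h1 : GammaRegular (0 + 1) := gammaRegular_of_re_pos (by simp)
  refine ⟨h1, h1, h1, h1, ?_, ?_⟩ <;> refine gammaRegular_of_not_int fun n hn => ?_
  · exact hμ (2 - 2 * n) (by push_cast; linear_combination -2 * hn)
  · exact hμ (2 * n - 3) (by push_cast; linear_combination 2 * hn)

/-- The quadratic in the moment recurrence factors as 4(s+(2-μ)/2)(s+(μ+3)/2), so M and m satisfy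
the same first-order recurrence. -/
theorem logMoment_div_momentQuot_succ (hμ : ∀ n : ℤ, μ ≠ n) {s : ℂ} (hs : -(1 / 4) ≤ s.re)
    (hr : GammaQuotRegular 1 1 1 1 ((2 - μ) / 2) ((μ + 3) / 2) s) :
    logMoment μ 0 (s + 1) / momentQuot μ (s + 1) = logMoment μ 0 s / momentQuot μ s := by
  have h1 := logMoment_rec hμ hs
  have h2 := gammaQuot_add_one hr
  rw [← momentQuot] at h2
  have n1 : s + 1 ≠ 0 := by simpa using hr.a₁ 0
  have n2 : s + (2 - μ) / 2 ≠ 0 := by simpa using hr.b₂ 0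
  have n3 : s + (μ + 3) / 2 ≠ 0 := by simpa using hr.b₃ 0
  have m0 : momentQuot μ s ≠ 0 := gammaQuot_ne_zero hr
  have m1 : momentQuot μ (s + 1) ≠ 0 := by
    have := hr.natCast_add 1
    rw [Nat.cast_one, add_comm (1 : ℂ)] at this
    exact gammaQuot_ne_zero this
  rw [div_eq_div_iff m1 m0]
  have n4 : (s + 1) * ((s + (2 - μ) / 2) * (s + (μ + 3) / 2)) ≠ 0 :=
    mul_ne_zero n1 (mul_ne_zero n2 n3)
  refine mul_left_cancel₀ n4 ?_
  linear_combination -(s + 1) / 4 * momentQuot μ s * h1 - logMoment μ 0 s * h2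

theorem logMoment_div_momentQuot_add (hμ : ∀ n : ℤ, μ ≠ n) {s : ℂ} (hs : -(1 / 4) ≤ s.re)
    (hr : GammaQuotRegular 1 1 1 1 ((2 - μ) / 2) ((μ + 3) / 2) s) (n : ℕ) :
    logMoment μ 0 (n + s) / momentQuot μ (n + s) = logMoment μ 0 s / momentQuot μ s := by
  induction n with
  | zero => simp
  | succ n ih =>
    rw [← ih, ← logMoment_div_momentQuot_succ hμ (s := n + s) ?_ (hr.natCast_add n)]
    · push_cast
      rw [add_right_comm]
    · rw [Complex.add_re, Complex.natCast_re]
      linarith [(Nat.cast_nonneg n : (0 : ℝ) ≤ n)]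

theorem tendsto_momentQuot {r : ℝ}
    (hr : ∀ ε : ℂ, ‖ε‖ ≤ r → GammaQuotRegular 1 1 1 1 ((2 - μ) / 2) ((μ + 3) / 2) ε)
    {ε : ℂ} (hε : ‖ε‖ ≤ r) :
    Tendsto (fun n : ℕ => (((n : ℝ) ^ (1 / 2 : ℝ) : ℝ) : ℂ) * momentQuot μ (n + ε)) atTop
      (𝓝 1) := by
  obtain ⟨C, hC⟩ := gammaQuot_sub_rpow_le (σ := 1 / 2) hr (by push_cast; ring)
  rw [tendsto_iff_norm_sub_tendsto_zero]
  refine squeeze_zero' (Eventually.of_forall fun n => norm_nonneg _) ?_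
    (tendsto_const_div_atTop_nhds_zero_nat |C|)
  filter_upwards [eventually_ge_atTop 1] with n hn
  have hn0 : (0 : ℝ) < n := by exact_mod_cast hn
  have e : (((n : ℝ) ^ (1 / 2 : ℝ) : ℝ) : ℂ) * momentQuot μ (n + ε) - 1 =
      (((n : ℝ) ^ (1 / 2 : ℝ) : ℝ) : ℂ) * (momentQuot μ (n + ε) -
        (((n : ℝ) ^ (-(1 / 2) : ℝ) : ℝ) : ℂ)) := by
    rw [mul_sub, ← Complex.ofReal_mul, ← Real.rpow_add hn0]
    simp
  rw [e, norm_mul, Complex.norm_real, Real.norm_of_nonneg (by positivity)]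
  have h1 : ((n : ℝ) + 1) ^ (-(1 / 2) - 1 : ℝ) ≤ (n : ℝ) ^ (-(3 / 2) : ℝ) := by
    rw [show (-(1 / 2) - 1 : ℝ) = -(3 / 2) by norm_num]
    exact Real.rpow_le_rpow_of_nonpos hn0 (by linarith) (by norm_num)
  calc _ ≤ (n : ℝ) ^ (1 / 2 : ℝ) * (|C| * (n : ℝ) ^ (-(3 / 2) : ℝ)) := by
        gcongr
        exact (hC n ε hε).trans (mul_le_mul (le_abs_self C) h1 (by positivity) (abs_nonneg C))
    _ = |C| * ((n : ℝ) ^ (1 / 2 : ℝ) * (n : ℝ) ^ (-(3 / 2) : ℝ)) := by ring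
    _ = |C| / n := by
        rw [← Real.rpow_add hn0, show (1 / 2 + -(3 / 2) : ℝ) = -1 by norm_num, Real.rpow_neg_one]
        rfl

/-- M/m is 1-periodic. M(n+ε) and M(n) differ by O(1/n), whereas m(n+ε) and m(n) are both asymptotic
to n^(-1/2). Multiplying by n^(1/2) and letting n → ∞ forces the ratios at ε and at 0 to agree. -/
theorem logMoment_eq (hμ : ∀ n : ℤ, μ ≠ n) {r : ℝ} (hr0 : 0 ≤ r) (hr8 : r ≤ 1 / 8)
    (hr : ∀ ε : ℂ, ‖ε‖ ≤ r → GammaQuotRegular 1 1 1 1 ((2 - μ) / 2) ((μ + 3) / 2) ε)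
    {ε : ℂ} (hε : ‖ε‖ ≤ r) (k : ℕ) :
    logMoment μ 0 (k + ε) = logMoment μ 0 0 / momentQuot μ 0 * momentQuot μ (k + ε) := by
  have hre := (abs_le.1 ((Complex.abs_re_le_norm ε).trans (hε.trans hr8))).1
  have hεre : -(1 / 4) ≤ ε.re := by linarith
  have h0 := hr 0 (by simpa using hr0)
  have A := logMoment_div_momentQuot_add hμ hεre (hr ε hε)
  have B := logMoment_div_momentQuot_add hμ (s := 0) (by norm_num) h0
  simp only [add_zero] at B
  have hm (n : ℕ) : momentQuot μ (n + ε) ≠ 0 := gammaQuot_ne_zero ((hr ε hε).natCast_add n)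
  have hm0 (n : ℕ) : momentQuot μ n ≠ 0 := gammaQuot_ne_zero (h0.natCast n)
  have key : logMoment μ 0 ε / momentQuot μ ε = logMoment μ 0 0 / momentQuot μ 0 := by
    have t1 := (tendsto_momentQuot hr hε).const_mul (logMoment μ 0 ε / momentQuot μ ε)
    have t2 := (tendsto_momentQuot hr (ε := 0) (by simpa using hr0)).const_mul
      (logMoment μ 0 0 / momentQuot μ 0)
    simp only [add_zero] at t2
    have t3 := (t1.sub t2).comp (tendsto_add_atTop_nat 1)
    obtain ⟨C, hC0, hC⟩ := norm_logMoment_sub_le hμ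
    have t4 : Tendsto (fun n : ℕ => 2 * C * (n : ℝ) ^ (-(1 / 2) : ℝ)) atTop (𝓝 0) := by
      simpa using ((tendsto_rpow_neg_atTop (show (0 : ℝ) < 1 / 2 by norm_num)).comp
        tendsto_natCast_atTop_atTop).const_mul (2 * C)
    have t5 := squeeze_zero_norm' (f := fun n : ℕ => (((((n + 1 : ℕ) : ℝ) ^ (1 / 2 : ℝ) : ℝ) : ℂ) *
      (logMoment μ 0 ((n + 1 : ℕ) + ε) - logMoment μ 0 (n + 1 : ℕ)))) (by
        filter_upwards [eventually_ge_atTop 1] with n hn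
        have hn0 : (0 : ℝ) < n := by exact_mod_cast hn
        have hn1 : (1 : ℝ) ≤ n := by exact_mod_cast hn
        have h2 : ((n + 1 : ℕ) : ℝ) ^ (1 / 2 : ℝ) ≤ 2 * (n : ℝ) ^ (1 / 2 : ℝ) := by
          calc _ ≤ (4 * (n : ℝ)) ^ (1 / 2 : ℝ) := by
                gcongr
                push_cast
                linarith
            _ = _ := by
              rw [Real.mul_rpow (by norm_num) hn0.le, ← Real.sqrt_eq_rpow,
                show (4 : ℝ) = 2 ^ 2 by norm_num, Real.sqrt_sq (by norm_num)]
        rw [norm_mul, Complex.norm_real, Real.norm_of_nonneg (by positivity)]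
        calc _ ≤ (2 * (n : ℝ) ^ (1 / 2 : ℝ)) * (C / n) := by
              gcongr
              exact hC n hn ε (hε.trans hr8)
          _ = 2 * C * ((n : ℝ) ^ (1 / 2 : ℝ) * (n : ℝ) ^ (-1 : ℝ)) := by
              rw [Real.rpow_neg_one]
              ring
          _ = _ := by
              rw [← Real.rpow_add hn0]
              norm_num) t4
    have := tendsto_nhds_unique t3 (t5.congr fun n => by
      simp only [Function.comp_apply]
      have a := A (n + 1)
      have b := B (n + 1)
      rw [div_eq_iff (hm (n + 1))] at a
      rw [div_eq_iff (hm0 (n + 1))] at b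
      rw [a, b]
      ring)
    rw [mul_one, mul_one] at this
    exact sub_eq_zero.1 this
  have a := A k
  rw [key, div_eq_iff (hm k)] at a
  exact a
end

/-! ### The hypergeometric family and termwise integration. -/

/-- Termwise first and second derivatives of a normally convergent series of holomorphic
functions. -/
theorem hasSum_deriv_deriv_of_summable {F : ℕ → ℂ → ℂ} {u : ℕ → ℝ} {r : ℝ} (hr : 0 < r)
    (hu : Summable u) (hF : ∀ k, DifferentiableOn ℂ (F k) (Metric.ball 0 r))
    (hb : ∀ k, ∀ w ∈ Metric.ball (0 : ℂ) r, ‖F k w‖ ≤ u k) :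
    DifferentiableOn ℂ (fun w => ∑' k, F k w) (Metric.ball 0 r) ∧
    HasSum (fun k => deriv (F k) 0) (deriv (fun w => ∑' k, F k w) 0) ∧
    HasSum (fun k => deriv (deriv (F k)) 0) (deriv (deriv fun w => ∑' k, F k w) 0) := by
  have hd {w : ℂ} (hw : w ∈ Metric.ball (0 : ℂ) r) :
      HasSum (fun k => deriv (F k) w) (deriv (fun w => ∑' k, F k w) w) :=
    Complex.hasSum_deriv_of_summable_norm hu hF Metric.isOpen_ball hb hw
  have h0 : (0 : ℂ) ∈ Metric.ball (0 : ℂ) (r / 2) := Metric.mem_ball_self (by positivity)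
  have hsub : Metric.ball (0 : ℂ) (r / 2) ⊆ Metric.ball 0 r :=
    Metric.ball_subset_ball (by linarith)
  refine ⟨Complex.differentiableOn_tsum_of_summable_norm hu hF Metric.isOpen_ball hb,
    hd (Metric.mem_ball_self hr), ?_⟩
  have hb' : ∀ k, ∀ w ∈ Metric.ball (0 : ℂ) (r / 2), ‖deriv (F k) w‖ ≤ u k / (r / 4) := by
    intro k w hw
    have hc : Metric.closedBall w (r / 4) ⊆ Metric.ball 0 r := by
      refine Metric.closedBall_subset_ball' ?_
      have : dist w 0 < r / 2 := hw
      linarith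
    refine Complex.norm_deriv_le_of_forall_mem_sphere_norm_le (by positivity) ?_
      fun s hs => hb k s (hc (Metric.sphere_subset_closedBall hs))
    refine DifferentiableOn.diffContOnCl ?_
    rw [closure_ball _ (by positivity : r / 4 ≠ 0)]
    exact (hF k).mono hc
  have hd2 := Complex.hasSum_deriv_of_summable_norm (hu.div_const (r / 4))
    (fun k => ((hF k).deriv Metric.isOpen_ball).mono hsub) Metric.isOpen_ball hb' h0
  have he : (fun w => ∑' k, deriv (F k) w) =ᶠ[𝓝 0] deriv fun w => ∑' k, F k w := by
    filter_upwards [Metric.isOpen_ball.mem_nhds h0] with w hw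
    exact (hd (hsub hw)).tsum_eq
  rwa [he.deriv_eq] at hd2

/-- The Gamma quotient whose shifted sum is the normalized hypergeometric family. -/
noncomputable def familyQuot (μ ν : ℂ) : ℂ → ℂ :=
  gammaQuot (1 / 2) (-ν) (ν + 1) 1 ((2 - μ) / 2) ((μ + 3) / 2)

section
variable {μ ν : ℂ}

theorem cCoeff_eq_familyQuot (μ ν ε : ℂ) : cCoeff μ ν ε = familyQuot μ ν ε := by
  rw [cCoeff, familyQuot, gammaQuot]
  simp only [add_comm ε]

theorem hypergeometricTerm_eq {ε : ℂ}
    (h : GammaQuotRegular (1 / 2) (-ν) (ν + 1) 1 ((2 - μ) / 2) ((μ + 3) / 2) ε) (k : ℕ) :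
    hypergeometricTerm (upperParams ν ε) (lowerParams μ ε) 1 k =
      familyQuot μ ν (k + ε) / familyQuot μ ν ε := by
  have e {c : ℂ} (hc : GammaRegular (ε + c)) : (ascPochhammer ℂ k).eval (c + ε) =
      Complex.Gamma (k + ε + c) / Complex.Gamma (ε + c) := by
    rw [add_comm c, ← Complex.Gamma_add_nat_div_Gamma_eq _ hc]
    ring_nf
  have g {t : ℂ} (h : GammaRegular t) := Complex.Gamma_ne_zero h
  have hk := h.natCast_add k
  have hf : (k.factorial : ℂ) ≠ 0 := by exact_mod_cast k.factorial_ne_zero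
  simp only [hypergeometricTerm, upperParams, lowerParams, List.map_cons, List.map_nil,
    List.prod_cons, List.prod_nil, mul_one, one_pow, ascPochhammer_eval_one]
  rw [e h.a₁, e h.a₂, e h.a₃, e h.b₁, e h.b₂, e h.b₃, familyQuot, gammaQuot, gammaQuot]
  have := g h.a₁; have := g h.a₂; have := g h.a₃; have := g h.b₁; have := g h.b₂; have := g h.b₃
  have := g hk.b₁; have := g hk.b₂; have := g hk.b₃
  field_simp

/-- The surplus Γ(s+1)² below in a(s) cancels against m(s). This cancellation is why the moments
turn the Frobenius series into the ₄F₃. -/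
theorem symSqQuot_mul_momentQuot {s : ℂ}
    (h : GammaQuotRegular (1 / 2) (-ν) (ν + 1) 1 ((2 - μ) / 2) ((μ + 3) / 2) s) :
    symSqQuot ν s * momentQuot μ s = familyQuot μ ν s := by
  have g {t : ℂ} (h : GammaRegular t) := Complex.Gamma_ne_zero h
  have := g h.b₁; have := g h.b₂; have := g h.b₃
  rw [symSqQuot, momentQuot, familyQuot, gammaQuot, gammaQuot, gammaQuot]
  field_simp

theorem exists_regular_radius (hμ : ∀ n : ℤ, μ ≠ n) (hν : ∀ n : ℤ, ν ≠ n) :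
    ∃ r : ℝ, 0 < r ∧ r ≤ 1 / 8 ∧ ∀ ε : ℂ, ‖ε‖ ≤ r →
      GammaQuotRegular (1 / 2) (-ν) (ν + 1) 1 1 1 ε ∧
      GammaQuotRegular 1 1 1 1 ((2 - μ) / 2) ((μ + 3) / 2) ε ∧
      GammaQuotRegular (1 / 2) (-ν) (ν + 1) 1 ((2 - μ) / 2) ((μ + 3) / 2) ε := by
  obtain ⟨r₁, h1, hr1⟩ := (symSq_gammaQuotRegular hν).exists_radius
  obtain ⟨r₂, h2, hr2⟩ := (moment_gammaQuotRegular hμ).exists_radius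
  refine ⟨min (min r₁ r₂) (1 / 8), by positivity, min_le_right _ _, fun ε hε => ?_⟩
  have a := hr1 ε (hε.trans ((min_le_left _ _).trans (min_le_left _ _)))
  have b := hr2 ε (hε.trans ((min_le_left _ _).trans (min_le_right _ _)))
  exact ⟨a, b, a.a₁, a.a₂, a.a₃, a.b₁, b.b₂, b.b₃⟩

/-- The lower parameters exceed the upper ones by 2 in total, independently of μ and ν, so the terms
decay like k^(-2) uniformly in ε. -/
theorem exists_summable_familyQuot {r : ℝ}
    (hr : ∀ ε : ℂ, ‖ε‖ ≤ r →
      GammaQuotRegular (1 / 2) (-ν) (ν + 1) 1 ((2 - μ) / 2) ((μ + 3) / 2) ε) :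
    ∃ u : ℕ → ℝ, Summable u ∧ ∀ k : ℕ, ∀ ε : ℂ, ‖ε‖ ≤ r → ‖familyQuot μ ν (k + ε)‖ ≤ u k := by
  obtain ⟨C, -, hC⟩ := gammaQuot_le (σ := 2) (by norm_num) hr (by push_cast; ring)
  exact ⟨_, (summable_add_one_rpow (s := 2) (by norm_num)).mul_left C, hC⟩

theorem normalizedFamily_eq {ε : ℂ}
    (h : GammaQuotRegular (1 / 2) (-ν) (ν + 1) 1 ((2 - μ) / 2) ((μ + 3) / 2) ε) :
    normalizedFamily μ ν ε = (∑' k : ℕ, familyQuot μ ν (k + ε)) / familyQuot μ ν 0 := by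
  have h0 : familyQuot μ ν ε ≠ 0 := gammaQuot_ne_zero h
  rw [normalizedFamily, hypergeometricPFQ, cCoeff_eq_familyQuot, cCoeff_eq_familyQuot]
  simp only [hypergeometricTerm_eq h]
  rw [tsum_div_const]
  field_simp

/-- Products of the derivatives of the coefficients with logarithmic moments. -/
theorem jet_mul_logMoment (hμ : ∀ n : ℤ, μ ≠ n) {r : ℝ} (hr0 : 0 < r) (hr8 : r ≤ 1 / 8)
    (hr : ∀ ε : ℂ, ‖ε‖ ≤ r → GammaQuotRegular (1 / 2) (-ν) (ν + 1) 1 1 1 ε ∧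
      GammaQuotRegular 1 1 1 1 ((2 - μ) / 2) ((μ + 3) / 2) ε ∧
      GammaQuotRegular (1 / 2) (-ν) (ν + 1) 1 ((2 - μ) / 2) ((μ + 3) / 2) ε) (k : ℕ) :
    deriv (symSqQuot ν) k * logMoment μ 0 k + symSqQuot ν k * logMoment μ 1 k =
      logMoment μ 0 0 / momentQuot μ 0 * deriv (familyQuot μ ν) k ∧
    deriv (deriv (symSqQuot ν)) k * logMoment μ 0 k +
      2 * deriv (symSqQuot ν) k * logMoment μ 1 k + symSqQuot ν k * logMoment μ 2 k =
      logMoment μ 0 0 / momentQuot μ 0 * deriv (deriv (familyQuot μ ν)) k := by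
  set U := Metric.ball (k : ℂ) r with hU
  have hUo : IsOpen U := Metric.isOpen_ball
  have hk : (k : ℂ) ∈ U := Metric.mem_ball_self hr0
  have hn (s : ℂ) (hs : s ∈ U) : ‖s - k‖ < r := by
    rw [← dist_eq_norm]
    exact hs
  have hre (s : ℂ) (hs : s ∈ U) : -(1 / 8) < s.re := by
    have h1 := (abs_lt.1 ((Complex.abs_re_le_norm (s - k)).trans_lt (hn s hs))).1
    rw [Complex.sub_re, Complex.natCast_re] at h1
    linarith [(Nat.cast_nonneg k : (0 : ℝ) ≤ k)]
  have hs1 (s : ℂ) (hs : s ∈ U) : GammaQuotRegular (1 / 2) (-ν) (ν + 1) 1 1 1 s := by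
    simpa using (hr _ (hn s hs).le).1.natCast_add k
  have hs2 (s : ℂ) (hs : s ∈ U) :
      GammaQuotRegular (1 / 2) (-ν) (ν + 1) 1 ((2 - μ) / 2) ((μ + 3) / 2) s := by
    simpa using (hr _ (hn s hs).le).2.2.natCast_add k
  have da : DifferentiableOn ℂ (symSqQuot ν) U := fun s hs =>
    (differentiableAt_gammaQuot (hs1 s hs)).differentiableWithinAt
  have dg : DifferentiableOn ℂ (familyQuot μ ν) U := fun s hs =>
    (differentiableAt_gammaQuot (hs2 s hs)).differentiableWithinAt
  have d0 {f : ℂ → ℂ} (hf : DifferentiableOn ℂ f U) (s : ℂ) (hs : s ∈ U) :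
      HasDerivAt f (deriv f s) s := (hf.differentiableAt (hUo.mem_nhds hs)).hasDerivAt
  -- This identity holds on a whole disc around k, so it may be differentiated twice by the Leibniz
  -- rule, each derivative of the moment adding a logarithm.
  have e0 : ∀ s ∈ U, symSqQuot ν s * logMoment μ 0 s =
      logMoment μ 0 0 / momentQuot μ 0 * familyQuot μ ν s := by
    intro s hs
    have h1 := logMoment_eq hμ hr0.le hr8 (fun ε hε => (hr ε hε).2.1) (hn s hs).le k
    rw [add_sub_cancel] at h1
    rw [h1, ← symSqQuot_mul_momentQuot (hs2 s hs)]
    ring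
  have e1 : ∀ s ∈ U, deriv (symSqQuot ν) s * logMoment μ 0 s + symSqQuot ν s * logMoment μ 1 s =
      logMoment μ 0 0 / momentQuot μ 0 * deriv (familyQuot μ ν) s := by
    intro s hs
    have l := (d0 da s hs).mul (hasDerivAt_logMoment hμ (j := 0) (by norm_num) (hre s hs))
    have r := (d0 dg s hs).const_mul (logMoment μ 0 0 / momentQuot μ 0)
    exact l.unique (r.congr_of_eventuallyEq (by
      filter_upwards [hUo.mem_nhds hs] with t ht using e0 t ht))
  refine ⟨e1 k hk, ?_⟩
  have l := ((d0 (da.deriv hUo) k hk).mul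
    (hasDerivAt_logMoment hμ (j := 0) (by norm_num) (hre k hk))).add
    ((d0 da k hk).mul (hasDerivAt_logMoment hμ (j := 1) (by norm_num) (hre k hk)))
  have r := (d0 (dg.deriv hUo) k hk).const_mul (logMoment μ 0 0 / momentQuot μ 0)
  have e := l.unique (r.congr_of_eventuallyEq (by
    filter_upwards [hUo.mem_nhds hk] with t ht using e1 t ht))
  rw [zero_add, one_add_one_eq_two] at e
  linear_combination e

/-- Termwise integration of logarithmic series against the Legendre function. -/
theorem hasSum_integral_logSum (hμ : ∀ n : ℤ, μ ≠ n) {α : Fin 3 → ℕ → ℂ} {C : ℝ}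
    (hα : ∀ j k, ‖α j k‖ ≤ C * ((k : ℝ) + 1) ^ (-(3 / 2) : ℝ)) :
    HasSum (fun k : ℕ => α 2 k * logMoment μ 0 k + 2 * α 1 k * logMoment μ 1 k +
      α 0 k * logMoment μ 2 k)
      (∫ x, legendreFn μ x * logSum α (1 - x ^ 2) ∂cutMeasure) := by
  let F : ℕ → ℝ → ℂ := fun k x => α 2 k * momentIntegrand μ 0 k x +
    2 * α 1 k * momentIntegrand μ 1 k x + α 0 k * momentIntegrand μ 2 k x
  have hk (k : ℕ) : -(1 / 4) ≤ (k : ℂ).re := by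
    rw [Complex.natCast_re]
    linarith [(Nat.cast_nonneg k : (0 : ℝ) ≤ k)]
  have i0 (k : ℕ) := (integrable_momentIntegrand hμ (j := 0) (by norm_num) (hk k)).const_mul (α 2 k)
  have i1 (k : ℕ) := (integrable_momentIntegrand hμ (j := 1) (by norm_num) (hk k)).const_mul
    (2 * α 1 k)
  have i2 (k : ℕ) := (integrable_momentIntegrand hμ (j := 2) (by norm_num) (hk k)).const_mul (α 0 k)
  have hFi (k : ℕ) : Integrable (F k) cutMeasure := ((i0 k).add (i1 k)).add (i2 k)
  have hFint (k : ℕ) : ∫ x, F k x ∂cutMeasure = α 2 k * logMoment μ 0 k +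
      2 * α 1 k * logMoment μ 1 k + α 0 k * logMoment μ 2 k := by
    have h1 := integral_add ((i0 k).add (i1 k)) (i2 k)
    have h2 := integral_add (i0 k) (i1 k)
    simp only [Pi.add_apply] at h1
    rw [h2, integral_const_mul, integral_const_mul, integral_const_mul] at h1
    exact h1
  have hsu : Summable fun k : ℕ => C * ((k : ℝ) + 1) ^ (-(3 / 2) : ℝ) :=
    (summable_add_one_rpow (by norm_num)).mul_left C
  have hsum : Summable fun k => ∫ x, ‖F k x‖ ∂cutMeasure := by
    obtain ⟨D, hD0, hD⟩ := momentIntegrand_le hμ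
    refine Summable.of_nonneg_of_le (fun k => integral_nonneg fun x => norm_nonneg _) (fun k => ?_)
      (hsu.mul_right (∫ x, 4 * (D * (1 - x ^ 2) ^ (-(1 / 2) : ℝ)) ∂cutMeasure))
    rw [← integral_const_mul]
    refine integral_mono_ae (hFi k).norm
      (((integrable_one_sub_sq_rpow.const_mul D).const_mul 4).const_mul _) ?_
    filter_upwards [ae_restrict_mem measurableSet_Ioo] with x hx
    have b (j : Fin 3) (i : ℕ) (hi : i ≤ 2) : ‖α j k‖ * ‖momentIntegrand μ i k x‖ ≤
        C * ((k : ℝ) + 1) ^ (-(3 / 2) : ℝ) * (D * (1 - x ^ 2) ^ (-(1 / 2) : ℝ)) :=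
      mul_le_mul (hα j k) (hD x hx i hi k (hk k)) (norm_nonneg _)
        ((norm_nonneg _).trans (hα j k))
    have b0 := b 2 0 (by norm_num)
    have b1 := b 1 1 (by norm_num)
    have b2 := b 0 2 (by norm_num)
    calc ‖F k x‖ ≤ ‖α 2 k‖ * ‖momentIntegrand μ 0 k x‖ +
          2 * (‖α 1 k‖ * ‖momentIntegrand μ 1 k x‖) + ‖α 0 k‖ * ‖momentIntegrand μ 2 k x‖ := by
          refine (norm_add_le _ _).trans (add_le_add ((norm_add_le _ _).trans
            (add_le_add ?_ ?_)) ?_)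
          · rw [norm_mul]
          · rw [norm_mul, norm_mul, Complex.norm_ofNat, mul_assoc]
          · rw [norm_mul]
      _ ≤ _ := by linarith
  have key := hasSum_integral_of_summable_integral_norm hFi hsum
  simp only [hFint] at key
  convert! key using 1
  refine integral_congr_ae ?_
  filter_upwards [ae_restrict_mem measurableSet_Ioo] with x hx
  have h0 := one_sub_sq_pos hx
  have h1 : 1 - x ^ 2 ≤ 1 := by nlinarith
  have hs (j : Fin 3) : Summable fun k => α j k * ((1 - x ^ 2 : ℝ) : ℂ) ^ k := by
    refine .of_norm_bounded hsu fun k => ?_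
    rw [norm_mul, norm_pow, Complex.norm_real, Real.norm_of_nonneg h0.le]
    exact (mul_le_of_le_one_right (norm_nonneg _) (pow_le_one₀ h0.le h1)).trans (hα j k)
  have hterm : HasSum (fun k => F k x) (legendreFn μ x * logSum α (1 - x ^ 2)) := by
    have h := (((hs 2).hasSum.add ((hs 1).hasSum.mul_left (2 * logOneSubSq x))).add
      ((hs 0).hasSum.mul_left (logOneSubSq x ^ 2))).mul_left (legendreFn μ x)
    convert! h using 1
    funext k
    simp only [F, momentIntegrand, exp_natCast_mul_logOneSubSq hx]
    ring
  exact hterm.tsum_eq.symm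

/-! ### Integrability, and reduction of both integrals to logarithmic series. -/

/-- Continuous functions on `(-1, 1)` with at most mild endpoint singularities. -/
structure MildlySingular (f : ℝ → ℂ) : Prop where
  continuousOn : ContinuousOn f (Set.Ioo (-1) 1)
  bound : ∃ C : ℝ, 0 ≤ C ∧ ∀ x ∈ Set.Ioo (-1 : ℝ) 1, ‖f x‖ ≤ C * (1 - x ^ 2) ^ (-(1 / 8) : ℝ)

theorem mildlySingular_legendreFn (hν : ∀ n : ℤ, ν ≠ n) : MildlySingular (legendreFn ν) :=
  ⟨continuousOn_legendreFn hν, norm_legendreFn_le_rpow hν⟩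

theorem MildlySingular.comp_neg {f : ℝ → ℂ} (hf : MildlySingular f) :
    MildlySingular fun x => f (-x) := by
  have hneg {x : ℝ} (hx : x ∈ Set.Ioo (-1 : ℝ) 1) : -x ∈ Set.Ioo (-1 : ℝ) 1 :=
    ⟨by linarith [hx.2], by linarith [hx.1]⟩
  obtain ⟨C, hC0, hC⟩ := hf.bound
  refine ⟨hf.continuousOn.comp continuous_neg.continuousOn fun x hx => hneg hx, C, hC0,
    fun x hx => ?_⟩
  simpa using hC (-x) (hneg hx)

theorem MildlySingular.integrable_mul {f g h : ℝ → ℂ} (hf : MildlySingular f)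
    (hg : MildlySingular g) (hh : MildlySingular h) :
    Integrable (fun x => f x * g x * h x) cutMeasure := by
  obtain ⟨A, hA0, hA⟩ := hf.bound
  obtain ⟨B, hB0, hB⟩ := hg.bound
  obtain ⟨C, hC0, hC⟩ := hh.bound
  refine integrable_cutMeasure_of_le (C := A * B * C)
    ((hf.continuousOn.mul hg.continuousOn).mul hh.continuousOn) fun x hx => ?_
  have h0 := one_sub_sq_pos hx
  have h1 : 1 - x ^ 2 ≤ 1 := by nlinarith
  rw [norm_mul, norm_mul]
  calc _ ≤ (A * (1 - x ^ 2) ^ (-(1 / 8) : ℝ)) * (B * (1 - x ^ 2) ^ (-(1 / 8) : ℝ)) *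
        (C * (1 - x ^ 2) ^ (-(1 / 8) : ℝ)) := by
        gcongr
        · exact hA x hx
        · exact hB x hx
        · exact hC x hx
    _ = A * B * C * (1 - x ^ 2) ^ (-(1 / 8) + -(1 / 8) + -(1 / 8) : ℝ) := by
        rw [Real.rpow_add h0, Real.rpow_add h0]
        ring
    _ ≤ _ := by
        gcongr A * B * C * ?_
        exact Real.rpow_le_rpow_of_exponent_ge h0 h1 (by norm_num)

/-- The product formulas are proved only for 0 < x < 1. Evenness in x carries them to -1 < x < 0,
and the origin is negligible. -/
theorem ae_cutMeasure_of_even {p : ℝ → Prop} (h : ∀ x ∈ Set.Ioo (0 : ℝ) 1, p x ∧ p (-x)) :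
    ∀ᵐ x ∂cutMeasure, p x := by
  have h0 : ∀ᵐ x ∂cutMeasure, x ≠ 0 :=
    compl_mem_ae_iff.2 (measure_singleton (0 : ℝ))
  filter_upwards [ae_restrict_mem measurableSet_Ioo, h0] with x hx hx0
  rcases lt_or_gt_of_ne hx0 with hlt | hgt
  · simpa using (h (-x) ⟨by linarith, by linarith [hx.1]⟩).2
  · exact (h x ⟨hgt, hx.2⟩).1

theorem integrable_cgIntegrandT (hμ : ∀ n : ℤ, μ ≠ n) (hν : ∀ n : ℤ, ν ≠ n) :
    Integrable (cgIntegrandT μ ν) cutMeasure :=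
  (mildlySingular_legendreFn hμ).integrable_mul (mildlySingular_legendreFn hν)
    (mildlySingular_legendreFn hν).comp_neg

theorem integrable_cgIntegrandU (hμ : ∀ n : ℤ, μ ≠ n) (hν : ∀ n : ℤ, ν ≠ n) :
    Integrable (cgIntegrandU μ ν) cutMeasure := by
  have m := mildlySingular_legendreFn hμ
  have n := mildlySingular_legendreFn hν
  refine (((m.integrable_mul n n).add (m.comp_neg.integrable_mul n n)).div_const 2).congr
    (Eventually.of_forall fun x => ?_)
  simp only [Pi.add_apply, cgIntegrandU]
  ring

theorem cgT_eq_integral_logSum (hν : ∀ n : ℤ, ν ≠ n) :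
    cgT μ ν = sinDivPi ν / symSqQuot ν 0 *
      ∫ x, legendreFn μ x * logSum (logCoeffOne ν) (1 - x ^ 2) ∂cutMeasure := by
  rw [cgT, intervalIntegral_eq_cutMeasure, ← integral_const_mul]
  refine integral_congr_ae (ae_cutMeasure_of_even fun x hx => ?_)
  have h := legendreFn_mul_neg_eq hν x hx
  simp only [cgIntegrandT, neg_neg, neg_sq]
  exact ⟨by linear_combination legendreFn μ x * h, by linear_combination legendreFn μ (-x) * h⟩

/-- The substitution x ↦ -x moves the reflection from P_μ to P_ν, so U = (1/2)∫ P_μ(x)(P_ν(x)² +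
P_ν(-x)²) dx. -/
theorem cgU_eq_integral_logSum (hμ : ∀ n : ℤ, μ ≠ n) (hν : ∀ n : ℤ, ν ≠ n) :
    cgU μ ν = 1 / 2 * (sinDivPi ν ^ 2 / symSqQuot ν 0) *
      ∫ x, legendreFn μ x * logSum (logCoeffTwo ν) (1 - x ^ 2) ∂cutMeasure := by
  have m := mildlySingular_legendreFn hμ
  have n := mildlySingular_legendreFn hν
  have i1 := m.integrable_mul n n
  have i2 := m.comp_neg.integrable_mul n n
  have i3 := m.integrable_mul n.comp_neg n.comp_neg
  have hswap : ∫ x, legendreFn μ (-x) * legendreFn ν x * legendreFn ν x ∂cutMeasure =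
      ∫ x, legendreFn μ x * legendreFn ν (-x) * legendreFn ν (-x) ∂cutMeasure := by
    have h := intervalIntegral.integral_comp_neg (a := -1) (b := 1)
      fun x => legendreFn μ x * legendreFn ν (-x) * legendreFn ν (-x)
    simp only [neg_neg] at h
    rwa [intervalIntegral_eq_cutMeasure, intervalIntegral_eq_cutMeasure] at h
  have hU : cgU μ ν = 1 / 2 * ∫ x, (legendreFn μ x * legendreFn ν x * legendreFn ν x +
      legendreFn μ (-x) * legendreFn ν x * legendreFn ν x) ∂cutMeasure := by
    rw [cgU, intervalIntegral_eq_cutMeasure, ← integral_const_mul]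
    refine integral_congr_ae (Eventually.of_forall fun x => ?_)
    simp only [cgIntegrandU]
    ring
  rw [hU, integral_add i1 i2, hswap, ← integral_add i1 i3, mul_assoc, ← integral_const_mul (
    sinDivPi ν ^ 2 / symSqQuot ν 0)]
  congr 1
  refine integral_congr_ae (ae_cutMeasure_of_even fun x hx => ?_)
  have h := legendreFn_sq_add_sq_eq hν x hx
  simp only [neg_neg, neg_sq]
  exact ⟨by linear_combination legendreFn μ x * h, by linear_combination legendreFn μ (-x) * h⟩

end

/-! ### Assembly of the two formulas. -/

theorem mainTheorem6 (μ ν : ℂ) (hμ : ∀ n : ℤ, μ ≠ n) (hν : ∀ n : ℤ, ν ≠ n) :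
    IntervalIntegrable (cgIntegrandT μ ν) MeasureTheory.volume (-1) 1 ∧
    IntervalIntegrable (cgIntegrandU μ ν) MeasureTheory.volume (-1) 1 ∧
    (∀ᶠ ε in 𝓝 (0 : ℂ),
      Summable (hypergeometricTerm (upperParams ν ε) (lowerParams μ ε) 1)) ∧
    AnalyticAt ℂ (normalizedFamily μ ν) 0 ∧
    cgT μ ν =
      2 * Complex.sin (μ * Real.pi) * Complex.sin (ν * Real.pi) /
        (μ * (μ + 1) * (Real.pi : ℂ) ^ 2) * deriv (normalizedFamily μ ν) 0 ∧
    cgU μ ν =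
      Complex.sin (μ * Real.pi) * Complex.sin (ν * Real.pi) ^ 2 /
        (μ * (μ + 1) * (Real.pi : ℂ) ^ 3) * iteratedDeriv 2 (normalizedFamily μ ν) 0 := by
  obtain ⟨r, hr0, hr8, hr⟩ := exists_regular_radius hμ hν
  obtain ⟨u, hu, hub⟩ := exists_summable_familyQuot fun ε hε => (hr ε hε).2.2
  have hball : ∀ ε ∈ Metric.ball (0 : ℂ) r, ‖ε‖ ≤ r := fun ε hε =>
    (mem_ball_zero_iff.1 hε).le
  obtain ⟨hdG, hs1, hs2⟩ := hasSum_deriv_deriv_of_summable (F := fun k ε => familyQuot μ ν (k + ε))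
    hr0 hu (fun k ε hε => by
      have := differentiableAt_gammaQuot ((hr ε (hball ε hε)).2.2.natCast_add k)
      exact (this.comp ε (differentiableAt_id.const_add (k : ℂ))).differentiableWithinAt)
    fun k ε hε => hub k ε (hball ε hε)
  have e2 (k : ℕ) : deriv (deriv fun ε => familyQuot μ ν (k + ε)) 0 =
      deriv (deriv (familyQuot μ ν)) k := by
    have e : (deriv fun ε => familyQuot μ ν (k + ε)) =
        fun ε => deriv (familyQuot μ ν) (k + ε) := funext fun ε => deriv_comp_const_add _ _ _
    rw [e, deriv_comp_const_add, add_zero]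
  simp only [deriv_comp_const_add, add_zero] at hs1
  simp only [e2] at hs2
  set G : ℂ → ℂ := fun ε => ∑' k : ℕ, familyQuot μ ν (k + ε) with hG
  have hFe : normalizedFamily μ ν =ᶠ[𝓝 0] fun ε => G ε / familyQuot μ ν 0 := by
    filter_upwards [Metric.ball_mem_nhds (0 : ℂ) hr0] with ε hε
    exact normalizedFamily_eq (hr ε (hball ε hε)).2.2
  have hGa : AnalyticAt ℂ G 0 := hdG.analyticAt (Metric.ball_mem_nhds 0 hr0)
  have hF1 : deriv (normalizedFamily μ ν) 0 = deriv G 0 / familyQuot μ ν 0 := by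
    rw [hFe.deriv_eq, deriv_div_const]
  have hF2 : iteratedDeriv 2 (normalizedFamily μ ν) 0 = deriv (deriv G) 0 / familyQuot μ ν 0 := by
    rw [iteratedDeriv_two_eq, hFe.deriv.deriv_eq]
    have e : (deriv fun ε => G ε / familyQuot μ ν 0) = fun ε => deriv G ε / familyQuot μ ν 0 :=
      funext fun ε => deriv_div_const _
    rw [e, deriv_div_const]
  have h0 := hr 0 (by simpa using hr0.le)
  have hg0 := symSqQuot_mul_momentQuot h0.2.2
  have ha0 : symSqQuot ν 0 ≠ 0 := gammaQuot_ne_zero h0.1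
  have hm0 : momentQuot μ 0 ≠ 0 := gammaQuot_ne_zero h0.2.1
  have hM := logMoment_zero_mul hμ
  have hμ0 : μ ≠ 0 := by simpa using hμ 0
  have hμ1 : μ + 1 ≠ 0 := fun h => hμ (-1) (by push_cast; linear_combination h)
  have hpi : (Real.pi : ℂ) ≠ 0 := by exact_mod_cast Real.pi_ne_zero
  have hM' : logMoment μ 0 0 = 2 * sinDivPi μ / (μ * (μ + 1)) := by
    field_simp
    linear_combination hM
  obtain ⟨C, hC0, hC⟩ := symSq_coeff_bounds hν
  have hbw (k : ℕ) : 0 ≤ C * ((k : ℝ) + 1) ^ (-(3 / 2) : ℝ) := by positivity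
  -- Termwise integration produces the k-th 1-jet of a(s)M(s), which is a constant multiple of
  -- c'(k). The sum of c'(k) over k is the derivative at 0 of G(ε) = ∑ c(k+ε).
  have hI1 : ∫ x, legendreFn μ x * logSum (logCoeffOne ν) (1 - x ^ 2) ∂cutMeasure =
      logMoment μ 0 0 / momentQuot μ 0 * deriv G 0 := by
    refine (hasSum_integral_logSum hμ (α := logCoeffOne ν) (C := C) fun j k => ?_).unique
      ((hs1.mul_left _).congr_fun fun k => ?_)
    · fin_cases j
      · simpa [logCoeffOne] using hbw k
      · have := (hC k).1
        simp only [logCoeffOne, Fin.mk_one, Matrix.cons_val, norm_div, Complex.norm_ofNat]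
        linarith [norm_nonneg (symSqQuot ν k)]
      · exact (hC k).2.1
    · rw [← (jet_mul_logMoment hμ hr0 hr8 hr k).1]
      simp only [logCoeffOne, Matrix.cons_val]
      ring
  have hI2 : ∫ x, legendreFn μ x * logSum (logCoeffTwo ν) (1 - x ^ 2) ∂cutMeasure =
      logMoment μ 0 0 / momentQuot μ 0 * deriv (deriv G) 0 := by
    refine (hasSum_integral_logSum hμ (α := logCoeffTwo ν) (C := C) fun j k => ?_).unique
      ((hs2.mul_left _).congr_fun fun k => ?_)
    · fin_cases j
      · exact (hC k).1
      · exact (hC k).2.1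
      · exact (hC k).2.2.1
    · rw [← (jet_mul_logMoment hμ hr0 hr8 hr k).2]
      simp only [logCoeffTwo, Matrix.cons_val]
  refine ⟨intervalIntegrable_iff_cutMeasure.2 (integrable_cgIntegrandT hμ hν),
    intervalIntegrable_iff_cutMeasure.2 (integrable_cgIntegrandU hμ hν), ?_, ?_, ?_, ?_⟩
  · filter_upwards [Metric.ball_mem_nhds (0 : ℂ) hr0] with ε hε
    have h := (Summable.of_norm_bounded hu fun k => hub k ε (hball ε hε)).div_const
      (familyQuot μ ν ε)
    exact h.congr fun k => (hypergeometricTerm_eq (hr ε (hball ε hε)).2.2 k).symm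
  · exact (hGa.div_const).congr hFe.symm
  -- The normalization c(0) equals a(0)m(0), so it cancels the 1/a(0) of the product formula and the
  -- 1/m(0) of the moments, leaving S_ν·M(0).
  · rw [cgT_eq_integral_logSum hν, hI1, hF1, hM', ← hg0, sinDivPi, sinDivPi]
    field_simp
  · rw [cgU_eq_integral_logSum hμ hν, hI2, hF2, hM', ← hg0, sinDivPi, sinDivPi]
    field_simp
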